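/- **Setting.** Manifolds are Hausdorff and countable at infinity. Let $X$ be a real analytic manifold of dimension $n$ and $\chi=\{M_1,\dots,M_\ell\}$ a finite family of closed real analytic submanifolds of $X$. For $q\in M_j$ let $\mathrm{NR}_q(M_j)$ be the set of those $M_k\ni q$ with $M_j\not\subseteq M_k$ and $M_k\not\subseteq M_j$. Let $\iota(M_j)$ be the intersection of all $M_k$ with $M_j\subsetneq M_k$, and $\iota(M_j)=X$ if there is no such $M_k$. Assume: - **H1.** Every $M_j$ is connected, and $M_j\ne M_k$ for $j\neq k$. - **H2.** For every $j$ and every $q\in M_j$ with $\mathrm{NR}_q(M_j)\neq\emptyset$, $\ \bigl(\bigcap_{M_k\in \mathrm{NR}_q(M_j)}T_qM_k\bigr)+T_qM_j=T_qX$. - **H3.** $M_j\neq\iota(M_j)$ for every $j$. For a closed submanifold $N$ of an analytic manifold $Y$, the normal deformation $\tilde Y_N$ is the analytic manifold with underlying set $\bigl(Y\times(\mathbb R\setminus\{0\})\bigr)\sqcup T_NY$, with projection $p:\tilde Y_N\to Y$ and parameter $t:\tilde Y_N\to\mathbb R$ (equal to $0$ exactly on $T_NY$). If $(y',y'')$ are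 local coordinates of $Y$ in which $N=\{y'=0\}$, then $\tilde Y_N$ has local coordinates $(x',x'',t)$ in which $p$ is $(x',x'',t)\mapsto(tx',x'')$ and which on $T_NY=\{t=0\}$ are given by $x'=dy'$, $x''=y''$. The multi-normal deformation of $X$ is defined recursively by $\tilde X_{M_1,\dots,M_k}=(\tilde X_{M_1,\dots,M_{k-1}})_{\tilde M_k}$ (starting from $X$), where $\tilde M_k$ is the closure in $\tilde X_{M_1,\dots,M_{k-1}}$ of the inverse image of $M_k$ in $\{t_1\neq0,\dots,t_{k-1}\ne0\}$. Put $\tilde X=\tilde X_{M_1,\dots,M_\ell}$, with its projection $p:\tilde X\to X$ and its parameters $t_1,\dots,t_\ell:\tilde X\to\mathbb R$, and $S=\{t_1=\dots=t_\ell=0\}\subset\tilde X$, $M=\bigcap_jM_j$. **Proposition 1.5.** There is a bijection $$\Phi:\ S\ \longrightarrow\ T_{M_1}\iota(M_1)\times_X\cdots\times_X T_{M_\ell}\iota(M_\ell)$$ onto the direct sum over $M$ of the normal bundles, with fibre $\bigoplus_j T_q\iota(M_j)/T_qM_j$ at $q\in M$, that is real analytic in both directions, is compatible with the projections to $X$,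 and is an isomorphism for the bundle structure that $S$ has in the local models of $\tilde X$, in the following sense. 1. Every point of $M$ lies in the domain $U$ of an *adapted* coordinate system $\varphi=(\varphi_1,\dots,\varphi_n)$ of $X$, that is, one for which there are $I_1,\dots,I_\ell\subseteq\{1,\dots,n\}$ with $M_j\cap U=\{\varphi_i=0,\ i\in I_j\}$ for all $j$. 2. For every adapted coordinate system $\varphi$ with sets $I_j$, put $J_i=\{j: i\in I_j\}$ and $t_{J_i}=\prod_{j\in J_i}t_j$. Then $p^{-1}(U)$ has analytic coordinates $(x_1,\dots,x_n,t_1,\dots,t_\ell)$, whose last $\ell$ components are the deformation parameters, which identify it with $\{(x,t)\in\mathbb R^n\times\mathbb R^\ell:\ (t_{J_i}x_i)_i\in\varphi(U)\}$ and in which $p$ is $(x,t)\mapsto(t_{J_1}x_1,\dots,t_{J_n}x_n)$. If $s\in S\cap p^{-1}(U)$ and $\Phi(s)=([v_j])_j$ with $v_j\in T_q\iota(M_j)$, $q=p(s)$, then $x_i(s)=d\varphi_i(v_j)$ for every $j$ and every $i\in\hat I_j:=I_j\setminus\bigcup_{I_k\subsetneq I_j}I_k$. -/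

import Mathlib

open Set Filter
open scoped Topology ENNReal NNReal Manifold ContDiff

universe u

namespace MultiNormal

noncomputable section

/-! ## Division of an analytic function by a coordinate

If `F (y, t)` is analytic near `(y₀, 0)` and vanishes for `t = 0`, then `F (y, t) = t • H (y, t)`
with `H` analytic. This is what makes the charts of a normal deformation compatible. -/

section Hadamard
variable {V G : Type*} [NormedAddCommGroup V] [NormedSpace ℝ V]
  [NormedAddCommGroup G] [NormedSpace ℝ G] 

/-- The map `(y, t) ↦ (y, 0)`. -/
def baseProj (V : Type*) [NormedAddCommGroup V] [NormedSpace ℝ V] :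
    V × ℝ →L[ℝ] V × ℝ :=
  (ContinuousLinearMap.inl ℝ V ℝ).comp (ContinuousLinearMap.fst ℝ V ℝ)

/-- The `k`-th term in the telescopic quotient of `f (z, …, z) - f (πz, …, πz)` by `t`, where
`z = (y, t)` and `πz = (y, 0)`. -/
def divTerm {n : ℕ} (f : ContinuousMultilinearMap ℝ (fun _ : Fin (n + 1) => V × ℝ) G)
    (k : Fin (n + 1)) : ContinuousMultilinearMap ℝ (fun _ : Fin n => V × ℝ) G :=
  (f.compContinuousLinearMap
    (fun i => if i < k then baseProj V else ContinuousLinearMap.id ℝ (V × ℝ))).curryMid k (0, 1)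

theorem norm_baseProj_le : ‖baseProj V‖ ≤ 1 := by
  refine ContinuousLinearMap.opNorm_le_bound _ zero_le_one fun x => ?_
  simp only [baseProj, ContinuousLinearMap.comp_apply, ContinuousLinearMap.inl_apply,
    ContinuousLinearMap.coe_fst', one_mul]
  rw [Prod.norm_def]
  simpa using norm_fst_le x

theorem norm_divTerm_le {n : ℕ}
    (f : ContinuousMultilinearMap ℝ (fun _ : Fin (n + 1) => V × ℝ) G) (k : Fin (n + 1)) :
    ‖divTerm f k‖ ≤ ‖f‖ := by
  have h1 : ‖((0, 1) : V × ℝ)‖ = 1 := by simp [Prod.norm_def]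
  have h2 : ‖f.compContinuousLinearMap
      (fun i => if i < k then baseProj V else ContinuousLinearMap.id ℝ (V × ℝ))‖ ≤ ‖f‖ := by
    refine (f.norm_compContinuousLinearMap_le _).trans ?_
    refine mul_le_of_le_one_right (norm_nonneg _) (Finset.prod_le_one (fun _ _ => norm_nonneg _) ?_)
    intro i _
    split_ifs
    · exact norm_baseProj_le
    · exact ContinuousLinearMap.norm_id_le
  refine (ContinuousLinearMap.le_opNorm _ _).trans ?_
  rw [h1, mul_one, ContinuousMultilinearMap.norm_curryMid]
  exact h2

theorem smul_divTerm {n : ℕ}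
    (f : ContinuousMultilinearMap ℝ (fun _ : Fin (n + 1) => V × ℝ) G) (k : Fin (n + 1))
    (z : V × ℝ) :
    z.2 • divTerm f k (fun _ => z) =
      f (fun i => if i < k then baseProj V z else z) -
        f (fun i => if i ≤ k then baseProj V z else z) := by
  have key : ∀ w : V × ℝ, f (fun i => if i < k then baseProj V z else if i = k then w else z) =
      f (Function.update (fun i => if i < k then baseProj V z else z) k w) := by
    intro w
    congr 1
    funext i
    by_cases hi : i = k
    · subst hi; simp
    · simp [hi]
  have e1 : (fun i => if i < k then baseProj V z else z) =
      (fun i => if i < k then baseProj V z else if i = k then z else z) := by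
    funext i; simp
  have e2 : (fun i => if i ≤ k then baseProj V z else z) =
      (fun i => if i < k then baseProj V z else if i = k then baseProj V z else z) := by
    funext i
    rcases lt_trichotomy i k with h | h | h
    · simp [h, h.le]
    · simp [h]
    · simp [not_le.2 h, not_lt.2 h.le, h.ne']
  rw [e1, e2, key, key, ← f.map_update_sub]
  have e3 : z - baseProj V z = z.2 • ((0, 1) : V × ℝ) := by
    ext <;> simp [baseProj]
  rw [e3, f.map_update_smul]
  congr 1
  simp only [divTerm, ContinuousMultilinearMap.curryMid_apply,
    ContinuousMultilinearMap.compContinuousLinearMap_apply]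
  congr 1
  funext i
  refine Fin.succAboveCases k ?_ (fun j => ?_) i
  · simp
  · rw [Function.update_of_ne (Fin.succAbove_ne k j)]
    simp only [Fin.insertNth_apply_succAbove]
    split_ifs <;> simp

theorem smul_sum_divTerm {n : ℕ}
    (f : ContinuousMultilinearMap ℝ (fun _ : Fin (n + 1) => V × ℝ) G) (z : V × ℝ) :
    z.2 • (∑ k, divTerm f k) (fun _ => z) = f (fun _ => z) - f (fun _ => baseProj V z) := by
  rw [_root_.sum_apply, Finset.smul_sum]
  simp only [smul_divTerm]
  have := Finset.sum_range_sub' (fun m : ℕ => f (fun i => if (i : ℕ) < m then baseProj V z else z))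
    (n + 1)
  rw [← Fin.sum_univ_eq_sum_range
    (fun m : ℕ => f (fun i => if (i : ℕ) < m then baseProj V z else z) -
      f (fun i => if (i : ℕ) < m + 1 then baseProj V z else z))] at this
  have ea : (fun i : Fin (n + 1) => if (i : ℕ) < 0 then baseProj V z else z) = fun _ => z := by
    funext i; rw [if_neg (Nat.not_lt_zero _)]
  have eb : (fun i : Fin (n + 1) => if (i : ℕ) < n + 1 then baseProj V z else z) =
      fun _ => baseProj V z := by
    funext i; rw [if_pos i.isLt]
  rw [ea, eb] at this
  rw [← this]
  refine Finset.sum_congr rfl fun k _ => ?_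
  simp only [Fin.lt_def, Fin.le_def, Nat.lt_succ_iff]

theorem exists_analyticAt_smul_eq [CompleteSpace G] {F : V × ℝ → G} {y₀ : V}
    (hF : AnalyticAt ℝ F (y₀, 0)) (h0 : ∀ᶠ y in 𝓝 y₀, F (y, 0) = 0) :
    ∃ H : V × ℝ → G, AnalyticAt ℝ H (y₀, 0) ∧ ∀ᶠ z in 𝓝 (y₀, (0 : ℝ)), F z = z.2 • H z := by
  obtain ⟨p, r, hp⟩ := hF
  let q : FormalMultilinearSeries ℝ (V × ℝ) G := fun n => ∑ k, divTerm (p (n + 1)) k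
  have hq : 0 < q.radius := by
    obtain ⟨ρ, hρ0, hρ⟩ := ENNReal.lt_iff_exists_nnreal_btwn.1 (hp.r_pos.trans_le hp.r_le)
    obtain ⟨C, hC, hCp⟩ := p.norm_mul_pow_le_of_lt_radius hρ
    have hρ0' : 0 < ρ := by simpa using hρ0
    have : ((ρ / 2 : ℝ≥0) : ℝ≥0∞) ≤ q.radius := by
      refine q.le_radius_of_bound (C / ρ) fun n => ?_
      have h1 : ‖q n‖ ≤ (n + 1) * ‖p (n + 1)‖ := by
        refine (norm_sum_le _ _).trans ?_
        refine (Finset.sum_le_sum fun k _ => norm_divTerm_le (p (n + 1)) k).trans ?_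
        simp
      have h2 : ((n : ℝ) + 1) ≤ 2 ^ n := by
        exact_mod_cast Nat.succ_le_of_lt (Nat.lt_two_pow_self (n := n))
      have h3 := hCp (n + 1)
      have hρr : (0 : ℝ) < ρ := by exact_mod_cast hρ0'
      rw [le_div_iff₀ hρr]
      calc ‖q n‖ * ((ρ / 2 : ℝ≥0) : ℝ) ^ n * ρ
          ≤ (2 ^ n * ‖p (n + 1)‖) * ((ρ / 2 : ℝ≥0) : ℝ) ^ n * ρ := by
            gcongr
            exact h1.trans (by gcongr)
        _ = ‖p (n + 1)‖ * (ρ : ℝ) ^ (n + 1) := by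
            push_cast
            rw [div_pow, pow_succ]
            field_simp
        _ ≤ C := h3
    refine lt_of_lt_of_le ?_ this
    simpa using hρ0'.ne'
  have hqs := q.hasFPowerSeriesOnBall hq
  refine ⟨fun z => q.sum (z - (y₀, 0)), ?_, ?_⟩
  · have := hqs.comp_sub (y₀, (0 : ℝ))
    simp only [zero_add] at this
    exact this.analyticAt
  · have hz : ∀ᶠ z in 𝓝 (0 : V × ℝ), F ((y₀, 0) + z) = z.2 • q.sum z := by
      have hb : ∀ᶠ z in 𝓝 (0 : V × ℝ), z ∈ Metric.eball (0 : V × ℝ) r :=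
        Metric.eball_mem_nhds _ hp.r_pos
      have hb' : ∀ᶠ z in 𝓝 (0 : V × ℝ), z ∈ Metric.eball (0 : V × ℝ) q.radius :=
        Metric.eball_mem_nhds _ hq
      have hbc : Tendsto (baseProj V) (𝓝 0) (𝓝 0) := by
        simpa using (baseProj V).continuous.tendsto 0
      have h0' : ∀ᶠ z in 𝓝 (0 : V × ℝ), F ((y₀, 0) + baseProj V z) = 0 := by
        have : Tendsto (fun z : V × ℝ => y₀ + z.1) (𝓝 0) (𝓝 y₀) := by
          have : Continuous (fun z : V × ℝ => y₀ + z.1) := by fun_prop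
          simpa using this.tendsto 0
        filter_upwards [this.eventually h0] with z hz
        simpa [baseProj] using hz
      filter_upwards [hb, hb', h0', hbc.eventually hb] with z h1 h2 h3 h4
      have s1 := hp.hasSum h1
      have s2 := hp.hasSum h4
      rw [h3] at s2
      have s3 := (hqs.hasSum h2).const_smul z.2
      rw [zero_add] at s3
      have s4 := s1.sub s2
      rw [sub_zero] at s4
      have s5 := (hasSum_nat_add_iff' 1).2 s4
      have c0 : p 0 (fun _ => z) - p 0 (fun _ => baseProj V z) = 0 := by
        rw [sub_eq_zero]; congr 1; funext i; exact i.elim0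
      simp only [Finset.range_one, Finset.sum_singleton, c0, sub_zero] at s5
      refine s5.unique ?_
      convert s3 using 2 with n
      exact (smul_sum_divTerm (p (n + 1)) z).symm
    have ht : Tendsto (fun z : V × ℝ => z - (y₀, 0)) (𝓝 (y₀, 0)) (𝓝 0) := by
      have : Continuous (fun z : V × ℝ => z - (y₀, 0)) := by fun_prop
      simpa using this.tendsto (y₀, 0)
    filter_upwards [ht.eventually hz] with z hz
    simpa using hz
end Hadamard


section Deformation
variable {E : Type} [NormedAddCommGroup E] [NormedSpace ℝ E]
  {X : Type u} [TopologicalSpace X] [ChartedSpace E X]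

/-- The tangent space `T_q A ⊆ T_q X` of a subset `A` (in practice an analytic submanifold): the span
of the velocities at `q` of the analytic curves of `X` that stay in `A`. -/
def tangentSubspace (A : Set X) (q : X) : Submodule ℝ (TangentSpace 𝓘(ℝ, E) q) :=
  Submodule.span ℝ {v | ∃ γ : ℝ → X, γ 0 = q ∧ (∀ᶠ s in 𝓝 (0 : ℝ), γ s ∈ A) ∧
    ContMDiffAt 𝓘(ℝ, ℝ) 𝓘(ℝ, E) ω γ 0 ∧ mfderiv 𝓘(ℝ, ℝ) 𝓘(ℝ, E) γ 0 (1 : ℝ) = v}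

/-- `e` is an analytic chart of `X` in which `N` is the linear subspace `{P = 0}`, where `P` is a linear
projection; the coordinates are split as `e x = (P (e x), e x - P (e x))` into the coordinates
transversal to `N` and those along `N`. -/
structure IsSliceChart (N : Set X) (e : OpenPartialHomeomorph X E) (P : E →L[ℝ] E) : Prop where
  mem_maximalAtlas : e ∈ IsManifold.maximalAtlas 𝓘(ℝ, E) ω X
  idem : ∀ v, P (P v) = P v
  mem_iff : ∀ x ∈ e.source, x ∈ N ↔ P (e x) = 0

variable (E) in
/-- `N` is a closed real analytic submanifold of `X`. -/
structure IsClosedSubmanifold (N : Set X) : Prop where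
  isClosed : IsClosed N
  exists_sliceChart : ∀ q ∈ N, ∃ (e : OpenPartialHomeomorph X E) (P : E →L[ℝ] E),
    IsSliceChart N e P ∧ q ∈ e.source

variable (E) in
/-- The points of `N` at which `N` is an analytic submanifold (all of `N` if `N` is a submanifold). -/
def regularPoints (N : Set X) : Set X :=
  {q | q ∈ N ∧ ∃ (e : OpenPartialHomeomorph X E) (P : E →L[ℝ] E),
    IsSliceChart N e P ∧ q ∈ e.source}

variable (E) in
/-- The underlying set of the normal deformation `X̃_N` of `X` along `N`: the disjoint union of
`X × (ℝ \ {0})` and of the normal bundle `T_N X`, whose fibre at `q ∈ N` is `T_q X / T_q N`.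
The definition makes sense for any subset `N`; points at which `N` is not a submanifold then carry
no normal vectors. -/
inductive NormalDeformation (N : Set X) : Type u
  | off (x : X) (t : ℝ) (ht : t ≠ 0) : NormalDeformation N
  | normal (q : X) (hq : q ∈ regularPoints E N)
      (ν : TangentSpace 𝓘(ℝ, E) q ⧸ tangentSubspace (E := E) N q) : NormalDeformation N

namespace NormalDeformation

/-- The projection `X̃_N → X`. -/
def proj {N : Set X} : NormalDeformation E N → X
  | off x _ _ => x
  | normal q _ _ => q

/-- The deformation parameter `X̃_N → ℝ`; its zero set is `T_N X`. -/
def param {N : Set X} : NormalDeformation E N → ℝ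
  | off _ t _ => t
  | normal _ _ _ => 0

end NormalDeformation

/-- `(y', y'') ↦ (t y', y'')`, where `y' = P y` and `y'' = y - P y`. -/
def scale (P : E →L[ℝ] E) (t : ℝ) (y : E) : E := y - P y + t • P y

/-- Data giving a chart of `X̃_N`: an analytic chart `e` of `X` with a linear projection `P`. If `full`
holds, `e` is a slice chart and the chart of `X̃_N` is defined over all of `e.source`; otherwise it
is defined only where the parameter is not zero. -/
structure DeformationChart (X : Type u) [TopologicalSpace X] [ChartedSpace E X] (N : Set X) where
  e : OpenPartialHomeomorph X E
  e_mem : e ∈ IsManifold.maximalAtlas 𝓘(ℝ, E) ω X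
  P : E →L[ℝ] E
  idem : ∀ v, P (P v) = P v
  full : Prop
  slice : full → IsSliceChart N e P

theorem scale_scale {P : E →L[ℝ] E} (hP : ∀ v, P (P v) = P v) (s t : ℝ) (y : E) :
    scale P s (scale P t y) = scale P (s * t) y := by
  simp [scale, hP, mul_smul]

@[simp] theorem scale_one (P : E →L[ℝ] E) (y : E) : scale P 1 y = y := by simp [scale]

@[simp] theorem scale_zero (P : E →L[ℝ] E) (y : E) : scale P 0 y = y - P y := by simp [scale]

theorem mdifferentiable_of_mem {e : OpenPartialHomeomorph X E}
    (he : e ∈ IsManifold.maximalAtlas 𝓘(ℝ, E) ω X) : e.MDifferentiable 𝓘(ℝ, E) 𝓘(ℝ, E) :=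
  ⟨(contMDiffOn_of_mem_maximalAtlas he).mdifferentiableOn (by simp),
    (contMDiffOn_symm_of_mem_maximalAtlas he).mdifferentiableOn (by simp)⟩

theorem IsSliceChart.mem_tangentSubspace_iff {N : Set X} {e : OpenPartialHomeomorph X E}
    {P : E →L[ℝ] E} (h : IsSliceChart N e P) {q : X} (hq : q ∈ e.source) (hqN : q ∈ N)
    (v : TangentSpace 𝓘(ℝ, E) q) :
    v ∈ tangentSubspace N q ↔ P (mfderiv 𝓘(ℝ, E) 𝓘(ℝ, E) e q v) = 0 := by
  have hd := mdifferentiable_of_mem h.mem_maximalAtlas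
  constructor
  · intro hv
    have hle : tangentSubspace N q ≤
        LinearMap.ker (P.comp (mfderiv 𝓘(ℝ, E) 𝓘(ℝ, E) e q :
          TangentSpace 𝓘(ℝ, E) q →L[ℝ] E)).toLinearMap := by
      refine Submodule.span_le.2 ?_
      rintro v ⟨γ, rfl, hN, hγ, rfl⟩
      have hγd : MDifferentiableAt 𝓘(ℝ, ℝ) 𝓘(ℝ, E) γ 0 := hγ.mdifferentiableAt (by simp)
      have hc := mfderiv_comp (0 : ℝ) (hd.mdifferentiableAt hq) hγd
      have hcd : MDifferentiableAt 𝓘(ℝ, ℝ) 𝓘(ℝ, E) (e ∘ γ) 0 :=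
        (hd.mdifferentiableAt hq).comp (0 : ℝ) hγd
      rw [mfderiv_eq_fderiv] at hc
      have hcd' : DifferentiableAt ℝ (e ∘ γ) 0 := hcd.differentiableAt
      have hz : (fun s => P ((e ∘ γ) s)) =ᶠ[𝓝 0] fun _ => (0 : E) := by
        filter_upwards [hN, hγ.continuousAt.eventually (e.open_source.mem_nhds hq)] with s h1 h2
        exact (h.mem_iff _ h2).1 h1
      have h3 : fderiv ℝ (fun s => P ((e ∘ γ) s)) 0 = 0 := by
        rw [hz.fderiv_eq]; simp
      have h4 : fderiv ℝ (fun s => P ((e ∘ γ) s)) 0 = P.comp (fderiv ℝ (e ∘ γ) 0) :=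
        (P.hasFDerivAt.comp (0 : ℝ) hcd'.hasFDerivAt).fderiv
      rw [h4, hc] at h3
      exact DFunLike.congr_fun h3 (1 : ℝ)
    exact hle hv
  · intro hv
    set w : E := mfderiv 𝓘(ℝ, E) 𝓘(ℝ, E) e q v with hw
    have hPq : P (e q) = 0 := (h.mem_iff q hq).1 hqN
    have hcont : Continuous fun s : ℝ => e q + s • w := by fun_prop
    have htend : Tendsto (fun s : ℝ => e q + s • w) (𝓝 0) (𝓝 (e q)) := by
      simpa using hcont.tendsto 0
    have hl : ContDiff ℝ ω fun s : ℝ => e q + s • w := by fun_prop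
    have hlm : ContMDiffAt 𝓘(ℝ, ℝ) 𝓘(ℝ, E) ω (fun s : ℝ => e q + s • w) 0 :=
      hl.contMDiff.contMDiffAt
    have hl0 : e q + (0 : ℝ) • w = e q := by simp
    refine Submodule.subset_span ⟨fun s => e.symm (e q + s • w), by simp [hq], ?_, ?_, ?_⟩
    · filter_upwards [htend.eventually (e.open_target.mem_nhds (e.map_source hq))] with s hs
      rw [h.mem_iff _ (e.map_target hs), e.right_inv hs]
      simp [hPq, hv]
    · refine ContMDiffAt.comp (0 : ℝ) (I' := 𝓘(ℝ, E)) (g := e.symm) ?_ hlm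
      rw [hl0]
      exact contMDiffAt_symm_of_mem_maximalAtlas h.mem_maximalAtlas (e.map_source hq)
    · have hsd : MDifferentiableAt 𝓘(ℝ, E) 𝓘(ℝ, E) e.symm (e q + (0 : ℝ) • w) := by
        rw [hl0]; exact hd.mdifferentiableAt_symm (e.map_source hq)
      have hc := mfderiv_comp (0 : ℝ) (g := e.symm) (f := fun s : ℝ => e q + s • w) hsd
        (hlm.mdifferentiableAt (by simp))
      have hld : fderiv ℝ (fun s : ℝ => e q + s • w) 0 (1 : ℝ) = w := by
        have : HasDerivAt (fun s : ℝ => e q + s • w) w 0 := by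
          simpa using ((hasDerivAt_id (0 : ℝ)).smul_const w).const_add (e q)
        rw [this.hasFDerivAt.fderiv]
        simp
      have hb : ∀ z : E, z = e q → (mfderiv 𝓘(ℝ, E) 𝓘(ℝ, E) e.symm z w : E) = v := by
        rintro z rfl
        have := DFunLike.congr_fun (hd.symm_comp_deriv hq) v
        exact this
      change (mfderiv 𝓘(ℝ, ℝ) 𝓘(ℝ, E) (e.symm ∘ fun s : ℝ => e q + s • w) 0 (1 : ℝ) : E) = v
      rw [hc]
      change (mfderiv 𝓘(ℝ, E) 𝓘(ℝ, E) e.symm (e q + (0 : ℝ) • w)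
        (mfderiv 𝓘(ℝ, ℝ) 𝓘(ℝ, E) (fun s : ℝ => e q + s • w) 0 (1 : ℝ)) : E) = v
      rw [mfderiv_eq_fderiv]
      refine Eq.trans ?_ (hb _ hl0)
      exact congrArg (mfderiv 𝓘(ℝ, E) 𝓘(ℝ, E) e.symm (e q + (0 : ℝ) • w)) hld

namespace DeformationChart
variable {N : Set X} (c : DeformationChart (E := E) X N)

/-- The chart of `X̃_N` attached to `(e, P)`. It is inverse to `(y', y'', t) ↦ ((t y', y''), t)` for
`t ≠ 0`, and on the normal bundle (`t = 0`) it is `(q, [v]) ↦ (de(v)', e(q)'', 0)`; there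
`e(q) = e(q)''`. -/
def toFun : NormalDeformation E N → E × ℝ
  | .off x t _ => (scale c.P t⁻¹ (c.e x), t)
  | .normal q _ ν => (c.e q + c.P (mfderiv 𝓘(ℝ, E) 𝓘(ℝ, E) c.e q (Quotient.out ν)), 0)

open Classical in
/-- The inverse of the chart `toFun` (with an irrelevant value off its target). -/
def invFun (z : E × ℝ) : NormalDeformation E N :=
  if ht : z.2 = 0 then
    if hq : c.e.symm (z.1 - c.P z.1) ∈ regularPoints E N then
      .normal _ hq (Submodule.Quotient.mk
        (mfderiv 𝓘(ℝ, E) 𝓘(ℝ, E) c.e.symm (z.1 - c.P z.1) (c.P z.1)))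
    else .off (c.e.symm (z.1 - c.P z.1)) 1 one_ne_zero
  else .off (c.e.symm (scale c.P z.2 z.1)) z.2 ht

def source : Set (NormalDeformation E N) := {a | a.proj ∈ c.e.source ∧ (a.param = 0 → c.full)}

def target : Set (E × ℝ) := {z | scale c.P z.2 z.1 ∈ c.e.target ∧ (z.2 = 0 → c.full)}

theorem P_e_eq_zero (hf : c.full) {q : X} (hq : q ∈ c.e.source) (hqN : q ∈ N) :
    c.P (c.e q) = 0 := ((c.slice hf).mem_iff q hq).1 hqN

theorem P_mfderiv_out (hf : c.full) {q : X} (hq : q ∈ c.e.source) (hqN : q ∈ N)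
    (a : TangentSpace 𝓘(ℝ, E) q) :
    c.P (mfderiv 𝓘(ℝ, E) 𝓘(ℝ, E) c.e q
      (Quotient.out (Submodule.Quotient.mk a : _ ⧸ tangentSubspace (E := E) N q))) =
      c.P (mfderiv 𝓘(ℝ, E) 𝓘(ℝ, E) c.e q a) := by
  have h1 : (Submodule.Quotient.mk (Quotient.out
      (Submodule.Quotient.mk a : _ ⧸ tangentSubspace (E := E) N q)) :
      _ ⧸ tangentSubspace (E := E) N q) = Submodule.Quotient.mk a := Quotient.out_eq _
  rw [Submodule.Quotient.eq, (c.slice hf).mem_tangentSubspace_iff hq hqN] at h1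
  rw [map_sub] at h1
  exact sub_eq_zero.1 ((map_sub c.P _ _).symm.trans h1)

theorem normal_congr {q q' : X} (h : q = q') (hq : q ∈ regularPoints E N)
    (hq' : q' ∈ regularPoints E N) (a : TangentSpace 𝓘(ℝ, E) q) (b : TangentSpace 𝓘(ℝ, E) q')
    (hab : ∀ b' : TangentSpace 𝓘(ℝ, E) q, (b' : E) = (b : E) → a - b' ∈ tangentSubspace N q) :
    NormalDeformation.normal q hq (Submodule.Quotient.mk a) =
      NormalDeformation.normal q' hq' (Submodule.Quotient.mk b) := by
  subst h
  congr 1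
  exact (Submodule.Quotient.eq _).2 (hab b rfl)

theorem mfderiv_symm_apply {q : X} (hq : q ∈ c.e.source) (z : E) (hz : z = c.e q) (w : E)
    (a : TangentSpace 𝓘(ℝ, E) q)
    (ha : (mfderiv 𝓘(ℝ, E) 𝓘(ℝ, E) c.e.symm z w : E) = (a : E)) :
    (mfderiv 𝓘(ℝ, E) 𝓘(ℝ, E) c.e q a : E) = w := by
  subst hz
  have hd := mdifferentiable_of_mem c.e_mem
  have h := DFunLike.congr_fun (hd.comp_symm_deriv (c.e.map_source hq)) w
  have key : ∀ q' : X, q' = q → ∀ u : E, u = (a : E) →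
      (mfderiv 𝓘(ℝ, E) 𝓘(ℝ, E) c.e q' u : E) = mfderiv 𝓘(ℝ, E) 𝓘(ℝ, E) c.e q a := by
    rintro q' rfl u rfl; rfl
  rw [← key _ (c.e.left_inv hq) _ ha]
  exact h

theorem invFun_zero (hf : c.full) {z : E × ℝ} (hz : z ∈ c.target) (h0 : z.2 = 0) :
    ∃ hq : c.e.symm (z.1 - c.P z.1) ∈ regularPoints E N, c.invFun z =
      .normal _ hq (Submodule.Quotient.mk
        (mfderiv 𝓘(ℝ, E) 𝓘(ℝ, E) c.e.symm (z.1 - c.P z.1) (c.P z.1))) := by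
  have h1 : z.1 - c.P z.1 ∈ c.e.target := by simpa [target, h0] using hz.1
  have h2 : c.e.symm (z.1 - c.P z.1) ∈ regularPoints E N := by
    refine ⟨?_, c.e, c.P, c.slice hf, c.e.map_target h1⟩
    rw [(c.slice hf).mem_iff _ (c.e.map_target h1), c.e.right_inv h1]
    simp [c.idem]
  exact ⟨h2, by simp [invFun, h0, h2]⟩

theorem proj_invFun {z : E × ℝ} : (c.invFun z).proj = c.e.symm (scale c.P z.2 z.1) := by
  unfold invFun
  split_ifs with h1 h2
  · simp [NormalDeformation.proj, h1]
  · simp [NormalDeformation.proj, h1]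
  · simp [NormalDeformation.proj]

theorem param_invFun {z : E × ℝ} (hz : z ∈ c.target) : (c.invFun z).param = z.2 := by
  by_cases h0 : z.2 = 0
  · obtain ⟨hq, h⟩ := c.invFun_zero (hz.2 h0) hz h0
    rw [h, h0]; rfl
  · simp [invFun, h0, NormalDeformation.param]

theorem scale_toFun {a : NormalDeformation E N} (ha : a ∈ c.source) :
    scale c.P (c.toFun a).2 (c.toFun a).1 = c.e a.proj := by
  cases a with
  | off x t ht => simp [toFun, scale_scale c.idem, ht, NormalDeformation.proj]
  | normal q hq ν =>
    have ha1 : q ∈ c.e.source := ha.1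
    have h0 := c.P_e_eq_zero (ha.2 rfl) ha1 hq.1
    have hw : ∀ w : E, scale c.P 0 (c.e q + c.P w) = c.e q := fun w => by simp [c.idem, h0]
    exact hw _

theorem toFun_snd (a : NormalDeformation E N) : (c.toFun a).2 = a.param := by
  cases a <;> rfl

def toPartialEquiv : PartialEquiv (NormalDeformation E N) (E × ℝ) where
  toFun := c.toFun
  invFun := c.invFun
  source := c.source
  target := c.target
  map_source' a ha := by
    refine ⟨?_, ?_⟩
    · rw [c.scale_toFun ha]; exact c.e.map_source ha.1
    · rw [c.toFun_snd]; exact ha.2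
  map_target' z hz := by
    refine ⟨?_, ?_⟩
    · rw [c.proj_invFun]; exact c.e.map_target hz.1
    · rw [c.param_invFun hz]; exact hz.2
  left_inv' a ha := by
    have hs := c.scale_toFun ha
    cases a with
    | off x t ht =>
      have ha1 : x ∈ c.e.source := ha.1
      have : (c.toFun (.off x t ht)).2 = t := rfl
      rw [this] at hs
      simp only [invFun, this, ht, dite_false, hs]
      simp only [NormalDeformation.proj, c.e.left_inv ha1]
    | normal q hq ν =>
      have hf := ha.2 rfl
      have ha1 : q ∈ c.e.source := ha.1
      have h0 := c.P_e_eq_zero hf ha1 hq.1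
      have hmem : c.toFun (.normal q hq ν) ∈ c.target := by
        refine ⟨?_, fun _ => hf⟩
        rw [hs]; exact c.e.map_source ha.1
      obtain ⟨hq', h⟩ := c.invFun_zero hf hmem rfl
      have hz0 : (c.toFun (.normal q hq ν)).1 - c.P (c.toFun (.normal q hq ν)).1 = c.e q := by
        rw [c.toFun_snd] at hs
        exact (scale_zero c.P _).symm.trans hs
      have hPw : c.P (c.toFun (.normal q hq ν)).1 =
          c.P (mfderiv 𝓘(ℝ, E) 𝓘(ℝ, E) c.e q (Quotient.out ν)) := by
        have hw : ∀ w : E, c.P (c.e q + c.P w) = c.P w := fun w => by simp [c.idem, h0]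
        exact hw _
      rw [h]
      conv_rhs => rw [← Quotient.out_eq ν]
      symm
      refine normal_congr ?_ hq hq' _ _ fun b' hb' => ?_
      · rw [hz0, c.e.left_inv ha1]
      · rw [(c.slice hf).mem_tangentSubspace_iff ha1 hq.1, map_sub]
        refine (map_sub c.P _ _).trans ?_
        have h5 := c.mfderiv_symm_apply ha1 _ hz0 _ b' hb'.symm
        rw [sub_eq_zero]
        refine Eq.trans ?_ (congrArg c.P h5.symm)
        rw [hPw]
        exact (c.idem _).symm
  right_inv' z hz := by
    by_cases h0 : z.2 = 0
    · have hf := hz.2 h0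
      obtain ⟨hq, h⟩ := c.invFun_zero hf hz h0
      have h1 : z.1 - c.P z.1 ∈ c.e.target := by simpa [target, h0] using hz.1
      rw [h]
      have h2 := c.P_mfderiv_out hf (c.e.map_target h1) hq.1
        (mfderiv 𝓘(ℝ, E) 𝓘(ℝ, E) c.e.symm (z.1 - c.P z.1) (c.P z.1))
      have h3 := c.mfderiv_symm_apply (c.e.map_target h1) (z.1 - c.P z.1)
        (c.e.right_inv h1).symm (c.P z.1) _ rfl
      refine Prod.ext ?_ h0.symm
      change c.e (c.e.symm (z.1 - c.P z.1)) + c.P _ = z.1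
      rw [h2, h3, c.e.right_inv h1, c.idem]
      abel
    · refine Prod.ext ?_ ?_
      · simp [invFun, h0, toFun, c.e.right_inv hz.1, scale_scale c.idem]
      · simp [invFun, h0, toFun]

end DeformationChart

namespace DeformationChart
variable {N : Set X} (c c' : DeformationChart (E := E) X N)

def transition (z : E × ℝ) : E × ℝ := c'.toFun (c.invFun z)

theorem mem_trans_source_iff (z : E × ℝ) :
    z ∈ (c.toPartialEquiv.symm.trans c'.toPartialEquiv).source ↔
      scale c.P z.2 z.1 ∈ c.e.target ∧ c.e.symm (scale c.P z.2 z.1) ∈ c'.e.source ∧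
        (z.2 = 0 → c.full ∧ c'.full) := by
  rw [PartialEquiv.trans_source]
  change z ∈ c.target ∧ c.invFun z ∈ c'.source ↔ _
  constructor
  · rintro ⟨h1, h2⟩
    have h3 := h2.1
    have h4 := h2.2
    rw [c.proj_invFun] at h3
    rw [c.param_invFun h1] at h4
    exact ⟨h1.1, h3, fun h => ⟨h1.2 h, h4 h⟩⟩
  · rintro ⟨h1, h2, h3⟩
    have h4 : z ∈ c.target := ⟨h1, fun h => (h3 h).1⟩
    refine ⟨h4, ?_, ?_⟩
    · rw [c.proj_invFun]; exact h2
    · rw [c.param_invFun h4]; exact fun h => (h3 h).2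

theorem continuous_scale (P : E →L[ℝ] E) : Continuous fun z : E × ℝ => scale P z.2 z.1 := by
  unfold scale; fun_prop

theorem contDiff_scale (P : E →L[ℝ] E) : ContDiff ℝ ω fun z : E × ℝ => scale P z.2 z.1 := by
  unfold scale; fun_prop

theorem isOpen_trans_source :
    IsOpen (c.toPartialEquiv.symm.trans c'.toPartialEquiv).source := by
  have h : (c.toPartialEquiv.symm.trans c'.toPartialEquiv).source =
      (fun z : E × ℝ => scale c.P z.2 z.1) ⁻¹' (c.e.symm.trans c'.e).source ∩
        {z | z.2 = 0 → c.full ∧ c'.full} := by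
    ext z
    rw [mem_trans_source_iff]
    simp [and_assoc]
  rw [h]
  refine ((c.e.symm.trans c'.e).open_source.preimage (continuous_scale c.P)).inter ?_
  by_cases hf : c.full ∧ c'.full
  · simp [hf]
  · simp only [hf, imp_false]
    exact (isClosed_singleton.preimage continuous_snd).isOpen_compl

theorem contDiffAt_coord {z : E} (hz : z ∈ c.e.target) (hz' : c.e.symm z ∈ c'.e.source) :
    ContDiffAt ℝ ω (c'.e ∘ c.e.symm) z := by
  have h1 := contMDiffAt_symm_of_mem_maximalAtlas c.e_mem hz
  have h2 := contMDiffAt_of_mem_maximalAtlas c'.e_mem hz'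
  exact (h2.comp z h1).contDiffAt

theorem fderiv_coord {z : E} (hz : z ∈ c.e.target) (hz' : c.e.symm z ∈ c'.e.source) (w : E) :
    (fderiv ℝ (c'.e ∘ c.e.symm) z w : E) =
      mfderiv 𝓘(ℝ, E) 𝓘(ℝ, E) c'.e (c.e.symm z) (mfderiv 𝓘(ℝ, E) 𝓘(ℝ, E) c.e.symm z w) := by
  have h := mfderiv_comp z ((mdifferentiable_of_mem c'.e_mem).mdifferentiableAt hz')
    ((mdifferentiable_of_mem c.e_mem).mdifferentiableAt_symm hz)
  rw [mfderiv_eq_fderiv] at h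
  exact DFunLike.congr_fun h w

theorem transition_ne (z : E × ℝ) (hz : z.2 ≠ 0) :
    c.transition c' z = (scale c'.P z.2⁻¹ (c'.e (c.e.symm (scale c.P z.2 z.1))), z.2) := by
  simp [transition, invFun, hz, toFun]

theorem transition_zero (z : E × ℝ)
    (hz : z ∈ (c.toPartialEquiv.symm.trans c'.toPartialEquiv).source) (h0 : z.2 = 0) :
    c.transition c' z = (c'.e (c.e.symm (z.1 - c.P z.1)) +
      c'.P (fderiv ℝ (c'.e ∘ c.e.symm) (z.1 - c.P z.1) (c.P z.1)), 0) ∧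
    c'.P (c'.e (c.e.symm (z.1 - c.P z.1))) = 0 := by
  obtain ⟨h1, h2, h3⟩ := (c.mem_trans_source_iff c' z).1 hz
  obtain ⟨hf, hf'⟩ := h3 h0
  obtain ⟨hq, h⟩ := c.invFun_zero hf ⟨h1, fun _ => hf⟩ h0
  rw [h0, scale_zero] at h1 h2
  refine ⟨?_, c'.P_e_eq_zero hf' h2 hq.1⟩
  rw [transition, h]
  refine Prod.ext ?_ rfl
  change c'.e (c.e.symm (z.1 - c.P z.1)) + c'.P _ = _
  rw [c'.P_mfderiv_out hf' h2 hq.1, ← c.fderiv_coord c' h1 h2]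

theorem contDiffAt_iff_analyticAt {V G : Type*} [NormedAddCommGroup V] [NormedSpace ℝ V]
    [NormedAddCommGroup G] [NormedSpace ℝ G] [CompleteSpace G] {f : V → G} {x : V} :
    ContDiffAt ℝ ω f x ↔ AnalyticAt ℝ f x := by
  rw [← contDiffWithinAt_univ, contDiffWithinAt_omega_iff_analyticWithinAt, analyticWithinAt_univ]

theorem contDiffAt_transition [FiniteDimensional ℝ E] (z : E × ℝ)
    (hz : z ∈ (c.toPartialEquiv.symm.trans c'.toPartialEquiv).source) :
    ContDiffAt ℝ ω (c.transition c') z := by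
  have := FiniteDimensional.complete ℝ E
  have hsrc := (c.isOpen_trans_source c').mem_nhds hz
  obtain ⟨h1, h2, h3⟩ := (c.mem_trans_source_iff c' z).1 hz
  have hτ : ContDiffAt ℝ ω (fun z : E × ℝ => c'.e (c.e.symm (scale c.P z.2 z.1))) z :=
    ContDiffAt.comp (g := c'.e ∘ c.e.symm) (f := fun z : E × ℝ => scale c.P z.2 z.1) z
      (c.contDiffAt_coord c' h1 h2) (contDiff_scale c.P).contDiffAt
  by_cases h0 : z.2 = 0
  · obtain ⟨y₀, t⟩ := z
    obtain rfl : t = 0 := h0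
    have hPτ : ContDiffAt ℝ ω
        (fun z : E × ℝ => c'.P (c'.e (c.e.symm (scale c.P z.2 z.1)))) (y₀, 0) :=
      c'.P.contDiff.contDiffAt.comp _ hτ
    have hF0 : ∀ᶠ y in 𝓝 y₀, c'.P (c'.e (c.e.symm (scale c.P 0 y))) = 0 := by
      have hc : Tendsto (fun y : E => (y, (0 : ℝ))) (𝓝 y₀) (𝓝 (y₀, 0)) := by
        have : Continuous (fun y : E => (y, (0 : ℝ))) := by fun_prop
        exact this.tendsto y₀
      filter_upwards [hc.eventually hsrc] with y hy
      rw [scale_zero]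
      exact (c.transition_zero c' (y, 0) hy rfl).2
    obtain ⟨H, hH, hFH⟩ := exists_analyticAt_smul_eq
      (F := fun z : E × ℝ => c'.P (c'.e (c.e.symm (scale c.P z.2 z.1))))
      (contDiffAt_iff_analyticAt.1 hPτ) hF0
    have hev : c.transition c' =ᶠ[𝓝 (y₀, 0)] fun z : E × ℝ =>
        (c'.e (c.e.symm (scale c.P z.2 z.1)) - c'.P (c'.e (c.e.symm (scale c.P z.2 z.1))) +
          c'.P (H z), z.2) := by
      filter_upwards [hsrc, hFH.eventually_nhds, hH.eventually_analyticAt] with z hz hFz hHz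
      obtain ⟨k1, k2, -⟩ := (c.mem_trans_source_iff c' z).1 hz
      by_cases hz0 : z.2 = 0
      · obtain ⟨y, t⟩ := z
        obtain rfl : t = 0 := hz0
        obtain ⟨e1, e2⟩ := c.transition_zero c' _ hz rfl
        rw [e1]
        refine Prod.ext ?_ rfl
        dsimp only at *
        rw [scale_zero] at k1 k2 ⊢
        rw [e2, sub_zero]
        congr 1
        have d1 : HasFDerivAt (c'.e ∘ c.e.symm)
            (fderiv ℝ (c'.e ∘ c.e.symm) (y - c.P y)) (y - c.P y) :=
          ((c.contDiffAt_coord c' k1 k2).differentiableAt (by simp)).hasFDerivAt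
        have d2 : HasDerivAt (fun t : ℝ => scale c.P t y) (c.P y) 0 := by
          have := ((hasDerivAt_id (0 : ℝ)).smul_const (c.P y)).const_add (y - c.P y)
          simpa [scale] using this
        have d3 : HasDerivAt (fun t : ℝ => c'.P (c'.e (c.e.symm (scale c.P t y))))
            (c'.P (fderiv ℝ (c'.e ∘ c.e.symm) (y - c.P y) (c.P y))) 0 := by
          have d1' := d1
          rw [← scale_zero] at d1'
          have := c'.P.hasFDerivAt.comp_hasDerivAt (0 : ℝ) (d1'.comp_hasDerivAt (0 : ℝ) d2)
          simpa [Function.comp_def] using this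
        have hc : ContinuousAt (fun t : ℝ => (y, t)) 0 := by fun_prop
        have d4 : HasDerivAt (fun t : ℝ => t • H (y, t)) (H (y, 0)) 0 := by
          have hd : DifferentiableAt ℝ (fun t : ℝ => H (y, t)) 0 :=
            DifferentiableAt.comp (0 : ℝ) (g := H) hHz.differentiableAt (by fun_prop)
          have := (hasDerivAt_id (0 : ℝ)).smul hd.hasDerivAt
          have e : (fun t : ℝ => t • H (y, t)) = ((id : ℝ → ℝ) • fun t : ℝ => H (y, t)) := rfl
          rw [e]
          simpa using this
        have d5 : (fun t : ℝ => c'.P (c'.e (c.e.symm (scale c.P t y)))) =ᶠ[𝓝 0]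
            fun t : ℝ => t • H (y, t) := hc.eventually hFz
        have d6 := d3.unique (d4.congr_of_eventuallyEq d5)
        rw [← d6, c'.idem]
      · rw [c.transition_ne c' z hz0]
        refine Prod.ext ?_ rfl
        have := hFz.self_of_nhds
        dsimp only at this ⊢
        unfold scale at this ⊢
        have e : H z = z.2⁻¹ • c'.P (c'.e (c.e.symm (z.1 - c.P z.1 + z.2 • c.P z.1))) := by
          rw [this, smul_smul, inv_mul_cancel₀ hz0, one_smul]
        rw [e, map_smul, c'.idem]
    refine ContDiffAt.congr_of_eventuallyEq ?_ hev
    refine ContDiffAt.prodMk ?_ contDiffAt_snd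
    exact (hτ.sub hPτ).add (c'.P.contDiff.contDiffAt.comp _ (contDiffAt_iff_analyticAt.2 hH))
  · have hev : c.transition c' =ᶠ[𝓝 z] fun z : E × ℝ =>
        (scale c'.P z.2⁻¹ (c'.e (c.e.symm (scale c.P z.2 z.1))), z.2) := by
      have : ∀ᶠ z' : E × ℝ in 𝓝 z, z'.2 ≠ 0 := continuousAt_snd.eventually_ne h0
      filter_upwards [this] with z' hz'
      exact c.transition_ne c' z' hz'
    refine ContDiffAt.congr_of_eventuallyEq ?_ hev
    refine ContDiffAt.prodMk ?_ contDiffAt_snd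
    exact (contDiff_scale c'.P).contDiffAt.comp z (hτ.prodMk (contDiffAt_snd.inv h0))

end DeformationChart

namespace NormalDeformation
variable (N : Set X)

theorem exists_chart [IsManifold 𝓘(ℝ, E) ω X] (a : NormalDeformation E N) :
    ∃ c : DeformationChart (E := E) X N, a ∈ c.source := by
  cases a with
  | off x t ht =>
    exact ⟨⟨chartAt E x, IsManifold.chart_mem_maximalAtlas x, 0, by simp, False, False.elim⟩,
      mem_chart_source E x, fun h => ht h⟩
  | normal q hq ν =>
    obtain ⟨hqN, e, P, hs, hqe⟩ := hq
    exact ⟨⟨e, hs.mem_maximalAtlas, P, hs.idem, True, fun _ => hs⟩, hqe, fun _ => trivial⟩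

/-- The atlas of `X̃_N`, consisting of all the charts `DeformationChart.toPartialEquiv`. -/
def core [FiniteDimensional ℝ E] [IsManifold 𝓘(ℝ, E) ω X] :
    ChartedSpaceCore (E × ℝ) (NormalDeformation E N) where
  atlas := Set.range DeformationChart.toPartialEquiv
  chartAt a := (exists_chart N a).choose.toPartialEquiv
  mem_chart_source a := (exists_chart N a).choose_spec
  chart_mem_atlas a := ⟨_, rfl⟩
  open_source := by
    rintro _ _ ⟨c, rfl⟩ ⟨c', rfl⟩
    exact c.isOpen_trans_source c'
  continuousOn_toFun := by
    rintro _ _ ⟨c, rfl⟩ ⟨c', rfl⟩ z hz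
    exact (c.contDiffAt_transition c' z hz).continuousAt.continuousWithinAt

variable [FiniteDimensional ℝ E] [IsManifold 𝓘(ℝ, E) ω X]

instance : TopologicalSpace (NormalDeformation E N) := (core N).toTopologicalSpace

instance : ChartedSpace (E × ℝ) (NormalDeformation E N) := (core N).toChartedSpace

instance : IsManifold 𝓘(ℝ, E × ℝ) ω (NormalDeformation E N) := by
  refine isManifold_of_contDiffOn _ _ _ ?_
  rintro e e' he he'
  change e ∈ ⋃ (f : PartialEquiv (NormalDeformation E N) (E × ℝ)) (hf : f ∈ (core N).atlas),
    {(core N).openPartialHomeomorph f hf} at he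
  change e' ∈ ⋃ (f : PartialEquiv (NormalDeformation E N) (E × ℝ)) (hf : f ∈ (core N).atlas),
    {(core N).openPartialHomeomorph f hf} at he'
  simp only [mem_iUnion, mem_singleton_iff] at he he'
  obtain ⟨_, ⟨c, rfl⟩, rfl⟩ := he
  obtain ⟨_, ⟨c', rfl⟩, rfl⟩ := he'
  rintro z ⟨hz, -⟩
  exact (c.contDiffAt_transition c' z hz).contDiffWithinAt

end NormalDeformation

end Deformation

/-- A bundled real analytic manifold (without boundary) modelled on a finite-dimensional space. -/
structure AnalyticManifold : Type (u + 1) where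
  Model : Type
  carrier : Type u
  [normed : NormedAddCommGroup Model]
  [normedSpace : NormedSpace ℝ Model]
  [finiteDimensional : FiniteDimensional ℝ Model]
  [topology : TopologicalSpace carrier]
  [charts : ChartedSpace Model carrier]
  [isManifold : IsManifold 𝓘(ℝ, Model) ω carrier]

namespace AnalyticManifold

instance : CoeSort AnalyticManifold.{u} (Type u) := ⟨carrier⟩

attribute [instance] normed normedSpace finiteDimensional topology charts isManifold

end AnalyticManifold

/-- A manifold over `X` with `ℓ` deformation parameters. -/
structure DeformationTower (X : Type u) (ℓ : ℕ) where
  space : AnalyticManifold.{u}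
  p : space → X
  t : Fin ℓ → space → ℝ

namespace DeformationTower
variable {X : Type u} {ℓ : ℕ}

/-- The closure of the inverse image of `A` in the part where no parameter vanishes. For `A = M_{ℓ+1}`
this is the submanifold `M̃_{ℓ+1}` of `X̃_{M_1, …, M_ℓ}`. -/
def strictPreimage (T : DeformationTower X ℓ) (A : Set X) : Set T.space :=
  closure {y | (∀ j, T.t j y ≠ 0) ∧ T.p y ∈ A}

/-- The zero section `S = {t_1 = ⋯ = t_ℓ = 0}`. -/
def zeroSection (T : DeformationTower X ℓ) : Set T.space := {y | ∀ j, T.t j y = 0}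

/-- One step of the iteration: the normal deformation along the closure of the inverse image of `A`. -/
def step (T : DeformationTower X ℓ) (A : Set X) : DeformationTower X (ℓ + 1) where
  space := ⟨T.space.Model × ℝ, NormalDeformation T.space.Model (T.strictPreimage A)⟩
  p y := T.p y.proj
  t := Fin.snoc (α := fun _ => NormalDeformation T.space.Model (T.strictPreimage A) → ℝ)
    (fun j y => T.t j y.proj) NormalDeformation.param

end DeformationTower

section Family
variable (E : Type) [NormedAddCommGroup E] [NormedSpace ℝ E] 
  (X : Type u) [TopologicalSpace X] [ChartedSpace E X] 

/-- The multi-normal deformation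
`X̃_{M_1, …, M_ℓ, M_{ℓ+1}} = (X̃_{M_1, …, M_ℓ})_{M̃_{ℓ+1}}`, with its projection to `X` and its
parameters `t_1, …, t_{ℓ+1}`; for `ℓ = 0` it is `X`. -/
def multiNormalDeformation [FiniteDimensional ℝ E] [IsManifold 𝓘(ℝ, E) ω X] :
    (ℓ : ℕ) → (Fin ℓ → Set X) → DeformationTower X ℓ
  | 0, _ => ⟨⟨E, X⟩, id, fun j => j.elim0⟩
  | ℓ + 1, M => (multiNormalDeformation ℓ fun j => M j.castSucc).step (M (Fin.last ℓ))

variable {X} {ℓ : ℕ} (M : Fin ℓ → Set X)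

/-- The (indices of the) members of the family through `q` that are not comparable with `M_j`. -/
def NR (j : Fin ℓ) (q : X) : Set (Fin ℓ) := {k | q ∈ M k ∧ ¬ M j ⊆ M k ∧ ¬ M k ⊆ M j}

/-- `ι(M_j)`: the intersection of the members that strictly contain `M_j` (`X` if there are none). -/
def iota (j : Fin ℓ) : Set X := ⋂ (k : Fin ℓ) (_ : M j ⊂ M k), M k

/-- The members are connected and mutually distinct. -/
def H1 : Prop := (∀ j, IsConnected (M j)) ∧ Function.Injective M

/-- At every point `q` of a member `M_j`, if some member through `q` is not comparable with `M_j`, then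
the intersection of the tangent spaces of all such members and `T_q M_j` together span `T_q X`. -/
def H2 : Prop := ∀ j, ∀ q ∈ M j, (NR M j q).Nonempty →
  (⨅ k ∈ NR M j q, tangentSubspace (E := E) (M k) q) ⊔ tangentSubspace (E := E) (M j) q = ⊤

/-- `M_j ≠ ι(M_j)` for every `j`. -/
def H3 : Prop := ∀ j, M j ≠ iota M j

/-- The normal bundle `T_A B` of `A` in `B`, for `A ⊆ B`: the fibre at `q ∈ A` is `T_q B / T_q A`. -/
def NormalBundle (A B : Set X) : Type u :=
  Σ q : A, tangentSubspace (E := E) B (q : X) ⧸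
    (tangentSubspace (E := E) A (q : X)).submoduleOf (tangentSubspace (E := E) B (q : X))

/-- The fibre product `T_{M_1} ι(M_1) ×_X ⋯ ×_X T_{M_ℓ} ι(M_ℓ)`. Its base is `⋂ j, M_j`, and its fibre at
`q` is the direct sum of the `T_q ι(M_j) / T_q M_j`. -/
def FiberProduct : Type u :=
  {z : X × (∀ j, NormalBundle E (M j) (iota M j)) // ∀ j, ((z.2 j).1 : X) = z.1}

variable {E M}

namespace FiberProduct

/-- The projection of the fibre product to `X`. -/
def base (z : FiberProduct E M) : X := z.1.1

/-- The tuple `w = (q, v_1, …, v_ℓ)` of a point and tangent vectors represents the element `z` of the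
fibre product: `z` lies over `q`, every `v_j` belongs to `T_q ι(M_j)`, and the `j`-th component of
`z` is the class of `v_j`. -/
def Represents (w : X × (Fin ℓ → TangentBundle 𝓘(ℝ, E) X)) (z : FiberProduct E M) : Prop :=
  w.1 = z.base ∧ ∀ j, ∃ v : tangentSubspace (E := E) (iota M j) ((z.1.2 j).1 : X),
    Submodule.Quotient.mk v = (z.1.2 j).2 ∧ w.2 j = ⟨(z.1.2 j).1, v⟩

end FiberProduct

variable [IsManifold 𝓘(ℝ, E) ω X]

/-- The bijection `Φ` from a subset `S` of an analytic manifold `T` to the fibre product is analytic in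
both directions. The analytic structure of the fibre product, a sum of quotient bundles, is the one
for which passing from representing tangent vectors to classes is a submersion: a map to it is
analytic if it lifts locally to an analytic family of representatives, and a map from it is analytic
if it is an analytic function of the representatives. (`ContMDiffOn` of order `ω` on a subset means
that there are local analytic extensions.) -/
structure IsAnalyticIso {T : AnalyticManifold.{u}} {S : Set T} (Φ : S ≃ FiberProduct E M) :
    Prop where
  analytic : ∀ s : S, ∃ U ∈ 𝓝 (s : T), ∃ σ : T → X × (Fin ℓ → TangentBundle 𝓘(ℝ, E) X),
    ContMDiffOn 𝓘(ℝ, T.Model)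
      (𝓘(ℝ, E).prod (ModelWithCorners.pi fun _ : Fin ℓ => 𝓘(ℝ, E).tangent)) ω σ (U ∩ S) ∧
    ∀ s' : S, (s' : T) ∈ U → FiberProduct.Represents (σ s') (Φ s')
  analytic_symm : ∃ g : X × (Fin ℓ → TangentBundle 𝓘(ℝ, E) X) → T,
    ContMDiffOn (𝓘(ℝ, E).prod (ModelWithCorners.pi fun _ : Fin ℓ => 𝓘(ℝ, E).tangent))
      𝓘(ℝ, T.Model) ω g {w | ∃ z : FiberProduct E M, FiberProduct.Represents w z} ∧
    ∀ w z, FiberProduct.Represents w z → g w = (Φ.symm z : T)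

end Family

section Coordinates
variable {n ℓ : ℕ} {X : Type u} [TopologicalSpace X] [ChartedSpace (EuclideanSpace ℝ (Fin n)) X]

/-- An analytic coordinate system of `X` in which each `M_j` is given by `x_i = 0` for `i ∈ I_j`. -/
structure IsAdaptedChart (M : Fin ℓ → Set X)
    (φ : OpenPartialHomeomorph X (EuclideanSpace ℝ (Fin n))) (I : Fin ℓ → Finset (Fin n)) :
    Prop where
  mem_maximalAtlas : φ ∈ IsManifold.maximalAtlas 𝓘(ℝ, EuclideanSpace ℝ (Fin n)) ω X
  mem_iff : ∀ j, ∀ x ∈ φ.source, x ∈ M j ↔ ∀ i ∈ I j, φ x i = 0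

/-- `t_{J_i}`, the product of the `t_j` over `J_i = {j | i ∈ I_j}`. -/
def tProd (I : Fin ℓ → Finset (Fin n)) (t : Fin ℓ → ℝ) (i : Fin n) : ℝ :=
  ∏ j with i ∈ I j, t j

/-- `Î_j`: the elements of `I_j` that are in no `I_k` strictly contained in `I_j`. -/
def hatI (I : Fin ℓ → Finset (Fin n)) (j : Fin ℓ) : Finset (Fin n) :=
  {i ∈ I j | ∀ k, I k ⊂ I j → i ∉ I k}

/-- `Ψ` is the system of coordinates `(x_1, …, x_n, t_1, …, t_ℓ)` of `X̃` over the domain of the adapted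
coordinates `φ` of `X`: it is bianalytic, its last components are the deformation parameters, and in
it the projection to `X` is `(x, t) ↦ (t_{J_1} x_1, …, t_{J_n} x_n)`. -/
structure IsLocalModel (T : DeformationTower X ℓ)
    (φ : OpenPartialHomeomorph X (EuclideanSpace ℝ (Fin n))) (I : Fin ℓ → Finset (Fin n))
    (Ψ : OpenPartialHomeomorph T.space (EuclideanSpace ℝ (Fin n) × (Fin ℓ → ℝ))) : Prop where
  contMDiffOn : ContMDiffOn 𝓘(ℝ, T.space.Model) 𝓘(ℝ, EuclideanSpace ℝ (Fin n) × (Fin ℓ → ℝ)) ω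
    Ψ Ψ.source
  contMDiffOn_symm : ContMDiffOn 𝓘(ℝ, EuclideanSpace ℝ (Fin n) × (Fin ℓ → ℝ))
    𝓘(ℝ, T.space.Model) ω Ψ.symm Ψ.target
  source_eq : Ψ.source = T.p ⁻¹' φ.source
  target_eq : Ψ.target = {z | (WithLp.toLp 2 fun i => tProd I z.2 i * z.1 i) ∈ φ.target}
  snd_eq : ∀ y ∈ Ψ.source, ∀ j, (Ψ y).2 j = T.t j y
  p_eq : ∀ y ∈ Ψ.source, ∀ i, φ (T.p y) i = tProd I (Ψ y).2 i * (Ψ y).1 i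

/-- In the coordinates `Ψ` of the deformation, `Φ` is linear in the fibres and given by the differentials
of the coordinates of `X`: for `i ∈ Î_j`, the coordinate `x_i` of `s ∈ S` is the value of `dφ_i` on the
`j`-th component of `Φ s`, which is a class in `T_q ι(M_j) / T_q M_j`. -/
def AgreesInCoordinates {M : Fin ℓ → Set X} (T : DeformationTower X ℓ)
    (φ : OpenPartialHomeomorph X (EuclideanSpace ℝ (Fin n))) (I : Fin ℓ → Finset (Fin n))
    (Ψ : OpenPartialHomeomorph T.space (EuclideanSpace ℝ (Fin n) × (Fin ℓ → ℝ)))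
    (Φ : T.zeroSection ≃ FiberProduct (EuclideanSpace ℝ (Fin n)) M) : Prop :=
  ∀ s : T.zeroSection, (s : T.space) ∈ Ψ.source → ∀ j,
    ∀ v : tangentSubspace (E := EuclideanSpace ℝ (Fin n)) (iota M j) (((Φ s).1.2 j).1 : X),
      Submodule.Quotient.mk v = ((Φ s).1.2 j).2 → ∀ i ∈ hatI I j,
        (Ψ s).1 i = mfderiv 𝓘(ℝ, EuclideanSpace ℝ (Fin n)) 𝓘(ℝ, ℝ) (fun x => φ x i)
          (((Φ s).1.2 j).1 : X) v

end Coordinates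

end

end MultiNormal

open MultiNormal

/-!
The bijection `Φ` is constructed through adapted coordinates. Over the domain of adapted coordinates
`φ` the multi-normal deformation has the coordinates `(x, t)` with `φ_i = t_{J_i} x_i`, by induction on
the number of members: in these coordinates the strict preimage of the next member is again a
coordinate subspace (`IsLocalModel.mem_strictPreimage_iff`), and one more deformation multiplies its
equations by the new parameter (`IsLocalModel.exists_step`). On `S = {t = 0}` the free coordinates are
the `φ_i` with `i` in no `I_j`, which are coordinates of `M = ⋂ j, M_j`, and the `x_i` with `i` in some
`I_j`. The sets `Î_j` are a partition of `⋃ j, I_j`: incomparable members meet transversally, so two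
members that share an equation are comparable. The `dφ_i` with `i ∈ Î_j` are coordinates of
`T_q ι(M_j) / T_q M_j`. Hence `x_i(s) = dφ_i(v_j)` defines a bijection over the domain of `φ`.

It does not depend on `φ` (`IsLocalModel.coordDeriv_eq`). Along the curve `(x, τ, …, τ)`, which ends in
`s`, the coordinate `φ_i` is `τ ^ card J_i * x_i`. For `i ∈ Î_j` this exponent is the number `N` of
members contained in `M_j`, and for the other `i ∈ I_j` it is larger. The equations of `M_j` in another
adapted system `φ'` vanish on `M_j`, so that for `i ∈ Î'_j` the first-order expansion of `φ'_i` divided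
by `τ ^ N` gives `x'_i(s)` as the value of `dφ'_i` on a vector with the coordinates `x_i`, `i ∈ Î_j`.
The relation `Corresponds` is the resulting description of `Φ` in all adapted systems at once.

Two facts hold the construction together. First, that `M_j ⊆ M_k` can be read off the index sets is a
global statement about a local condition; it follows from the identity theorem for analytic functions
and connectedness (`IsClosedSubmanifold.subset_of_eventually`). Second, adapted coordinates exist at
every point `q` of `M` (`exists_isAdaptedChart`): the conormal spaces of the members at `q` are an
order-reversing family in which incomparable members are independent, so `T_q^* X` has a basis
adapted to all of them (`exists_adapted_basis`). A basis vector in the conormal space of `M_j` is the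
differential of a function vanishing on `M_j`, and the inverse function theorem makes these functions
a coordinate system.

Analyticity in both directions is read off the local models: the vectors with coordinates `x_i`, `i ∈
Î_j`, and otherwise `0`, are analytic representatives of `Φ s`, and conversely the coordinates of
`Φ⁻¹ z` are analytic functions of arbitrary representatives of `z`.
-/

namespace MultiNormal

noncomputable section

/-! ### Local models of the multi-normal deformation -/

section LocalModels
variable {n ℓ : ℕ}

/-- The projection of `ℝⁿ` onto the coordinates with index in `J`; the other ones are set to `0`. -/
def coordProj (J : Finset (Fin n)) :
    EuclideanSpace ℝ (Fin n) →L[ℝ] EuclideanSpace ℝ (Fin n) :=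
  LinearMap.toContinuousLinearMap
    { toFun := fun x => WithLp.toLp 2 fun i => if i ∈ J then x i else 0
      map_add' := fun x y => by ext i; simp only [PiLp.add_apply]; split_ifs <;> simp
      map_smul' := fun c x => by
        ext i; simp only [PiLp.smul_apply, RingHom.id_apply]; split_ifs <;> simp }

@[simp] theorem coordProj_apply (J : Finset (Fin n)) (x : EuclideanSpace ℝ (Fin n)) (i : Fin n) :
    coordProj J x i = if i ∈ J then x i else 0 := rfl

theorem coordProj_idem (J : Finset (Fin n)) (x : EuclideanSpace ℝ (Fin n)) :
    coordProj J (coordProj J x) = coordProj J x := by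
  ext i; by_cases hi : i ∈ J <;> simp [hi]

theorem coordProj_eq_zero_iff {J : Finset (Fin n)} {x : EuclideanSpace ℝ (Fin n)} :
    coordProj J x = 0 ↔ ∀ i ∈ J, x i = 0 := by
  constructor
  · intro h i hi
    have := congrArg (fun y : EuclideanSpace ℝ (Fin n) => y i) h
    simpa [hi] using this
  · intro h
    ext i
    by_cases hi : i ∈ J
    · simp [hi, h i hi]
    · simp [hi]

/-- Appending a last parameter, as a linear isomorphism `(F × ℝ^ℓ) × ℝ ≃ F × ℝ^{ℓ+1}`. -/
def snocEquiv (F : Type*) [NormedAddCommGroup F] [NormedSpace ℝ F] [FiniteDimensional ℝ F] (ℓ : ℕ) :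
    ((F × (Fin ℓ → ℝ)) × ℝ) ≃L[ℝ] F × (Fin (ℓ + 1) → ℝ) :=
  LinearEquiv.toContinuousLinearEquiv
    { toFun := fun z => (z.1.1, Fin.snoc (α := fun _ => ℝ) z.1.2 z.2)
      invFun := fun z => ((z.1, Fin.init (α := fun _ => ℝ) z.2), z.2 (Fin.last ℓ))
      left_inv := fun z => by simp
      right_inv := fun z => by simp
      map_add' := fun z w => by
        refine Prod.ext rfl (funext fun j => ?_)
        refine Fin.lastCases ?_ (fun j => ?_) j <;> simp
      map_smul' := fun c z => by
        refine Prod.ext rfl (funext fun j => ?_)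
        refine Fin.lastCases ?_ (fun j => ?_) j <;> simp }

theorem tProd_snoc (I : Fin ℓ → Finset (Fin n)) (J : Finset (Fin n)) (t : Fin ℓ → ℝ) (r : ℝ)
    (i : Fin n) :
    tProd (Fin.snoc (α := fun _ => Finset (Fin n)) I J) (Fin.snoc (α := fun _ => ℝ) t r) i =
      tProd I t i * (if i ∈ J then r else 1) := by
  simp only [tProd, Finset.prod_filter, Fin.prod_univ_castSucc, Fin.snoc_castSucc, Fin.snoc_last]

theorem tProd_ne_zero {I : Fin ℓ → Finset (Fin n)} {t : Fin ℓ → ℝ} (ht : ∀ j, t j ≠ 0)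
    (i : Fin n) : tProd I t i ≠ 0 := Finset.prod_ne_zero_iff.2 fun j _ => ht j

variable {X : Type u} [TopologicalSpace X]
  {T : DeformationTower X ℓ} {φ : OpenPartialHomeomorph X (EuclideanSpace ℝ (Fin n))}
  {I : Fin ℓ → Finset (Fin n)}
  {Ψ : OpenPartialHomeomorph T.space (EuclideanSpace ℝ (Fin n) × (Fin ℓ → ℝ))}

/-- In a local model the strict preimage of a coordinate subspace is a coordinate subspace. -/
theorem IsLocalModel.mem_strictPreimage_iff (h : IsLocalModel T φ I Ψ) {A : Set X}
    {J : Finset (Fin n)} (hA : ∀ x ∈ φ.source, x ∈ A ↔ ∀ i ∈ J, φ x i = 0) {y : T.space}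
    (hy : y ∈ Ψ.source) : y ∈ T.strictPreimage A ↔ ∀ i ∈ J, (Ψ y).1 i = 0 := by
  have hoff : ∀ y ∈ Ψ.source, (∀ j, T.t j y ≠ 0) → (T.p y ∈ A ↔ ∀ i ∈ J, (Ψ y).1 i = 0) := by
    intro y hy ht
    have hyφ : T.p y ∈ φ.source := by rw [h.source_eq] at hy; exact hy
    rw [hA _ hyφ]
    refine forall₂_congr fun i _ => ?_
    rw [h.p_eq y hy, mul_eq_zero,
      or_iff_right (tProd_ne_zero (fun j => by rw [h.snd_eq y hy]; exact ht j) i)]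
  constructor
  · intro hcl i hi
    by_contra hne
    have hc : ContinuousAt (fun y => (Ψ y).1 i) y := by
      have := (Ψ.continuousAt hy).fst
      exact (PiLp.continuous_apply 2 _ i).continuousAt.comp this
    obtain ⟨y', ⟨h1, h2⟩, h3, h4⟩ := mem_closure_iff_nhds.1 hcl _
      (inter_mem (hc.eventually_ne hne) (Ψ.open_source.mem_nhds hy))
    exact h1 ((hoff y' h2 h3).1 h4 i hi)
  · intro hz
    let z : ℝ → EuclideanSpace ℝ (Fin n) × (Fin ℓ → ℝ) := fun τ => ((Ψ y).1, fun j => (Ψ y).2 j + τ)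
    have hz0 : z 0 = Ψ y := by simp [z]
    have hzc : Continuous z := by fun_prop
    have hzt : Tendsto z (𝓝[≠] 0) (𝓝 (Ψ y)) := by
      rw [← hz0]; exact (hzc.tendsto 0).mono_left nhdsWithin_le_nhds
    have hlim : Tendsto (fun τ => Ψ.symm (z τ)) (𝓝[≠] 0) (𝓝 y) := by
      have := (Ψ.continuousAt_symm (Ψ.map_source hy)).tendsto.comp hzt
      rwa [Ψ.left_inv hy] at this
    refine mem_closure_of_tendsto hlim ?_
    have hne : ∀ j, ∀ᶠ τ in 𝓝[≠] (0 : ℝ), (Ψ y).2 j + τ ≠ 0 := by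
      intro j
      by_cases hj : (Ψ y).2 j = 0
      · filter_upwards [self_mem_nhdsWithin] with τ hτ
        simpa [hj] using hτ
      · have : ContinuousAt (fun τ : ℝ => (Ψ y).2 j + τ) 0 := by fun_prop
        exact nhdsWithin_le_nhds (this.eventually_ne (by simpa using hj))
    filter_upwards [eventually_all.2 hne, hzt.eventually (Ψ.open_target.mem_nhds (Ψ.map_source hy))]
      with τ h1 h2
    have h3 := Ψ.map_target h2
    have h4 : ∀ j, T.t j (Ψ.symm (z τ)) ≠ 0 := by
      intro j
      rw [← h.snd_eq _ h3, Ψ.right_inv h2]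
      exact h1 j
    refine ⟨h4, (hoff _ h3 h4).2 ?_⟩
    rw [Ψ.right_inv h2]
    exact hz

/-- The local model of a tower gives one of the next step of the iteration: in the slice chart
attached to the local model, the new chart of the normal deformation multiplies the coordinates in
`J` by the new parameter. -/
theorem IsLocalModel.exists_step (L : T.space.Model ≃L[ℝ] EuclideanSpace ℝ (Fin n) × (Fin ℓ → ℝ))
    (h : IsLocalModel T φ I Ψ) {A : Set X}
    {J : Finset (Fin n)} (hA : ∀ x ∈ φ.source, x ∈ A ↔ ∀ i ∈ J, φ x i = 0) :
    ∃ Ψ', IsLocalModel (T.step A) φ (Fin.snoc (α := fun _ => Finset (Fin n)) I J) Ψ' := by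
  classical
  let N := T.strictPreimage A
  let Q : EuclideanSpace ℝ (Fin n) × (Fin ℓ → ℝ) →L[ℝ] EuclideanSpace ℝ (Fin n) × (Fin ℓ → ℝ) :=
    ((coordProj J).comp (ContinuousLinearMap.fst ℝ _ _)).prod 0
  let P : T.space.Model →L[ℝ] T.space.Model :=
    (L.symm : _ →L[ℝ] _).comp (Q.comp (L : _ →L[ℝ] _))
  have hLP : ∀ v, L (P v) = (coordProj J (L v).1, 0) := fun v => by simp [P, Q]
  have hidem : ∀ v, P (P v) = P v := fun v => L.injective (by simp [hLP, coordProj_idem])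
  let e : OpenPartialHomeomorph T.space T.space.Model :=
    Ψ.trans L.symm.toHomeomorph.toOpenPartialHomeomorph
  have hes : e.source = Ψ.source := by simp [e]
  have het : ∀ z, z ∈ e.target ↔ L z ∈ Ψ.target := fun z => by simp [e]
  have hea : ∀ y, L (e y) = Ψ y := fun y => by simp [e]
  have hemem : e ∈ IsManifold.maximalAtlas 𝓘(ℝ, T.space.Model) ω T.space := by
    refine e.mem_maximalAtlas_of_contMDiffOn ?_ ?_
    · rw [hes]
      exact (L.symm.contDiff (n := ω)).contMDiff.comp_contMDiffOn h.contMDiffOn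
    · exact h.contMDiffOn_symm.comp (L.contDiff (n := ω)).contMDiff.contMDiffOn
        fun z hz => (het z).1 hz
  have hslice : IsSliceChart N e P := by
    refine ⟨hemem, hidem, fun y hy => ?_⟩
    rw [hes] at hy
    rw [h.mem_strictPreimage_iff hA hy, ← L.map_eq_zero_iff, hLP, hea, Prod.mk_eq_zero,
      coordProj_eq_zero_iff]
    simp
  let c : DeformationChart (E := T.space.Model) T.space N :=
    ⟨e, hemem, P, hidem, True, fun _ => hslice⟩
  let k : OpenPartialHomeomorph (NormalDeformation T.space.Model N) (T.space.Model × ℝ) :=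
    (NormalDeformation.core N).openPartialHomeomorph c.toPartialEquiv ⟨c, rfl⟩
  have hk : k ∈ IsManifold.maximalAtlas 𝓘(ℝ, T.space.Model × ℝ) ω
      (NormalDeformation T.space.Model N) := by
    refine IsManifold.subset_maximalAtlas ?_
    change k ∈ ⋃ (f : PartialEquiv (NormalDeformation T.space.Model N) (T.space.Model × ℝ))
      (hf : f ∈ (NormalDeformation.core N).atlas),
      {(NormalDeformation.core N).openPartialHomeomorph f hf}
    simp only [mem_iUnion, mem_singleton_iff]
    exact ⟨c.toPartialEquiv, ⟨c, rfl⟩, rfl⟩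
  let L' : (T.space.Model × ℝ) ≃L[ℝ] EuclideanSpace ℝ (Fin n) × (Fin (ℓ + 1) → ℝ) :=
    (L.prodCongr (ContinuousLinearEquiv.refl ℝ ℝ)).trans (snocEquiv _ ℓ)
  have hL' : ∀ z, L' z = ((L z.1).1, Fin.snoc (α := fun _ => ℝ) (L z.1).2 z.2) := fun z => rfl
  have hscale : ∀ (r : ℝ) (z : T.space.Model), L (scale P r z) =
      (WithLp.toLp 2 fun i => (if i ∈ J then r else 1) * (L z).1 i, (L z).2) := by
    intro r z
    refine Prod.ext ?_ ?_
    · ext i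
      by_cases hi : i ∈ J <;> simp [scale, hLP, hi]
    · simp [scale, hLP]
  let Ψ' : OpenPartialHomeomorph (NormalDeformation T.space.Model N)
      (EuclideanSpace ℝ (Fin n) × (Fin (ℓ + 1) → ℝ)) :=
    k.trans L'.toHomeomorph.toOpenPartialHomeomorph
  have hs : ∀ a, a ∈ Ψ'.source ↔ a.proj ∈ Ψ.source := by
    intro a
    rw [← hes]
    have : Ψ'.source = c.source := by simp [Ψ', k]; rfl
    rw [this]
    exact ⟨fun h => h.1, fun h => ⟨h, fun _ => trivial⟩⟩
  have hΨ' : ∀ a, Ψ' a = L' (c.toFun a) := fun a => rfl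
  have hsc : ∀ a ∈ Ψ'.source, Ψ a.proj = (WithLp.toLp 2 fun i => (if i ∈ J then a.param else 1) *
      (Ψ' a).1 i, (L (c.toFun a).1).2) := by
    intro a ha
    have := c.scale_toFun (a := a) ⟨by rw [hs] at ha; exact hes ▸ ha, fun _ => trivial⟩
    have h2 := congrArg L this
    rw [hea, hscale, c.toFun_snd] at h2
    exact h2.symm
  have f1 : ContMDiffOn 𝓘(ℝ, T.space.Model × ℝ) 𝓘(ℝ, EuclideanSpace ℝ (Fin n) × (Fin (ℓ + 1) → ℝ)) ω
      Ψ' Ψ'.source := by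
    have : Ψ'.source = k.source := by simp [Ψ']
    rw [this]
    exact (L'.contDiff (n := ω)).contMDiff.comp_contMDiffOn (contMDiffOn_of_mem_maximalAtlas hk)
  have f2 : ContMDiffOn 𝓘(ℝ, EuclideanSpace ℝ (Fin n) × (Fin (ℓ + 1) → ℝ)) 𝓘(ℝ, T.space.Model × ℝ) ω
      Ψ'.symm Ψ'.target :=
    (contMDiffOn_symm_of_mem_maximalAtlas hk).comp
      (L'.symm.contDiff (n := ω)).contMDiff.contMDiffOn fun z hz => by simpa [Ψ'] using hz
  have f3 : Ψ'.source = (fun a => T.p a.proj) ⁻¹' φ.source := by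
    ext a
    rw [hs, h.source_eq]
    rfl
  have f4 : Ψ'.target = {z | (WithLp.toLp 2 fun i =>
      tProd (Fin.snoc (α := fun _ => Finset (Fin n)) I J) z.2 i * z.1 i) ∈ φ.target} := by
    ext z
    obtain ⟨w, rfl⟩ := L'.surjective z
    have h1 : L' w ∈ Ψ'.target ↔ w ∈ c.target := by
      have : L' w ∈ Ψ'.target ↔ w ∈ k.target := by simp [Ψ']
      rw [this]; rfl
    have h2 : w ∈ c.target ↔ scale P w.2 w.1 ∈ e.target :=
      ⟨fun h => h.1, fun h => ⟨h, fun _ => trivial⟩⟩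
    rw [h1, h2, het, hscale, h.target_eq]
    simp only [mem_ofPred_eq, hL', tProd_snoc, mul_assoc]
  have f5 : ∀ a ∈ Ψ'.source, ∀ j, (Ψ' a).2 j =
      Fin.snoc (α := fun _ => ℝ) (fun j => T.t j a.proj) a.param j := by
    intro a ha j
    rw [hΨ', hL']
    refine Fin.lastCases ?_ (fun j => ?_) j
    · simp only [Fin.snoc_last, c.toFun_snd]
    · have h1 := h.snd_eq a.proj ((hs a).1 ha) j
      rw [hsc a ha] at h1
      simp only [Fin.snoc_castSucc]
      exact h1
  have f6 : ∀ a ∈ Ψ'.source, ∀ i, φ (T.p a.proj) i =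
      tProd (Fin.snoc (α := fun _ => Finset (Fin n)) I J) (Ψ' a).2 i * (Ψ' a).1 i := by
    intro a ha i
    have h1 := h.p_eq a.proj ((hs a).1 ha) i
    rw [hsc a ha] at h1
    refine h1.trans ?_
    have h2 : (Ψ' a).2 = Fin.snoc (α := fun _ => ℝ) (L (c.toFun a).1).2 a.param := by
      rw [hΨ', hL', c.toFun_snd]
    rw [h2, tProd_snoc, mul_assoc]
  refine ⟨Ψ', f1, f2, f3, f4, fun a ha j => ?_, f6⟩
  refine (f5 a ha j).trans ?_
  refine Fin.lastCases ?_ (fun j => ?_) j <;> simp [DeformationTower.step]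

variable (E : Type) [NormedAddCommGroup E] [NormedSpace ℝ E] [FiniteDimensional ℝ E]
  (Y : Type u) [TopologicalSpace Y] [ChartedSpace E Y] [IsManifold 𝓘(ℝ, E) ω Y]

/-- The model space of the `ℓ`-fold deformation has `ℓ` more dimensions than that of the base. -/
theorem nonempty_model_equiv : ∀ (ℓ : ℕ) (M : Fin ℓ → Set Y),
    Nonempty ((multiNormalDeformation E Y ℓ M).space.Model ≃L[ℝ] E × (Fin ℓ → ℝ))
  | 0, _ => ⟨((ContinuousLinearEquiv.prodUnique ℝ E (Fin 0 → ℝ)).symm : E ≃L[ℝ] E × (Fin 0 → ℝ))⟩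
  | ℓ + 1, M => by
    obtain ⟨L⟩ := nonempty_model_equiv ℓ fun j => M j.castSucc
    exact ⟨(L.prodCongr (ContinuousLinearEquiv.refl ℝ ℝ)).trans (snocEquiv E ℓ)⟩

theorem NormalDeformation.continuous_proj (N : Set Y) :
    Continuous (NormalDeformation.proj : NormalDeformation E N → Y) := by
  refine continuous_iff_continuousAt.2 fun a => ?_
  obtain ⟨c, hc⟩ := NormalDeformation.exists_chart N a
  let k : OpenPartialHomeomorph (NormalDeformation E N) (E × ℝ) :=
    (NormalDeformation.core N).openPartialHomeomorph c.toPartialEquiv ⟨c, rfl⟩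
  have hk : a ∈ k.source := hc
  have h1 : ContinuousAt (fun b => c.e.symm (scale c.P (k b).2 (k b).1)) a := by
    have h2 : ContinuousAt (fun b => scale c.P (k b).2 (k b).1) a :=
      (DeformationChart.continuous_scale c.P).continuousAt.comp (k.continuousAt hk)
    refine ContinuousAt.comp (g := c.e.symm) ?_ h2
    refine c.e.continuousAt_symm ?_
    have := c.scale_toFun hc
    change scale c.P (c.toFun a).2 (c.toFun a).1 ∈ _
    rw [this]
    exact c.e.map_source hc.1
  refine h1.congr ?_
  filter_upwards [k.open_source.mem_nhds hk] with b hb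
  have := c.scale_toFun (show b ∈ c.source from hb)
  change c.e.symm (scale c.P (c.toFun b).2 (c.toFun b).1) = _
  rw [this, c.e.left_inv]
  exact (show b ∈ c.source from hb).1

theorem continuous_multiNormalDeformation_p : ∀ (ℓ : ℕ) (M : Fin ℓ → Set Y),
    Continuous (multiNormalDeformation E Y ℓ M).p
  | 0, _ => continuous_id (X := Y)
  | ℓ + 1, M =>
    (continuous_multiNormalDeformation_p ℓ fun j => M j.castSucc).comp
      (NormalDeformation.continuous_proj (multiNormalDeformation E Y ℓ fun j => M j.castSucc).space.Model
        (multiNormalDeformation E Y ℓ fun j => M j.castSucc).space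
        ((multiNormalDeformation E Y ℓ fun j => M j.castSucc).strictPreimage (M (Fin.last ℓ))))

/-- The parameter `t_j` vanishes only over `M_j`. -/
theorem p_mem_of_t_eq_zero : ∀ (ℓ : ℕ) (M : Fin ℓ → Set Y), (∀ j, IsClosed (M j)) →
    ∀ (j : Fin ℓ) (y : (multiNormalDeformation E Y ℓ M).space),
      (multiNormalDeformation E Y ℓ M).t j y = 0 → (multiNormalDeformation E Y ℓ M).p y ∈ M j
  | 0, _, _, j, _, _ => j.elim0
  | ℓ + 1, M, hM, j, y, h => by
    let T := multiNormalDeformation E Y ℓ fun j => M j.castSucc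
    let N := T.strictPreimage (M (Fin.last ℓ))
    change (T.step (M (Fin.last ℓ))).t j y = 0 at h
    change T.p (NormalDeformation.proj (N := N) y) ∈ M j
    induction j using Fin.lastCases with
    | cast j =>
      refine p_mem_of_t_eq_zero ℓ (fun j => M j.castSucc) (fun j => hM _) j _ ?_
      simpa [DeformationTower.step] using h
    | last =>
      have h' : NormalDeformation.param (N := N) y = 0 := by
        simpa [DeformationTower.step] using h
      have hy : NormalDeformation.proj (N := N) y ∈ N := by
        cases (y : NormalDeformation T.space.Model N) with
        | off x t ht => exact (ht h').elim
        | normal q hq ν => exact hq.1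
      have hc : Continuous T.p := continuous_multiNormalDeformation_p E Y ℓ _
      have := hc.closure_preimage_subset (M (Fin.last ℓ))
        (closure_mono (fun z (hz : z ∈ {y | (∀ j, T.t j y ≠ 0) ∧ T.p y ∈ M (Fin.last ℓ)}) => hz.2) hy)
      rwa [(hM _).closure_eq] at this

variable [ChartedSpace (EuclideanSpace ℝ (Fin n)) X]
  [IsManifold 𝓘(ℝ, EuclideanSpace ℝ (Fin n)) ω X]

/-- Over the domain of adapted coordinates the multi-normal deformation has a local model. -/
theorem exists_isLocalModel (φ : OpenPartialHomeomorph X (EuclideanSpace ℝ (Fin n))) :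
    ∀ (ℓ : ℕ) (M : Fin ℓ → Set X) (I : Fin ℓ → Finset (Fin n)), IsAdaptedChart M φ I →
      ∃ Ψ, IsLocalModel (multiNormalDeformation (EuclideanSpace ℝ (Fin n)) X ℓ M) φ I Ψ
  | 0, M, I, h => by
    let L : EuclideanSpace ℝ (Fin n) ≃L[ℝ] EuclideanSpace ℝ (Fin n) × (Fin 0 → ℝ) :=
      (ContinuousLinearEquiv.prodUnique ℝ (EuclideanSpace ℝ (Fin n)) (Fin 0 → ℝ)).symm
    have hL' : ∀ z, L.symm z = z.1 := fun z => rfl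
    let Ψ : OpenPartialHomeomorph X (EuclideanSpace ℝ (Fin n) × (Fin 0 → ℝ)) :=
      φ.trans L.toHomeomorph.toOpenPartialHomeomorph
    have hone : ∀ t i, tProd I t i = 1 := fun t i => by simp [tProd]
    have f1 : ContMDiffOn 𝓘(ℝ, EuclideanSpace ℝ (Fin n))
        𝓘(ℝ, EuclideanSpace ℝ (Fin n) × (Fin 0 → ℝ)) ω Ψ Ψ.source := by
      have : Ψ.source = φ.source := by simp [Ψ]
      rw [this]
      exact (L.contDiff (n := ω)).contMDiff.comp_contMDiffOn
        (contMDiffOn_of_mem_maximalAtlas h.mem_maximalAtlas)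
    have f2 : ContMDiffOn 𝓘(ℝ, EuclideanSpace ℝ (Fin n) × (Fin 0 → ℝ))
        𝓘(ℝ, EuclideanSpace ℝ (Fin n)) ω Ψ.symm Ψ.target :=
      (contMDiffOn_symm_of_mem_maximalAtlas h.mem_maximalAtlas).comp
        (L.symm.contDiff (n := ω)).contMDiff.contMDiffOn fun z hz => by simpa [Ψ] using hz
    have f3 : Ψ.source = φ.source := by simp [Ψ]
    have f4 : Ψ.target = {z | (WithLp.toLp 2 fun i => tProd I z.2 i * z.1 i) ∈ φ.target} := by
      ext z
      simp [Ψ, hone, hL']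
    exact ⟨Ψ, f1, f2, f3, f4, fun y _ j => j.elim0, fun y _ i => by rw [hone, one_mul]; rfl⟩
  | ℓ + 1, M, I, h => by
    obtain ⟨Ψ, hΨ⟩ := exists_isLocalModel φ ℓ (fun j => M j.castSucc) (fun j => I j.castSucc)
      ⟨h.mem_maximalAtlas, fun j => h.mem_iff j.castSucc⟩
    obtain ⟨L⟩ := nonempty_model_equiv (EuclideanSpace ℝ (Fin n)) X ℓ fun j => M j.castSucc
    obtain ⟨Ψ', hΨ'⟩ := hΨ.exists_step L (h.mem_iff (Fin.last ℓ))
    have : (Fin.snoc (α := fun _ => Finset (Fin n)) (fun j => I j.castSucc) (I (Fin.last ℓ))) = I :=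
      Fin.snoc_init_self I
    rw [this] at hΨ'
    exact ⟨Ψ', hΨ'⟩

end LocalModels

/-! ### The identity theorem for closed submanifolds -/

section IdentityTheorem
variable {E : Type} [NormedAddCommGroup E] [NormedSpace ℝ E] [FiniteDimensional ℝ E]
  {X : Type u} [TopologicalSpace X] [ChartedSpace E X]

/-- If every neighbourhood of `r` contains a point of `A` near which `A ⊆ B`, then `A ⊆ B` near `r`:
in slice charts the defining equations of `B` are analytic functions on a ball of `A`. -/
theorem IsClosedSubmanifold.eventually_mem_of_mem_closure {A B : Set X}
    (hA : IsClosedSubmanifold E A) (hB : IsClosedSubmanifold E B) {r : X} (hr : r ∈ A)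
    (hcl : r ∈ closure ({x | ∀ᶠ y in 𝓝 x, y ∈ A → y ∈ B} ∩ A)) :
    ∀ᶠ y in 𝓝 r, y ∈ A → y ∈ B := by
  have := FiniteDimensional.complete ℝ E
  have hrB : r ∈ B := by
    have : ({x | ∀ᶠ y in 𝓝 x, y ∈ A → y ∈ B} ∩ A) ⊆ B := fun x hx => hx.1.self_of_nhds hx.2
    exact hB.isClosed.closure_subset_iff.2 this hcl
  obtain ⟨e, P, hs, hre⟩ := hA.exists_sliceChart r hr
  obtain ⟨e', P', hs', hre'⟩ := hB.exists_sliceChart r hrB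
  have hPr : P (e r) = 0 := (hs.mem_iff r hre).1 hr
  let W : Set E := (fun y => y - P y) ⁻¹' (e.symm.trans e').source
  have hW : IsOpen W := (e.symm.trans e').open_source.preimage (by fun_prop)
  have hrW : e r ∈ W := by simp [W, hPr, hre, hre']
  obtain ⟨δ, hδ, hball⟩ := Metric.isOpen_iff.1 hW _ hrW
  let f : E → E := fun y => P' (e' (e.symm (y - P y)))
  have hf : AnalyticOnNhd ℝ f (Metric.ball (e r) δ) := by
    intro y hy
    have hyW := hball hy
    simp only [W, mem_preimage, OpenPartialHomeomorph.trans_source,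
      OpenPartialHomeomorph.symm_source, mem_inter_iff] at hyW
    have h1 : ContDiffAt ℝ ω (e' ∘ e.symm) (y - P y) :=
      ((contMDiffAt_of_mem_maximalAtlas hs'.mem_maximalAtlas hyW.2).comp _
        (contMDiffAt_symm_of_mem_maximalAtlas hs.mem_maximalAtlas hyW.1)).contDiffAt
    have h2 : ContDiffAt ℝ ω (fun y => y - P y) y := by fun_prop
    have h3 : ContDiffAt ℝ ω ((e' ∘ e.symm) ∘ fun y => y - P y) y := h1.comp y h2
    have h4 : ContDiffAt ℝ ω f y := P'.contDiff.contDiffAt.comp y h3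
    exact DeformationChart.contDiffAt_iff_analyticAt.1 h4
  have hn : e.source ∩ e ⁻¹' Metric.ball (e r) δ ∈ 𝓝 r :=
    inter_mem (e.open_source.mem_nhds hre)
      ((e.continuousAt hre).preimage_mem_nhds (Metric.ball_mem_nhds _ hδ))
  obtain ⟨r', ⟨hr'e, hr'b⟩, hr'G, hr'A⟩ := mem_closure_iff_nhds.1 hcl _ hn
  have hPr' : P (e r') = 0 := (hs.mem_iff r' hr'e).1 hr'A
  have hf0 : f =ᶠ[𝓝 (e r')] 0 := by
    have hc : Tendsto (fun y => e.symm (y - P y)) (𝓝 (e r')) (𝓝 r') := by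
      have h1 : Tendsto (fun y => y - P y) (𝓝 (e r')) (𝓝 (e r')) := by
        have : Continuous fun y => y - P y := by fun_prop
        simpa [hPr'] using this.tendsto (e r')
      have h2 := (e.continuousAt_symm (e.map_source hr'e)).tendsto.comp h1
      rwa [e.left_inv hr'e] at h2
    filter_upwards [hc.eventually hr'G, hW.mem_nhds (hball hr'b)] with y hy hyW
    simp only [W, mem_preimage, OpenPartialHomeomorph.trans_source,
      OpenPartialHomeomorph.symm_source, mem_inter_iff] at hyW
    refine (hs'.mem_iff _ hyW.2).1 (hy ((hs.mem_iff _ (e.map_target hyW.1)).2 ?_))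
    rw [e.right_inv hyW.1]
    simp [hs.idem]
  have hz := hf.eqOn_zero_of_preconnected_of_eventuallyEq_zero
    (convex_ball _ _).isPreconnected hr'b hf0
  filter_upwards [hn] with x ⟨hxe, hxb⟩ hxA
  have hPx : P (e x) = 0 := (hs.mem_iff x hxe).1 hxA
  have hxW := hball hxb
  simp only [W, mem_preimage, OpenPartialHomeomorph.trans_source,
    OpenPartialHomeomorph.symm_source, mem_inter_iff, hPx, sub_zero, e.left_inv hxe] at hxW
  refine (hs'.mem_iff x hxW.2).2 ?_
  have := hz hxb
  simpa [f, hPx, e.left_inv hxe] using this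

/-- A connected submanifold that is contained in a closed submanifold near one of its points is
contained in it. -/
theorem IsClosedSubmanifold.subset_of_eventually {A B : Set X}
    (hA : IsClosedSubmanifold E A) (hB : IsClosedSubmanifold E B) (hc : IsPreconnected A) {q : X}
    (hq : q ∈ A) (h : ∀ᶠ y in 𝓝 q, y ∈ A → y ∈ B) : A ⊆ B := by
  let G : Set X := {x | ∀ᶠ y in 𝓝 x, y ∈ A → y ∈ B}
  have hG : IsOpen G := isOpen_setOfPred_eventually_nhds
  by_contra hne
  obtain ⟨x, hxA, hxB⟩ := not_subset.1 hne
  have hcov : A ⊆ G ∪ (closure (G ∩ A))ᶜ := fun r hr => by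
    by_cases hcl : r ∈ closure (G ∩ A)
    · exact Or.inl (hA.eventually_mem_of_mem_closure hB hr hcl)
    · exact Or.inr hcl
  have hxG : x ∉ G := fun hx => hxB (hx.self_of_nhds hxA)
  obtain ⟨y, hyA, hyG, hy⟩ := hc G _ hG isClosed_closure.isOpen_compl hcov ⟨q, hq, h⟩
    ⟨x, hxA, (hcov hxA).resolve_left hxG⟩
  exact hy (subset_closure ⟨hyG, hyA⟩)

end IdentityTheorem

/-! ### Linear algebra in adapted coordinates -/

section AdaptedCharts
variable {n ℓ : ℕ} {X : Type u} [TopologicalSpace X] [ChartedSpace (EuclideanSpace ℝ (Fin n)) X]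
  {M : Fin ℓ → Set X} {φ : OpenPartialHomeomorph X (EuclideanSpace ℝ (Fin n))}
  {I : Fin ℓ → Finset (Fin n)} {q : X}

theorem IsAdaptedChart.isSliceChart (h : IsAdaptedChart M φ I) (j : Fin ℓ) :
    IsSliceChart (M j) φ (coordProj (I j)) :=
  ⟨h.mem_maximalAtlas, coordProj_idem _, fun x hx => by
    rw [h.mem_iff j x hx, coordProj_eq_zero_iff]⟩

/-- The differential at `q` of a map to `ℝⁿ`, in practice of a coordinate system, with values in
`ℝⁿ` instead of the tangent space of `ℝⁿ` at the image point. -/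
def coordDeriv (f : X → EuclideanSpace ℝ (Fin n)) (q : X)
    (v : TangentSpace 𝓘(ℝ, EuclideanSpace ℝ (Fin n)) q) : EuclideanSpace ℝ (Fin n) :=
  mfderiv 𝓘(ℝ, EuclideanSpace ℝ (Fin n)) 𝓘(ℝ, EuclideanSpace ℝ (Fin n)) f q v

theorem coordDeriv_add (v w : TangentSpace 𝓘(ℝ, EuclideanSpace ℝ (Fin n)) q) :
    coordDeriv φ q (v + w) = coordDeriv φ q v + coordDeriv φ q w := map_add _ _ _

theorem coordDeriv_sub (v w : TangentSpace 𝓘(ℝ, EuclideanSpace ℝ (Fin n)) q) :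
    coordDeriv φ q (v - w) = coordDeriv φ q v - coordDeriv φ q w := map_sub _ _ _

theorem IsAdaptedChart.coordDeriv_surjective (h : IsAdaptedChart M φ I) (hq : q ∈ φ.source) :
    Function.Surjective (coordDeriv φ q) :=
  (mdifferentiable_of_mem h.mem_maximalAtlas).mfderiv_surjective hq

theorem mfderiv_euclidean_apply {f : X → EuclideanSpace ℝ (Fin n)}
    (hf : MDifferentiableAt 𝓘(ℝ, EuclideanSpace ℝ (Fin n)) 𝓘(ℝ, EuclideanSpace ℝ (Fin n)) f q)
    (i : Fin n) (v : TangentSpace 𝓘(ℝ, EuclideanSpace ℝ (Fin n)) q) :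
    mfderiv 𝓘(ℝ, EuclideanSpace ℝ (Fin n)) 𝓘(ℝ, ℝ) (fun x => f x i) q v = coordDeriv f q v i := by
  have h2 : MDifferentiableAt 𝓘(ℝ, EuclideanSpace ℝ (Fin n)) 𝓘(ℝ, ℝ)
      (EuclideanSpace.proj (𝕜 := ℝ) i) (f q) :=
    (EuclideanSpace.proj (𝕜 := ℝ) i).mdifferentiableAt
  have h3 := mfderiv_comp q h2 hf
  have h4 : ((EuclideanSpace.proj (𝕜 := ℝ) i) ∘ f : X → ℝ) = fun x => f x i := rfl
  rw [h4, mfderiv_eq_fderiv, ContinuousLinearMap.fderiv] at h3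
  rw [h3]
  rfl

theorem IsAdaptedChart.mfderiv_coord_apply (h : IsAdaptedChart M φ I) (hq : q ∈ φ.source)
    (i : Fin n) (v : TangentSpace 𝓘(ℝ, EuclideanSpace ℝ (Fin n)) q) :
    mfderiv 𝓘(ℝ, EuclideanSpace ℝ (Fin n)) 𝓘(ℝ, ℝ) (fun x => φ x i) q v = coordDeriv φ q v i :=
  mfderiv_euclidean_apply ((mdifferentiable_of_mem h.mem_maximalAtlas).mdifferentiableAt hq) i v

theorem IsAdaptedChart.mem_tangentSubspace_iff (h : IsAdaptedChart M φ I) (hq : q ∈ φ.source)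
    {j : Fin ℓ} (hj : q ∈ M j) (v : TangentSpace 𝓘(ℝ, EuclideanSpace ℝ (Fin n)) q) :
    v ∈ tangentSubspace (M j) q ↔ ∀ i ∈ I j, coordDeriv φ q v i = 0 :=
  ((h.isSliceChart j).mem_tangentSubspace_iff hq hj v).trans coordProj_eq_zero_iff

theorem tangentSubspace_mono {A B : Set X} (hAB : A ⊆ B) :
    tangentSubspace (E := EuclideanSpace ℝ (Fin n)) A q ≤ tangentSubspace B q := by
  refine Submodule.span_mono ?_
  rintro v ⟨γ, h0, hγ, h2⟩
  exact ⟨γ, h0, hγ.mono fun _ hs => hAB hs, h2⟩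

/-- Inclusions between the members of the family can be read off an adapted chart; the identity
theorem makes the local inclusion global. -/
theorem IsAdaptedChart.subset_iff (h : IsAdaptedChart M φ I)
    (hM : ∀ j, IsClosedSubmanifold (EuclideanSpace ℝ (Fin n)) (M j)) (h1 : H1 M)
    (hq : q ∈ φ.source) (hqM : ∀ j, q ∈ M j) {j k : Fin ℓ} : M j ⊆ M k ↔ I k ⊆ I j := by
  classical
  constructor
  · intro hjk i hi
    by_contra hij
    obtain ⟨v, hv⟩ := h.coordDeriv_surjective hq (EuclideanSpace.single i 1)
    have h3 : v ∈ tangentSubspace (M j) q := by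
      rw [h.mem_tangentSubspace_iff hq (hqM j), hv]
      intro i' hi'
      have : i' ≠ i := fun h => hij (h ▸ hi')
      simp [this]
    have h4 := tangentSubspace_mono hjk h3
    rw [h.mem_tangentSubspace_iff hq (hqM k), hv] at h4
    simpa using h4 i hi
  · intro hI
    refine (hM j).subset_of_eventually (hM k) (h1.1 j).isPreconnected (hqM j) ?_
    filter_upwards [φ.open_source.mem_nhds hq] with x hx hxj
    rw [h.mem_iff k x hx]
    exact fun i hi => (h.mem_iff j x hx).1 hxj i (hI hi)

theorem IsAdaptedChart.ssubset_iff (h : IsAdaptedChart M φ I)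
    (hM : ∀ j, IsClosedSubmanifold (EuclideanSpace ℝ (Fin n)) (M j)) (h1 : H1 M)
    (hq : q ∈ φ.source) (hqM : ∀ j, q ∈ M j) {j k : Fin ℓ} : M j ⊂ M k ↔ I k ⊂ I j := by
  rw [ssubset_iff_subset_not_subset, ssubset_iff_subset_not_subset,
    h.subset_iff hM h1 hq hqM, h.subset_iff hM h1 hq hqM]

/-- Members that share an equation are comparable: the index sets of incomparable members are disjoint
because these meet transversally. -/
theorem IsAdaptedChart.subset_or_subset (h : IsAdaptedChart M φ I)
    (h2 : H2 (EuclideanSpace ℝ (Fin n)) M)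
    (hq : q ∈ φ.source) (hqM : ∀ j, q ∈ M j) {j k : Fin ℓ} {i : Fin n} (hj : i ∈ I j)
    (hk : i ∈ I k) : M j ⊆ M k ∨ M k ⊆ M j := by
  classical
  by_contra hjk
  rw [not_or] at hjk
  have hNR : k ∈ NR M j q := ⟨hqM k, hjk.1, hjk.2⟩
  obtain ⟨v, hv⟩ := h.coordDeriv_surjective hq (EuclideanSpace.single i 1)
  have hmem : v ∈ (⨅ k ∈ NR M j q, tangentSubspace (E := EuclideanSpace ℝ (Fin n)) (M k) q) ⊔
      tangentSubspace (E := EuclideanSpace ℝ (Fin n)) (M j) q := by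
    rw [h2 j q (hqM j) ⟨k, hNR⟩]; trivial
  obtain ⟨a, ha, b, hb, hab⟩ := Submodule.mem_sup.1 hmem
  have ha' : a ∈ tangentSubspace (M k) q := by
    simp only [Submodule.mem_iInf] at ha
    exact ha k hNR
  have ha0 := (h.mem_tangentSubspace_iff hq (hqM k) a).1 ha' i hk
  have hb0 := (h.mem_tangentSubspace_iff hq (hqM j) b).1 hb i hj
  have := congrArg (fun w => coordDeriv φ q w i) hab
  simp [coordDeriv_add, ha0, hb0, hv] at this

theorem mem_hatI {j : Fin ℓ} {i : Fin n} :
    i ∈ hatI I j ↔ i ∈ I j ∧ ∀ k, I k ⊂ I j → i ∉ I k := by simp [hatI]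

/-- A coordinate that occurs in `I_k` for some `k` occurs in `Î_j` for some `j`: take `I_j` minimal. -/
theorem exists_mem_hatI {k : Fin ℓ} {i : Fin n} (hi : i ∈ I k) : ∃ j, i ∈ hatI I j := by
  classical
  have hne : (Finset.univ.filter fun j => i ∈ I j).Nonempty := ⟨k, by simpa using hi⟩
  obtain ⟨j, hj, hmin⟩ := Finset.exists_min_image _ (fun j => (I j).card) hne
  refine ⟨j, mem_hatI.2 ⟨by simpa using hj, fun m hm him => ?_⟩⟩
  exact absurd (hmin m (by simpa using him)) (not_le.2 (Finset.card_lt_card hm))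

theorem IsAdaptedChart.mem_iff_of_mem_hatI (h : IsAdaptedChart M φ I)
    (hM : ∀ j, IsClosedSubmanifold (EuclideanSpace ℝ (Fin n)) (M j)) (h1 : H1 M)
    (h2 : H2 (EuclideanSpace ℝ (Fin n)) M) (hq : q ∈ φ.source) (hqM : ∀ j, q ∈ M j)
    {j k : Fin ℓ} {i : Fin n} (hi : i ∈ hatI I j) : i ∈ I k ↔ M k ⊆ M j := by
  rw [mem_hatI] at hi
  constructor
  · intro hk
    by_contra hkj
    have hjk := (h.subset_or_subset h2 hq hqM hi.1 hk).resolve_right hkj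
    exact hi.2 k ((h.ssubset_iff hM h1 hq hqM).1 ⟨hjk, hkj⟩) hk
  · intro hkj
    exact (h.subset_iff hM h1 hq hqM).1 hkj hi.1

/-- The sets `Î_j` are pairwise disjoint. -/
theorem IsAdaptedChart.eq_of_mem_hatI (h : IsAdaptedChart M φ I)
    (hM : ∀ j, IsClosedSubmanifold (EuclideanSpace ℝ (Fin n)) (M j)) (h1 : H1 M)
    (h2 : H2 (EuclideanSpace ℝ (Fin n)) M) (hq : q ∈ φ.source) (hqM : ∀ j, q ∈ M j)
    {j k : Fin ℓ} {i : Fin n} (hj : i ∈ hatI I j) (hk : i ∈ hatI I k) : j = k :=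
  h1.2 (Subset.antisymm
    ((h.mem_iff_of_mem_hatI hM h1 h2 hq hqM hk).1 (mem_hatI.1 hj).1)
    ((h.mem_iff_of_mem_hatI hM h1 h2 hq hqM hj).1 (mem_hatI.1 hk).1))

theorem IsAdaptedChart.isSliceChart_iota (h : IsAdaptedChart M φ I) (j : Fin ℓ)
    [DecidablePred fun k => M j ⊂ M k] :
    IsSliceChart (iota M j) φ (coordProj ((Finset.univ.filter fun k => M j ⊂ M k).biUnion I)) := by
  refine ⟨h.mem_maximalAtlas, coordProj_idem _, fun x hx => ?_⟩
  rw [coordProj_eq_zero_iff]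
  simp only [iota, mem_iInter, Finset.mem_biUnion, Finset.mem_filter, Finset.mem_univ, true_and]
  constructor
  · rintro hk i ⟨k, hjk, hi⟩
    exact (h.mem_iff k x hx).1 (hk k hjk) i hi
  · intro hk k hjk
    exact (h.mem_iff k x hx).2 fun i hi => hk i ⟨k, hjk, hi⟩

omit [TopologicalSpace X] [ChartedSpace (EuclideanSpace ℝ (Fin n)) X] in
theorem mem_iota {j : Fin ℓ} (hqM : ∀ j, q ∈ M j) : q ∈ iota M j :=
  mem_iInter₂.2 fun k _ => hqM k

theorem IsAdaptedChart.mem_tangentSubspace_iota_iff (h : IsAdaptedChart M φ I) (hq : q ∈ φ.source)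
    (hqM : ∀ j, q ∈ M j) {j : Fin ℓ} (v : TangentSpace 𝓘(ℝ, EuclideanSpace ℝ (Fin n)) q) :
    v ∈ tangentSubspace (iota M j) q ↔ ∀ k, M j ⊂ M k → ∀ i ∈ I k, coordDeriv φ q v i = 0 := by
  classical
  refine ((h.isSliceChart_iota j).mem_tangentSubspace_iff hq (mem_iota hqM) v).trans
    (coordProj_eq_zero_iff.trans ?_)
  simp only [Finset.mem_biUnion, Finset.mem_filter, Finset.mem_univ, true_and]
  exact ⟨fun h k hk i hi => h i ⟨k, hk, hi⟩, fun h i ⟨k, hk, hi⟩ => h k hk i hi⟩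

/-- The differentials of the coordinates with index in `Î_j` identify `T_q ι(M_j) / T_q M_j` with
`ℝ^{Î_j}`: this is injectivity. -/
theorem IsAdaptedChart.mem_tangentSubspace_iff_of_mem_iota (h : IsAdaptedChart M φ I)
    (hM : ∀ j, IsClosedSubmanifold (EuclideanSpace ℝ (Fin n)) (M j)) (h1 : H1 M)
    (hq : q ∈ φ.source) (hqM : ∀ j, q ∈ M j) {j : Fin ℓ}
    {v : TangentSpace 𝓘(ℝ, EuclideanSpace ℝ (Fin n)) q} (hv : v ∈ tangentSubspace (iota M j) q) :
    v ∈ tangentSubspace (M j) q ↔ ∀ i ∈ hatI I j, coordDeriv φ q v i = 0 := by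
  rw [h.mem_tangentSubspace_iff hq (hqM j)]
  refine ⟨fun hv i hi => hv i (mem_hatI.1 hi).1, fun hv' i hi => ?_⟩
  by_cases hih : i ∈ hatI I j
  · exact hv' i hih
  · rw [mem_hatI, not_and] at hih
    have := hih hi
    push Not at this
    obtain ⟨k, hk, hik⟩ := this
    exact (h.mem_tangentSubspace_iota_iff hq hqM v).1 hv k
      ((h.ssubset_iff hM h1 hq hqM).2 hk) i hik

end AdaptedCharts

/-! ### Bases adapted to a family of subspaces -/

section AdaptedBasis
variable {V ι : Type*} [AddCommGroup V] [Module ℝ V] [Finite ι] [PartialOrder ι]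

/-- A monotone family of subspaces in which every member is independent of the sum of the members
that are not comparable with it splits: there are independent `C_j ⊆ A_j` such that
`A_j = ⨆_{k ≤ j} C_k`. -/
theorem exists_iSupIndep_of_disjoint_incomparable (A : ι → Submodule ℝ V) (hA : Monotone A)
    (hd : ∀ j, Disjoint (A j) (⨆ (k) (_ : ¬ k ≤ j ∧ ¬ j ≤ k), A k)) :
    ∃ C : ι → Submodule ℝ V, iSupIndep C ∧ ∀ j, A j = ⨆ k ≤ j, C k := by
  classical
  let B : ι → Submodule ℝ V := fun j => ⨆ k < j, A k
  have hBA : ∀ j, B j ≤ A j := fun j => iSup₂_le fun k hk => hA hk.le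
  have hex : ∀ j, ∃ C, C ≤ A j ∧ Disjoint (B j) C ∧ B j ⊔ C = A j := fun j => by
    obtain ⟨D, hD⟩ := (B j).exists_isCompl
    refine ⟨D ⊓ A j, inf_le_right, hD.disjoint.mono_right inf_le_left, ?_⟩
    rw [← sup_inf_assoc_of_le _ (hBA j), hD.sup_eq_top, top_inf_eq]
  choose C hCA hBC hsup using hex
  refine ⟨C, ?_, ?_⟩
  · rw [iSupIndep_iff_finsetSum_eq_zero_imp_eq_zero]
    intro s v hv h0
    by_contra! hne
    obtain ⟨i₀, hi₀, hvi₀⟩ := hne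
    -- A maximal index of a non-zero term; the other non-zero terms have smaller or incomparable index.
    obtain ⟨j, hj⟩ := (s.filter fun i => v i ≠ 0).exists_maximal ⟨i₀, by simp [hi₀, hvi₀]⟩
    obtain ⟨hjs, hvj⟩ := Finset.mem_filter.1 hj.prop
    have hmem : v j ∈ B j ⊔ ⨆ (k) (_ : ¬ k ≤ j ∧ ¬ j ≤ k), A k := by
      rw [← Finset.add_sum_erase _ _ hjs, add_eq_zero_iff_eq_neg] at h0
      rw [h0]
      refine Submodule.neg_mem _ (Submodule.sum_mem _ fun i hi => ?_)
      obtain ⟨hij, his⟩ := Finset.mem_erase.1 hi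
      by_cases hvi : v i = 0
      · rw [hvi]; exact Submodule.zero_mem _
      have hnot : ¬ j < i := fun hlt => hj.not_gt (Finset.mem_filter.2 ⟨his, hvi⟩) hlt
      have hviA : v i ∈ A i := hCA i (hv i his)
      by_cases hle : i ≤ j
      · exact Submodule.mem_sup_left
          (Submodule.mem_iSup_of_mem i (Submodule.mem_iSup_of_mem (hle.lt_of_ne hij) hviA))
      · refine Submodule.mem_sup_right (Submodule.mem_iSup_of_mem i
          (Submodule.mem_iSup_of_mem ⟨hle, fun h => hnot (h.lt_of_ne hij.symm)⟩ hviA))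
    obtain ⟨b, hb, a, ha, hab⟩ := Submodule.mem_sup.1 hmem
    have ha0 : a = 0 := by
      refine Submodule.disjoint_def.1 (hd j) a ?_ ha
      have : a = v j - b := by rw [← hab]; abel
      rw [this]
      exact Submodule.sub_mem _ (hCA j (hv j hjs)) (hBA j hb)
    refine hvj (Submodule.disjoint_def.1 (hBC j) _ ?_ (hv j hjs))
    rwa [← hab, ha0, add_zero]
  · intro j
    induction j using WellFoundedLT.induction with
    | ind j ih =>
      refine le_antisymm ?_ (iSup₂_le fun k hk => (hCA k).trans (hA hk))
      rw [← hsup j]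
      refine sup_le (iSup₂_le fun k hk => ?_) (le_iSup₂_of_le j le_rfl le_rfl)
      rw [ih k hk]
      exact iSup₂_le fun i hi => le_iSup₂_of_le i (hi.trans hk.le) le_rfl

/-- The basis obtained by joining bases of the pieces of a splitting as in
`exists_iSupIndep_of_disjoint_incomparable`. The label `c i` of a basis vector is the piece to which
it belongs, and `⊤` if it belongs to a complement of the sum of all pieces. -/
theorem exists_adapted_basis [FiniteDimensional ℝ V] {n : ℕ} (hn : Module.finrank ℝ V = n)
    (A : ι → Submodule ℝ V) (hA : Monotone A)
    (hd : ∀ j, Disjoint (A j) (⨆ (k) (_ : ¬ k ≤ j ∧ ¬ j ≤ k), A k)) :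
    ∃ (b : Module.Basis (Fin n) ℝ V) (c : Fin n → WithTop ι),
      (∀ (i : Fin n) (j : ι), c i = (j : WithTop ι) → b i ∈ A j) ∧
      ∀ j, A j ≤ Submodule.span ℝ (b '' {i | c i ≤ (j : WithTop ι)}) := by
  classical
  let A' : WithTop ι → Submodule ℝ V := fun j => j.recTopCoe ⊤ A
  have hA' : Monotone A' := by
    intro j k hjk
    induction k using WithTop.recTopCoe with
    | top => exact le_top
    | coe k =>
      induction j using WithTop.recTopCoe with
      | top => simp at hjk
      | coe j => exact hA (WithTop.coe_le_coe.1 hjk)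
  have hd' : ∀ j, Disjoint (A' j) (⨆ (k) (_ : ¬ k ≤ j ∧ ¬ j ≤ k), A' k) := by
    intro j
    induction j using WithTop.recTopCoe with
    | top => simp
    | coe j =>
      refine (hd j).mono_right (iSup₂_le fun k hk => ?_)
      induction k using WithTop.recTopCoe with
      | top => simp at hk
      | coe k =>
        exact le_iSup₂_of_le k ⟨fun h => hk.1 (WithTop.coe_le_coe.2 h),
          fun h => hk.2 (WithTop.coe_le_coe.2 h)⟩ le_rfl
  have : Finite (WithTop ι) := inferInstanceAs (Finite (Option ι))
  obtain ⟨C, hC, hAC⟩ := exists_iSupIndep_of_disjoint_incomparable A' hA' hd'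
  have htop : iSup C = ⊤ := by
    have h1 := hAC ⊤
    simp only [le_top, iSup_pos] at h1
    exact h1.symm
  have hint := DirectSum.isInternal_submodule_of_iSupIndep_of_iSup_eq_top hC htop
  let b₀ := hint.collectedBasis fun j => Module.finBasis ℝ (C j)
  have : Fintype (WithTop ι) := Fintype.ofFinite _
  have hcard : Fintype.card (Σ j, Fin (Module.finrank ℝ (C j))) = n := by
    rw [← Module.finrank_eq_card_basis b₀, hn]
  let σ := Fintype.equivFinOfCardEq hcard
  have hmem : ∀ i, b₀ (σ.symm i) ∈ C (σ.symm i).1 := fun i => hint.collectedBasis_mem _ _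
  refine ⟨b₀.reindex σ, fun i => (σ.symm i).1, fun i j hij => ?_, fun j => ?_⟩
  · rw [Module.Basis.reindex_apply]
    have h1 : C (σ.symm i).1 ≤ A' j := by
      rw [hAC j]
      exact le_iSup₂_of_le _ hij.le le_rfl
    exact h1 (hmem i)
  · change A' j ≤ _
    rw [hAC j]
    refine iSup₂_le fun k hk => ?_
    have h1 := (Module.finBasis ℝ (C k)).span_eq
    have h2 : C k = Submodule.span ℝ (range fun a => ((Module.finBasis ℝ (C k) a : C k) : V)) := by
      have := congrArg (Submodule.map (C k).subtype) h1
      rw [Submodule.map_span, Submodule.map_top, Submodule.range_subtype, ← range_comp] at this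
      exact this.symm
    rw [h2]
    refine Submodule.span_mono ?_
    rintro _ ⟨a, rfl⟩
    refine ⟨σ ⟨k, a⟩, by simpa using hk, ?_⟩
    simp only [Module.Basis.reindex_apply, Equiv.symm_apply_apply, b₀,
      DirectSum.IsInternal.collectedBasis_coe]

end AdaptedBasis

/-! ### The inverse function theorem and defining equations of submanifolds -/

section InverseFunction
variable {E : Type} [NormedAddCommGroup E] [NormedSpace ℝ E] [FiniteDimensional ℝ E]
  {X : Type u} [TopologicalSpace X] [ChartedSpace E X] [IsManifold 𝓘(ℝ, E) ω X]

/-- An analytic map to the model space with bijective differential at `q` is a chart near `q`. -/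
theorem exists_chart_of_bijective_mfderiv {f : X → E} {q : X} (hf : ContMDiffAt 𝓘(ℝ, E) 𝓘(ℝ, E) ω f q)
    (hb : Function.Bijective (mfderiv 𝓘(ℝ, E) 𝓘(ℝ, E) f q)) :
    ∃ φ ∈ IsManifold.maximalAtlas 𝓘(ℝ, E) ω X, q ∈ φ.source ∧ ∀ x ∈ φ.source, φ x = f x := by
  have := FiniteDimensional.complete ℝ E
  let e := chartAt E q
  have he : e ∈ IsManifold.maximalAtlas 𝓘(ℝ, E) ω X := IsManifold.chart_mem_maximalAtlas q
  have hqe : q ∈ e.source := mem_chart_source E q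
  have hed := mdifferentiable_of_mem he
  let G : E → E := f ∘ e.symm
  have hes := contMDiffAt_symm_of_mem_maximalAtlas he (e.map_source hqe)
  have hG : ContDiffAt ℝ ω G (e q) := by
    refine (ContMDiffAt.comp (e q) ?_ hes).contDiffAt
    rw [e.left_inv hqe]
    exact hf
  have hbij : Function.Bijective (fderiv ℝ G (e q)) := by
    have h1 : MDifferentiableAt 𝓘(ℝ, E) 𝓘(ℝ, E) f (e.symm (e q)) := by
      rw [e.left_inv hqe]; exact hf.mdifferentiableAt (by simp)
    have h2 := mfderiv_comp (e q) h1 (hed.mdifferentiableAt_symm (e.map_source hqe))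
    rw [mfderiv_eq_fderiv] at h2
    have h3 : Function.Bijective (mfderiv 𝓘(ℝ, E) 𝓘(ℝ, E) f (e.symm (e q))) := by
      rw [e.left_inv hqe]; exact hb
    have h4 := h3.comp (hed.symm.mfderiv_bijective (e.map_source hqe))
    rw [show fderiv ℝ G (e q) = _ from h2]
    exact h4
  let L : E ≃L[ℝ] E := (LinearEquiv.ofBijective (fderiv ℝ G (e q)).toLinearMap hbij).toContinuousLinearEquiv
  have hL : HasFDerivAt G (L : E →L[ℝ] E) (e q) :=
    (hG.differentiableAt (by simp)).hasFDerivAt.congr_fderiv (by ext; rfl)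
  let h := hG.toOpenPartialHomeomorph G hL (by simp)
  have hgood : ∀ᶠ y in 𝓝 (e q), ContDiffAt ℝ ω G y ∧
      ∃ L' : E ≃L[ℝ] E, (L' : E →L[ℝ] E) = fderiv ℝ G y := by
    have hc : ContinuousAt (fderiv ℝ G) (e q) :=
      (hG.fderiv_right (m := 0) (by simp)).continuousAt
    have h1 : range ((↑) : (E ≃L[ℝ] E) → E →L[ℝ] E) ∈ 𝓝 (fderiv ℝ G (e q)) := by
      rw [hL.fderiv]; exact L.nhds
    exact (hG.eventually (by simp)).and (hc.eventually h1)
  obtain ⟨U, hU, hUo, hqU⟩ := eventually_nhds_iff.1 hgood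
  let k := h.restr U
  have hks : k.source = h.source ∩ U := by simp [k, hUo.interior_eq]
  have hk : ContDiffOn ℝ ω k k.source := fun y hy =>
    (hU y (hks ▸ hy).2).1.contDiffWithinAt
  have hk' : ContDiffOn ℝ ω k.symm k.target := fun z hz => by
    have hy := k.map_target hz
    obtain ⟨h1, L', hL'⟩ := hU _ (hks ▸ hy).2
    refine (k.contDiffAt_symm (f₀' := L') hz ?_ h1).contDiffWithinAt
    rw [hL']
    exact (h1.differentiableAt (by simp)).hasFDerivAt
  let φ := e.trans k
  have hφs : ∀ x ∈ φ.source, x ∈ e.source ∧ e x ∈ k.source := fun x hx => by simpa [φ] using hx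
  refine ⟨φ, φ.mem_maximalAtlas_of_contMDiffOn ?_ ?_, ?_, fun x hx => ?_⟩
  · exact hk.contMDiffOn.comp ((contMDiffOn_of_mem_maximalAtlas he).mono fun x hx => (hφs x hx).1)
      fun x hx => (hφs x hx).2
  · refine (contMDiffOn_symm_of_mem_maximalAtlas he).comp (hk'.contMDiffOn.mono fun z hz => ?_)
      fun z hz => ?_
    · have : z ∈ k.target ∧ k.symm z ∈ e.target := by simpa [φ] using hz
      exact this.1
    · have : z ∈ k.target ∧ k.symm z ∈ e.target := by simpa [φ] using hz
      exact this.2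
  · have : e q ∈ k.source := by
      rw [hks]
      exact ⟨hG.mem_toOpenPartialHomeomorph_source hL (by simp), hqU⟩
    simp [φ, hqe, this]
  · change f (e.symm (e x)) = f x
    rw [e.left_inv (hφs x hx).1]

omit [IsManifold 𝓘(ℝ, E) ω X] in
/-- Analytic functions that vanish on the submanifold `N`, and whose differentials at `q` have no
common zeros other than the tangent vectors of `N`, define `N` near `q`: together with the
coordinates along `N` they form a locally injective map, which takes the same value at a common
zero and at its projection to `N`. -/
theorem IsSliceChart.eventually_mem_of_forall_eq_zero {N : Set X} {e : OpenPartialHomeomorph X E}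
    {P : E →L[ℝ] E} (h : IsSliceChart N e P) {q : X} (hq : q ∈ e.source) (hqN : q ∈ N)
    {J : Type*} [Fintype J] {f : J → X → ℝ} (hf : ∀ i, ContMDiffAt 𝓘(ℝ, E) 𝓘(ℝ, ℝ) ω (f i) q)
    (hfN : ∀ i, ∀ᶠ x in 𝓝 q, x ∈ N → f i x = 0)
    (hT : ∀ v, (∀ i, mfderiv 𝓘(ℝ, E) 𝓘(ℝ, ℝ) (f i) q v = 0) → v ∈ tangentSubspace N q) :
    ∀ᶠ x in 𝓝 q, (∀ i, f i x = 0) → x ∈ N := by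
  have hd := mdifferentiable_of_mem h.mem_maximalAtlas
  have hPq : P (e q) = 0 := (h.mem_iff q hq).1 hqN
  have hes := contMDiffAt_symm_of_mem_maximalAtlas h.mem_maximalAtlas (e.map_source hq)
  let G : E → (J → ℝ) × E := fun y => (fun i => f i (e.symm y), y - P y)
  have hfi : ∀ i, ContDiffAt ℝ ω (fun y => f i (e.symm y)) (e q) := fun i => by
    refine (ContMDiffAt.comp (e q) (g := f i) ?_ hes).contDiffAt
    rw [e.left_inv hq]
    exact hf i
  have hG : ContDiffAt ℝ ω G (e q) := by
    refine ContDiffAt.prodMk (contDiffAt_pi.2 hfi) ?_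
    fun_prop
  have hGs := hG.hasStrictFDerivAt (by simp)
  have hG' : ∀ w, fderiv ℝ G (e q) w = (fun i => fderiv ℝ (fun y => f i (e.symm y)) (e q) w, w - P w) := by
    intro w
    have h1 : HasFDerivAt G ((ContinuousLinearMap.pi fun i =>
        fderiv ℝ (fun y => f i (e.symm y)) (e q)).prod (ContinuousLinearMap.id ℝ E - P)) (e q) := by
      refine HasFDerivAt.prodMk (hasFDerivAt_pi.2 fun i =>
        ((hfi i).differentiableAt (by simp)).hasFDerivAt) ?_
      exact (ContinuousLinearMap.id ℝ E - P).hasFDerivAt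
    rw [h1.fderiv]
    rfl
  have hker : LinearMap.ker (fderiv ℝ G (e q)).toLinearMap = ⊥ := by
    refine LinearMap.ker_eq_bot'.2 fun w hw => ?_
    have hw' : fderiv ℝ G (e q) w = 0 := hw
    rw [hG', Prod.mk_eq_zero] at hw'
    obtain ⟨v, hv⟩ := hd.mfderiv_surjective hq w
    have hvT : v ∈ tangentSubspace N q := by
      refine hT v fun i => ?_
      have h0 := congrFun hw'.1 i
      have h1 : MDifferentiableAt 𝓘(ℝ, E) 𝓘(ℝ, ℝ) (fun y => f i (e.symm y)) (e q) :=
        (hfi i).contMDiffAt.mdifferentiableAt (by simp)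
      have h2 := mfderiv_comp q h1 (hd.mdifferentiableAt hq)
      have h3 : ((fun y => f i (e.symm y)) ∘ e) =ᶠ[𝓝 q] f i := by
        filter_upwards [e.open_source.mem_nhds hq] with x hx
        simp [e.left_inv hx]
      rw [h3.mfderiv_eq] at h2
      rw [h2, mfderiv_eq_fderiv]
      refine Eq.trans ?_ h0
      exact congrArg (fderiv ℝ (fun y => f i (e.symm y)) (e q)) hv
    rw [h.mem_tangentSubspace_iff hq hqN, hv] at hvT
    have := hw'.2
    rwa [hvT, sub_zero] at this
  obtain ⟨K, hK, hanti⟩ := LinearMap.exists_antilipschitzWith _ hker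
  have hKr : (0 : ℝ) < K := hK
  have hbd := hGs.isLittleO.def (c := 1 / (2 * K)) (by positivity)
  have ht1 : Tendsto (fun x => (e x, e x - P (e x))) (𝓝 q) (𝓝 (e q, e q)) := by
    have h1 : ContinuousAt (fun x => (e x, e x - P (e x))) q :=
      (e.continuousAt hq).prodMk
        ((e.continuousAt hq).sub (P.continuous.continuousAt.comp (e.continuousAt hq)))
    simpa [ContinuousAt, hPq] using h1
  have ht2 : Tendsto (fun x => e x - P (e x)) (𝓝 q) (𝓝 (e q)) := (continuous_snd.tendsto _).comp ht1
  have ht3 : Tendsto (fun x => e.symm (e x - P (e x))) (𝓝 q) (𝓝 q) := by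
    have := (e.continuousAt_symm (e.map_source hq)).tendsto.comp ht2
    rwa [e.left_inv hq] at this
  filter_upwards [ht1.eventually hbd, ht3.eventually (eventually_all.2 hfN), e.open_source.mem_nhds hq,
    ht2.eventually (e.open_target.mem_nhds (e.map_source hq))] with x h1 h2 h3 h4 h5
  have hx'N : e.symm (e x - P (e x)) ∈ N := by
    rw [h.mem_iff _ (e.map_target h4), e.right_inv h4]
    simp [h.idem]
  have hGe : G (e x) = G (e x - P (e x)) := by
    refine Prod.ext (funext fun i => ?_) ?_
    · change f i (e.symm (e x)) = f i (e.symm (e x - P (e x)))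
      rw [e.left_inv h3, h5 i, h2 i hx'N]
    · simp [G, h.idem]
  have h6 : ‖P (e x)‖ ≤ K * ‖fderiv ℝ G (e q) (P (e x))‖ := by
    have := hanti.le_mul_dist (P (e x)) 0
    simpa using this
  have h7 : ‖fderiv ℝ G (e q) (P (e x))‖ ≤ 1 / (2 * K) * ‖P (e x)‖ := by
    simpa [hGe] using h1
  have h8 : ‖P (e x)‖ ≤ 1 / 2 * ‖P (e x)‖ :=
    calc ‖P (e x)‖ ≤ K * (1 / (2 * K) * ‖P (e x)‖) := h6.trans (by gcongr)
      _ = 1 / 2 * ‖P (e x)‖ := by field_simp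
  rw [h.mem_iff x h3, ← norm_le_zero_iff]
  linarith [norm_nonneg (P (e x))]

end InverseFunction

/-! ### Existence of adapted coordinates -/

section Existence
variable {n ℓ : ℕ} {X : Type u} [TopologicalSpace X] [ChartedSpace (EuclideanSpace ℝ (Fin n)) X]

theorem mfderiv_linear_comp_chart {e : OpenPartialHomeomorph X (EuclideanSpace ℝ (Fin n))}
    (he : e ∈ IsManifold.maximalAtlas 𝓘(ℝ, EuclideanSpace ℝ (Fin n)) ω X) {q : X}
    (hq : q ∈ e.source) (μ : EuclideanSpace ℝ (Fin n) →L[ℝ] ℝ) :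
    ContMDiffAt 𝓘(ℝ, EuclideanSpace ℝ (Fin n)) 𝓘(ℝ, ℝ) ω (fun x => μ (e x)) q ∧
      ∀ v, mfderiv 𝓘(ℝ, EuclideanSpace ℝ (Fin n)) 𝓘(ℝ, ℝ) (fun x => μ (e x)) q v =
        μ (coordDeriv e q v) := by
  refine ⟨μ.contDiff.contDiffAt.contMDiffAt.comp q (contMDiffAt_of_mem_maximalAtlas he hq),
    fun v => ?_⟩
  have h1 := mfderiv_comp q (μ.mdifferentiableAt (x := e q))
    ((mdifferentiable_of_mem he).mdifferentiableAt hq)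
  have h2 : (μ ∘ e : X → ℝ) = fun x => μ (e x) := rfl
  rw [h2, mfderiv_eq_fderiv, ContinuousLinearMap.fderiv] at h1
  rw [h1]
  rfl

/-- Every linear form on `T_q X` that vanishes on `T_q N` is the differential of an analytic function
that vanishes on `N`. -/
theorem IsSliceChart.exists_function {N : Set X}
    {e : OpenPartialHomeomorph X (EuclideanSpace ℝ (Fin n))}
    {P : EuclideanSpace ℝ (Fin n) →L[ℝ] EuclideanSpace ℝ (Fin n)} (h : IsSliceChart N e P) {q : X}
    (hq : q ∈ e.source) (hqN : q ∈ N)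
    (b : Module.Dual ℝ (TangentSpace 𝓘(ℝ, EuclideanSpace ℝ (Fin n)) q))
    (hb : b ∈ (tangentSubspace (E := EuclideanSpace ℝ (Fin n)) N q).dualAnnihilator) :
    ∃ f : X → ℝ, ContMDiffAt 𝓘(ℝ, EuclideanSpace ℝ (Fin n)) 𝓘(ℝ, ℝ) ω f q ∧
      (∀ v, mfderiv 𝓘(ℝ, EuclideanSpace ℝ (Fin n)) 𝓘(ℝ, ℝ) f q v = b v) ∧
      ∀ᶠ x in 𝓝 q, x ∈ N → f x = 0 := by
  let D : TangentSpace 𝓘(ℝ, EuclideanSpace ℝ (Fin n)) q ≃L[ℝ] EuclideanSpace ℝ (Fin n) :=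
    (mdifferentiable_of_mem h.mem_maximalAtlas).mfderiv hq
  have hD : ∀ v, coordDeriv e q v = D v := fun v => rfl
  let μ : EuclideanSpace ℝ (Fin n) →L[ℝ] ℝ := LinearMap.toContinuousLinearMap
    (b.comp (D.symm.toLinearEquiv.toLinearMap.comp P.toLinearMap))
  have hμ : ∀ w, μ w = b (D.symm (P w)) := fun w => rfl
  obtain ⟨h1, h2⟩ := mfderiv_linear_comp_chart h.mem_maximalAtlas hq μ
  refine ⟨fun x => μ (e x), h1, fun v => ?_, ?_⟩
  · have h3 : v - D.symm (P (D v)) ∈ tangentSubspace (E := EuclideanSpace ℝ (Fin n)) N q := by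
      rw [h.mem_tangentSubspace_iff hq hqN]
      change P (D (v - D.symm (P (D v)))) = 0
      rw [map_sub, D.apply_symm_apply, map_sub, h.idem, sub_self]
    have h4 := (Submodule.mem_dualAnnihilator b).1 hb _ h3
    rw [map_sub, sub_eq_zero] at h4
    rw [h2, hD, hμ, ← h4]
  · filter_upwards [e.open_source.mem_nhds hq] with x hx hxN
    have : P (e x) = 0 := (h.mem_iff x hx).1 hxN
    rw [hμ, this, map_zero, map_zero]

theorem exists_function_of_dual {e : OpenPartialHomeomorph X (EuclideanSpace ℝ (Fin n))}
    (he : e ∈ IsManifold.maximalAtlas 𝓘(ℝ, EuclideanSpace ℝ (Fin n)) ω X) {q : X}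
    (hq : q ∈ e.source) (b : Module.Dual ℝ (TangentSpace 𝓘(ℝ, EuclideanSpace ℝ (Fin n)) q)) :
    ∃ f : X → ℝ, ContMDiffAt 𝓘(ℝ, EuclideanSpace ℝ (Fin n)) 𝓘(ℝ, ℝ) ω f q ∧
      ∀ v, mfderiv 𝓘(ℝ, EuclideanSpace ℝ (Fin n)) 𝓘(ℝ, ℝ) f q v = b v := by
  let D : TangentSpace 𝓘(ℝ, EuclideanSpace ℝ (Fin n)) q ≃L[ℝ] EuclideanSpace ℝ (Fin n) :=
    (mdifferentiable_of_mem he).mfderiv hq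
  let μ : EuclideanSpace ℝ (Fin n) →L[ℝ] ℝ := LinearMap.toContinuousLinearMap
    (b.comp D.symm.toLinearEquiv.toLinearMap)
  obtain ⟨h1, h2⟩ := mfderiv_linear_comp_chart he hq μ
  refine ⟨fun x => μ (e x), h1, fun v => ?_⟩
  rw [h2]
  change b (D.symm (D v)) = b v
  rw [D.symm_apply_apply]

variable [IsManifold 𝓘(ℝ, EuclideanSpace ℝ (Fin n)) ω X]

/-- Around every common point of the members of the family there are adapted coordinates. They are
found by choosing a basis of the cotangent space that is compatible with the conormal spaces. -/
theorem exists_isAdaptedChart {M : Fin ℓ → Set X}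
    (hM : ∀ j, IsClosedSubmanifold (EuclideanSpace ℝ (Fin n)) (M j)) (hinj : Function.Injective M)
    (h2 : H2 (EuclideanSpace ℝ (Fin n)) M) {q : X} (hq : ∀ j, q ∈ M j) :
    ∃ (φ : OpenPartialHomeomorph X (EuclideanSpace ℝ (Fin n))) (I : Fin ℓ → Finset (Fin n)),
      IsAdaptedChart M φ I ∧ q ∈ φ.source := by
  classical
  choose e P hs hqe using fun j => (hM j).exists_sliceChart q (hq j)
  have : FiniteDimensional ℝ (TangentSpace 𝓘(ℝ, EuclideanSpace ℝ (Fin n)) q) :=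
    inferInstanceAs (FiniteDimensional ℝ (EuclideanSpace ℝ (Fin n)))
  have hfin : Module.finrank ℝ (Module.Dual ℝ (TangentSpace 𝓘(ℝ, EuclideanSpace ℝ (Fin n)) q)) = n := by
    rw [Subspace.dual_finrank_eq]
    exact finrank_euclideanSpace_fin
  let A : Fin ℓ → Submodule ℝ (Module.Dual ℝ (TangentSpace 𝓘(ℝ, EuclideanSpace ℝ (Fin n)) q)) :=
    fun j => (tangentSubspace (E := EuclideanSpace ℝ (Fin n)) (M j) q).dualAnnihilator
  -- The members are ordered by reverse inclusion, which makes the conormal spaces `A j` increasing.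
  let ι := Fin ℓ
  let ord : PartialOrder ι := PartialOrder.lift (fun j => OrderDual.toDual (M j)) fun j k h => hinj h
  have hmono : @Monotone ι _ ord.toPreorder _ A := fun k j hkj =>
    Submodule.dualAnnihilator_anti (tangentSubspace_mono hkj)
  have hdisj : ∀ j, Disjoint (A j) (⨆ (k) (_ : ¬ ord.le k j ∧ ¬ ord.le j k), A k) := by
    intro j
    by_cases hne : (NR M j q).Nonempty
    · have h3 := congrArg Submodule.dualAnnihilator (h2 j q (hq j) hne)
      rw [Submodule.dualAnnihilator_sup_eq, Submodule.dualAnnihilator_top] at h3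
      rw [disjoint_comm, disjoint_iff, ← h3]
      congr 1
      rw [← iInf_subtype'', Subspace.dualAnnihilator_iInf_eq, iSup_subtype]
      refine iSup_congr fun k => iSup_congr_Prop ?_ fun _ => rfl
      simp only [NR, mem_ofPred_eq, hq k, true_and]
      exact Iff.rfl
    · have : (⨆ (k) (_ : ¬ ord.le k j ∧ ¬ ord.le j k), A k) = ⊥ := by
        simp only [iSup_eq_bot]
        exact fun k hk => absurd ⟨k, hq k, hk⟩ hne
      rw [this]
      exact disjoint_bot_right
  obtain ⟨b, c, hbA, hspan⟩ := @exists_adapted_basis _ ι _ _ _ ord _ n hfin A hmono hdisj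
  have hf : ∀ i, ∃ f : X → ℝ, ContMDiffAt 𝓘(ℝ, EuclideanSpace ℝ (Fin n)) 𝓘(ℝ, ℝ) ω f q ∧
      (∀ v, mfderiv 𝓘(ℝ, EuclideanSpace ℝ (Fin n)) 𝓘(ℝ, ℝ) f q v = b i v) ∧
      ∀ j : Fin ℓ, c i = ((j : ι) : WithTop ι) → ∀ᶠ x in 𝓝 q, x ∈ M j → f x = 0 := by
    intro i
    rcases hci : c i with _ | j
    · obtain ⟨f, h1, h3⟩ := exists_function_of_dual
        (IsManifold.chart_mem_maximalAtlas (I := 𝓘(ℝ, EuclideanSpace ℝ (Fin n))) (n := ω) q)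
        (mem_chart_source _ q) (b i)
      exact ⟨f, h1, h3, fun j hj => absurd hj (WithTop.top_ne_coe (a := j))⟩
    · obtain ⟨f, h1, h3, h4⟩ := (hs j).exists_function (hqe j) (hq j) (b i) (hbA i j hci)
      refine ⟨f, h1, h3, fun j' hj' => ?_⟩
      obtain rfl : j = j' := WithTop.coe_injective hj'
      exact h4
  choose f hfa hfd hf0 using hf
  let I : Fin ℓ → Finset (Fin n) := fun j => Finset.univ.filter fun i =>
    (@WithTop.instPartialOrder ι ord).le (c i) (((j : ι) : WithTop ι))
  have hI : ∀ i j, i ∈ I j ↔ (@WithTop.instPartialOrder ι ord).le (c i) (((j : ι) : WithTop ι)) :=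
    fun i j => by simp [I]
  let F : X → EuclideanSpace ℝ (Fin n) := fun x => WithLp.toLp 2 fun i => f i x
  have hF : ContMDiffAt 𝓘(ℝ, EuclideanSpace ℝ (Fin n)) 𝓘(ℝ, EuclideanSpace ℝ (Fin n)) ω F q :=
    (EuclideanSpace.equiv (Fin n) ℝ).symm.contDiff.contDiffAt.contMDiffAt.comp q
      (contMDiffAt_pi_space.2 hfa)
  have hFd : ∀ v i, coordDeriv F q v i = b i v := fun v i => by
    rw [← mfderiv_euclidean_apply (hF.mdifferentiableAt (by simp)), ← hfd i v]
  have hFinj : Function.Injective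
      (mfderiv 𝓘(ℝ, EuclideanSpace ℝ (Fin n)) 𝓘(ℝ, EuclideanSpace ℝ (Fin n)) F q) := by
    refine (injective_iff_map_eq_zero _).2 fun v hv => ?_
    refine (Module.forall_dual_apply_eq_zero_iff ℝ v).1 fun g => ?_
    rw [← b.sum_repr g]
    simp only [LinearMap.sum_apply, LinearMap.smul_apply]
    refine Finset.sum_eq_zero fun i _ => ?_
    rw [← hFd v i, coordDeriv, hv]
    exact smul_zero _
  have hFbij : Function.Bijective
      (mfderiv 𝓘(ℝ, EuclideanSpace ℝ (Fin n)) 𝓘(ℝ, EuclideanSpace ℝ (Fin n)) F q) :=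
    ⟨hFinj, (LinearMap.injective_iff_surjective
      (f := ((mfderiv 𝓘(ℝ, EuclideanSpace ℝ (Fin n)) 𝓘(ℝ, EuclideanSpace ℝ (Fin n)) F q :
        EuclideanSpace ℝ (Fin n) →L[ℝ] EuclideanSpace ℝ (Fin n)).toLinearMap))).1 hFinj⟩
  obtain ⟨φ, hφ, hqφ, hφF⟩ := exists_chart_of_bijective_mfderiv hF hFbij
  have hloc : ∀ j, ∀ᶠ x in 𝓝 q, x ∈ M j ↔ ∀ i ∈ I j, f i x = 0 := by
    intro j
    have hvan : ∀ i ∈ I j, ∀ᶠ x in 𝓝 q, x ∈ M j → f i x = 0 := by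
      intro i hi
      rw [hI] at hi
      rcases hci : c i with _ | k
      · rw [hci] at hi
        exact absurd hi (@WithTop.not_top_le_coe ι ord.toLE j)
      · rw [hci] at hi
        have hjk : M j ⊆ M k := (@WithTop.coe_le_coe ι j k ord.toLE).1 hi
        filter_upwards [hf0 i k hci] with x hx hxj using hx (hjk hxj)
    have h3 := (hs j).eventually_mem_of_forall_eq_zero (hqe j) (hq j) (J := I j)
      (f := fun i => f i) (fun i => hfa i) (fun i => hvan i i.2) fun v hv => by
        rw [← Subspace.dualAnnihilator_dualCoannihilator_eq
          (W := tangentSubspace (E := EuclideanSpace ℝ (Fin n)) (M j) q),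
          Submodule.mem_dualCoannihilator]
        intro g hg
        have h5 : g ∈ Submodule.span ℝ (b '' {i | i ∈ I j}) := by
          simp only [hI]
          exact hspan j hg
        refine Submodule.span_induction (p := fun g _ => g v = 0) ?_ ?_ ?_ ?_ h5
        · rintro _ ⟨i, hi, rfl⟩
          rw [← hfd i v]
          exact hv ⟨i, hi⟩
        · simp
        · intro x y _ _ hx hy
          simp [hx, hy]
        · intro a x _ hx
          simp [hx]
    filter_upwards [h3, (Filter.eventually_all_finset (I j)).2 hvan] with x h6 h7
    exact ⟨fun hx i hi => h7 i hi hx, fun hx => h6 fun i => hx i i.2⟩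
  obtain ⟨U, hU, hUo, hqU⟩ := eventually_nhds_iff.1 (eventually_all.2 hloc)
  have hsrc : (φ.restr U).source = φ.source ∩ U := by simp [hUo.interior_eq]
  refine ⟨φ.restr U, I, ⟨restr_mem_maximalAtlas _ hφ hUo, fun j x hx => ?_⟩, hsrc ▸ ⟨hqφ, hqU⟩⟩
  rw [hsrc] at hx
  rw [hU x hx.2 j]
  refine forall₂_congr fun i _ => ?_
  have : (φ.restr U) x = F x := hφF x hx.1
  rw [this]

end Existence

/-! ### Change of adapted coordinates on the zero section -/

section Transition
variable {n ℓ : ℕ} {X : Type u} [TopologicalSpace X] [ChartedSpace (EuclideanSpace ℝ (Fin n)) X]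
  {M : Fin ℓ → Set X} {q : X}
  {φ φ' : OpenPartialHomeomorph X (EuclideanSpace ℝ (Fin n))} {I I' : Fin ℓ → Finset (Fin n)}

theorem tProd_const (I : Fin ℓ → Finset (Fin n)) (τ : ℝ) (i : Fin n) :
    tProd I (fun _ => τ) i = τ ^ (Finset.univ.filter fun k => i ∈ I k).card := by
  simp [tProd]

/-- The number of members contained in `M_j` is the number of parameters by which a coordinate with
index in `Î_j` is multiplied. -/
theorem IsAdaptedChart.card_of_mem_hatI [DecidableRel fun j k => M k ⊆ M j]
    (h : IsAdaptedChart M φ I)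
    (hM : ∀ j, IsClosedSubmanifold (EuclideanSpace ℝ (Fin n)) (M j)) (h1 : H1 M)
    (h2 : H2 (EuclideanSpace ℝ (Fin n)) M) (hq : q ∈ φ.source) (hqM : ∀ j, q ∈ M j)
    {j : Fin ℓ} {i : Fin n} (hi : i ∈ hatI I j) :
    (Finset.univ.filter fun k => i ∈ I k).card = (Finset.univ.filter fun k => M k ⊆ M j).card := by
  congr 1
  ext k
  simp [h.mem_iff_of_mem_hatI hM h1 h2 hq hqM hi]

theorem IsAdaptedChart.card_lt_of_notMem_hatI [DecidableRel fun j k => M k ⊆ M j]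
    (h : IsAdaptedChart M φ I)
    (hM : ∀ j, IsClosedSubmanifold (EuclideanSpace ℝ (Fin n)) (M j)) (h1 : H1 M)
    (h2 : H2 (EuclideanSpace ℝ (Fin n)) M) (hq : q ∈ φ.source) (hqM : ∀ j, q ∈ M j)
    {j : Fin ℓ} {i : Fin n} (hi : i ∈ I j) (hi' : i ∉ hatI I j) :
    (Finset.univ.filter fun k => M k ⊆ M j).card < (Finset.univ.filter fun k => i ∈ I k).card := by
  obtain ⟨m, hm⟩ := exists_mem_hatI hi
  have hjm : M j ⊆ M m := (h.mem_iff_of_mem_hatI hM h1 h2 hq hqM hm).1 hi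
  have hmj : ¬ M m ⊆ M j := fun hmj => hi' (h1.2 (Subset.antisymm hjm hmj) ▸ hm)
  rw [h.card_of_mem_hatI hM h1 h2 hq hqM hm]
  refine Finset.card_lt_card ((Finset.ssubset_iff_of_subset fun k hk => ?_).2 ⟨m, by simp, by simp [hmj]⟩)
  simp only [Finset.mem_filter, Finset.mem_univ, true_and] at hk ⊢
  exact hk.trans hjm

/-- The change of the fibre coordinates of the zero section. Along the curve with coordinates
`(x, τ, …, τ)` the point of `X` has the coordinates `τ ^ card J_i * x_i`, so that its coordinates
transversal to `M_j` are `τ ^ N * (x_i + o(1))` for `i ∈ Î_j` and `o(τ ^ N)` for the other `i ∈ I_j`,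
where `N` is the number of members contained in `M_j`. Dividing the other system of coordinates by
`τ ^ N` and letting `τ → 0` gives its differential. -/
theorem IsLocalModel.coordDeriv_eq {T : DeformationTower X ℓ}
    {Ψ Ψ' : OpenPartialHomeomorph T.space (EuclideanSpace ℝ (Fin n) × (Fin ℓ → ℝ))}
    (hΨ : IsLocalModel T φ I Ψ) (hΨ' : IsLocalModel T φ' I' Ψ')
    (h : IsAdaptedChart M φ I) (h' : IsAdaptedChart M φ' I')
    (hM : ∀ j, IsClosedSubmanifold (EuclideanSpace ℝ (Fin n)) (M j)) (h1 : H1 M)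
    (h2 : H2 (EuclideanSpace ℝ (Fin n)) M) {s : T.space} (hs : ∀ j, T.t j s = 0)
    (hp : T.p s = q) (hq : q ∈ φ.source) (hq' : q ∈ φ'.source) (hqM : ∀ j, q ∈ M j) {j : Fin ℓ}
    {v : TangentSpace 𝓘(ℝ, EuclideanSpace ℝ (Fin n)) q} (hv : v ∈ tangentSubspace (iota M j) q)
    (hvx : ∀ i ∈ hatI I j, (Ψ s).1 i = coordDeriv φ q v i) :
    ∀ i ∈ hatI I' j, (Ψ' s).1 i = coordDeriv φ' q v i := by
  classical
  intro i hi
  have hsΨ : s ∈ Ψ.source := by rw [hΨ.source_eq]; exact (hp ▸ hq : T.p s ∈ φ.source)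
  have hsΨ' : s ∈ Ψ'.source := by rw [hΨ'.source_eq]; exact (hp ▸ hq' : T.p s ∈ φ'.source)
  have hd := mdifferentiable_of_mem h.mem_maximalAtlas
  set x := (Ψ s).1 with hx
  have hΨs : Ψ s = (x, 0) := Prod.ext rfl (funext fun j => by rw [hΨ.snd_eq s hsΨ, hs]; rfl)
  set N := (Finset.univ.filter fun k => M k ⊆ M j).card with hN
  let a := φ q
  let F : EuclideanSpace ℝ (Fin n) → EuclideanSpace ℝ (Fin n) := φ' ∘ φ.symm
  have hF : ContDiffAt ℝ ω F a := by
    refine (ContMDiffAt.comp a ?_ (contMDiffAt_symm_of_mem_maximalAtlas h.mem_maximalAtlas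
      (φ.map_source hq))).contDiffAt
    rw [φ.left_inv hq]
    exact contMDiffAt_of_mem_maximalAtlas h'.mem_maximalAtlas hq'
  let L := fderiv ℝ F a
  have hL : HasStrictFDerivAt F L a := hF.hasStrictFDerivAt (by simp)
  have hchain : ∀ u, coordDeriv φ' q u = L (coordDeriv φ q u) := by
    intro u
    have k1 : MDifferentiableAt 𝓘(ℝ, EuclideanSpace ℝ (Fin n)) 𝓘(ℝ, EuclideanSpace ℝ (Fin n)) F a :=
      hF.contMDiffAt.mdifferentiableAt (by simp)
    have k2 := mfderiv_comp (f := φ) q k1 (hd.mdifferentiableAt hq)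
    have k3 : (F ∘ φ) =ᶠ[𝓝 q] φ' := by
      filter_upwards [φ.open_source.mem_nhds hq] with z hz
      simp [F, φ.left_inv hz]
    rw [k3.mfderiv_eq, mfderiv_eq_fderiv] at k2
    rw [coordDeriv, k2]
    rfl
  -- The curve in the deformation and its projection to `X`.
  let Y : ℝ → T.space := fun τ => Ψ.symm (x, fun _ => τ)
  let y : ℝ → EuclideanSpace ℝ (Fin n) := fun τ =>
    WithLp.toLp 2 fun i => τ ^ (Finset.univ.filter fun k => i ∈ I k).card * x i
  let z : ℝ → EuclideanSpace ℝ (Fin n) := fun τ => y τ - coordProj (I j) (y τ)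
  let w : ℝ → EuclideanSpace ℝ (Fin n) := fun τ => WithLp.toLp 2 fun i =>
    if i ∈ I j then τ ^ ((Finset.univ.filter fun k => i ∈ I k).card - N) * x i else 0
  have hcard : ∀ i ∈ I j, N ≤ (Finset.univ.filter fun k => i ∈ I k).card := fun i hi => by
    by_cases hi' : i ∈ hatI I j
    · exact (h.card_of_mem_hatI hM h1 h2 hq hqM hi').ge
    · exact (h.card_lt_of_notMem_hatI hM h1 h2 hq hqM hi hi').le
  have hyzw : ∀ τ, y τ - z τ = τ ^ N • w τ := by
    intro τ
    ext i
    by_cases hi : i ∈ I j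
    · simp [y, z, w, hi, ← mul_assoc, ← pow_add, Nat.add_sub_cancel' (hcard i hi)]
    · simp [y, z, w, hi]
  have hpt : Tendsto (fun τ : ℝ => (x, fun _ : Fin ℓ => τ)) (𝓝 0) (𝓝 (x, (0 : Fin ℓ → ℝ))) := by
    have : Continuous fun τ : ℝ => (x, fun _ : Fin ℓ => τ) := by fun_prop
    exact this.tendsto 0
  have hmemt : (x, (0 : Fin ℓ → ℝ)) ∈ Ψ.target := hΨs ▸ Ψ.map_source hsΨ
  have hY : Tendsto Y (𝓝 0) (𝓝 s) := by
    have := (Ψ.continuousAt_symm hmemt).tendsto.comp hpt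
    rwa [← hΨs, Ψ.left_inv hsΨ] at this
  have hYt := hpt.eventually (Ψ.open_target.mem_nhds hmemt)
  have hyeq : ∀ τ : ℝ, (x, fun _ : Fin ℓ => τ) ∈ Ψ.target → T.p (Y τ) ∈ φ.source ∧ φ (T.p (Y τ)) = y τ := by
    intro τ hτ
    have k1 := Ψ.map_target hτ
    refine ⟨by rw [hΨ.source_eq] at k1; exact k1, ?_⟩
    ext i
    rw [hΨ.p_eq _ k1, Ψ.right_inv hτ, tProd_const]
  have hy0 : y 0 = a := by
    have k1 := (hyeq 0 hmemt).2
    have k2 : Y 0 = s := by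
      change Ψ.symm (x, 0) = s
      rw [← hΨs, Ψ.left_inv hsΨ]
    rw [← k1, k2, hp]
  have hyc : Continuous y := by
    refine (PiLp.continuous_toLp 2 _).comp ?_
    fun_prop
  have hyt : Tendsto y (𝓝 0) (𝓝 a) := hy0 ▸ hyc.tendsto 0
  have ha0 : coordProj (I j) a = 0 := coordProj_eq_zero_iff.2 ((h.mem_iff j q hq).1 (hqM j))
  have hzt : Tendsto z (𝓝 0) (𝓝 a) := by
    have := hyt.sub (((coordProj (I j)).continuous.tendsto a).comp hyt)
    simpa [ha0] using this
  have hwc : Continuous w := by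
    refine (PiLp.continuous_toLp 2 _).comp (continuous_pi fun i => ?_)
    by_cases hi : i ∈ I j
    · simp only [hi, if_true]; fun_prop
    · simp only [hi, if_false]; fun_prop
  have hwt : Tendsto w (𝓝[≠] 0) (𝓝 (w 0)) := (hwc.tendsto 0).mono_left nhdsWithin_le_nhds
  have hw0 : ∀ i, w 0 i = if i ∈ hatI I j then x i else 0 := by
    intro i
    by_cases hi : i ∈ I j
    · by_cases hi' : i ∈ hatI I j
      · simp [w, hi, hi', h.card_of_mem_hatI hM h1 h2 hq hqM hi', ← hN]
      · have := Nat.sub_ne_zero_of_lt (h.card_lt_of_notMem_hatI hM h1 h2 hq hqM hi hi')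
        simp [w, hi, hi', zero_pow this, hN]
    · have hi' : i ∉ hatI I j := fun h => hi (mem_hatI.1 h).1
      simp [w, hi, hi']
  -- The coordinates `φ'` along the curve.
  have hFz : ∀ᶠ τ in 𝓝 (0 : ℝ), F (z τ) i = 0 := by
    have k1 : a ∈ (φ.symm.trans φ').source := by simp [a, hq, hq', φ.map_source hq]
    filter_upwards [hzt.eventually ((φ.symm.trans φ').open_source.mem_nhds k1)] with τ hτ
    simp only [OpenPartialHomeomorph.trans_source, OpenPartialHomeomorph.symm_source] at hτ
    refine (h'.mem_iff j _ hτ.2).1 ?_ i (mem_hatI.1 hi).1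
    rw [h.mem_iff j _ (φ.map_target hτ.1), φ.right_inv hτ.1]
    intro m hm
    simp [z, hm]
  have hFy : ∀ᶠ τ in 𝓝 (0 : ℝ), F (y τ) i = τ ^ N * (Ψ' (Y τ)).1 i := by
    filter_upwards [hYt, hY.eventually (Ψ'.open_source.mem_nhds hsΨ')] with τ k1 k2
    obtain ⟨k3, k4⟩ := hyeq τ k1
    have k5 := hΨ'.p_eq _ k2 i
    have k6 : (Ψ' (Y τ)).2 = fun _ => τ := funext fun m => by
      rw [hΨ'.snd_eq _ k2, ← hΨ.snd_eq _ (Ψ.map_target k1), Ψ.right_inv k1]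
    rw [k6, tProd_const, h'.card_of_mem_hatI hM h1 h2 hq' hqM hi] at k5
    rw [← k5, ← k4]
    simp [F, φ.left_inv k3]
  have hlo : (fun τ => F (y τ) - F (z τ) - L (y τ - z τ)) =o[𝓝[≠] 0] fun τ : ℝ => τ ^ N := by
    have k1 : Tendsto (fun τ => (y τ, z τ)) (𝓝[≠] 0) (𝓝 (a, a)) :=
      (hyt.prodMk_nhds hzt).mono_left nhdsWithin_le_nhds
    refine (hL.isLittleO.comp_tendsto k1).trans_isBigO ?_
    have k2 : (fun τ : ℝ => τ ^ N • w τ) =O[𝓝[≠] 0] fun τ : ℝ => τ ^ N • (1 : ℝ) :=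
      (Asymptotics.isBigO_refl _ _).smul (hwt.isBigO_one ℝ)
    simp only [smul_eq_mul, mul_one] at k2
    exact k2.congr_left fun τ => (hyzw τ).symm
  have hlim := hlo.tendsto_inv_smul_nhds_zero
  have hlim' : Tendsto (fun τ => (Ψ' (Y τ)).1 i - L (w τ) i) (𝓝[≠] 0) (𝓝 0) := by
    have k0 := ((PiLp.continuous_apply 2 (fun _ : Fin n => ℝ) i).tendsto 0).comp hlim
    refine Tendsto.congr' ?_ k0
    filter_upwards [self_mem_nhdsWithin, nhdsWithin_le_nhds hFz, nhdsWithin_le_nhds hFy]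
      with τ k1 k2 k3
    have k4 : τ ^ N ≠ 0 := pow_ne_zero _ k1
    have k2' : F (z τ) i = 0 := k2
    have k3' : F (y τ) i = τ ^ N * (Ψ' (Y τ)).1 i := k3
    simp only [Function.comp_apply, hyzw, map_smul, PiLp.smul_apply, PiLp.sub_apply, k2', k3',
      smul_eq_mul, sub_zero]
    field_simp
  have hlim2 : Tendsto (fun τ => (Ψ' (Y τ)).1 i - L (w τ) i) (𝓝[≠] 0)
      (𝓝 ((Ψ' s).1 i - L (w 0) i)) := by
    refine Tendsto.sub ?_ ?_
    · have k1 := ((Ψ'.continuousAt hsΨ').tendsto.comp hY).fst_nhds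
      exact ((PiLp.continuous_apply 2 (fun _ : Fin n => ℝ) i).tendsto _).comp
        (k1.mono_left nhdsWithin_le_nhds)
    · exact ((PiLp.continuous_apply 2 (fun _ : Fin n => ℝ) i).tendsto _).comp
        ((L.continuous.tendsto _).comp hwt)
  have hres : (Ψ' s).1 i = L (w 0) i := sub_eq_zero.1 (tendsto_nhds_unique hlim2 hlim')
  -- `v` differs from the vector with coordinates `w 0` by a tangent vector of `M_j`.
  obtain ⟨v₀, hv₀⟩ := h.coordDeriv_surjective hq (w 0)
  have hdiff : v - v₀ ∈ tangentSubspace (M j) q := by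
    rw [h.mem_tangentSubspace_iff hq (hqM j)]
    intro m hm
    rw [coordDeriv_sub, hv₀, PiLp.sub_apply, hw0]
    by_cases hm' : m ∈ hatI I j
    · rw [if_pos hm', hvx m hm', sub_self]
    · rw [if_neg hm', sub_zero]
      rw [mem_hatI, not_and] at hm'
      have := hm' hm
      push Not at this
      obtain ⟨k, hk, hmk⟩ := this
      exact (h.mem_tangentSubspace_iota_iff hq hqM v).1 hv k
        ((h.ssubset_iff hM h1 hq hqM).2 hk) m hmk
  have := (h'.mem_tangentSubspace_iff hq' (hqM j) _).1 hdiff i (mem_hatI.1 hi).1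
  rw [coordDeriv_sub, PiLp.sub_apply, sub_eq_zero] at this
  rw [hres, this, hchain, hv₀]

end Transition

/-! ### Maps to products of manifolds -/

section PiManifold
variable {E₀ H₀ N : Type*} [NormedAddCommGroup E₀] [NormedSpace ℝ E₀] [TopologicalSpace H₀]
  {I₀ : ModelWithCorners ℝ E₀ H₀} [TopologicalSpace N] [ChartedSpace H₀ N]
  {ι : Type*} [Fintype ι] {F H Q : ι → Type*} [∀ i, NormedAddCommGroup (F i)]
  [∀ i, NormedSpace ℝ (F i)] [∀ i, TopologicalSpace (H i)] {J : ∀ i, ModelWithCorners ℝ (F i) (H i)}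
  [∀ i, TopologicalSpace (Q i)] [∀ i, ChartedSpace (H i) (Q i)]

/-- A map to a finite product of manifolds is `C^k` if and only if its components are. -/
theorem contMDiffWithinAt_pi_manifold {k : WithTop ℕ∞} {f : N → ∀ i, Q i} {s : Set N} {x : N} :
    ContMDiffWithinAt I₀ (ModelWithCorners.pi J) k f s x ↔
      ∀ i, ContMDiffWithinAt I₀ (J i) k (fun y => f y i) s x := by
  simp only [contMDiffWithinAt_iff, forall_and, continuousWithinAt_pi]
  refine and_congr_right fun _ => ?_
  exact contDiffWithinAt_pi

theorem contMDiff_apply_manifold {k : WithTop ℕ∞} (i : ι) :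
    ContMDiff (ModelWithCorners.pi J) (J i) k fun w : ∀ i, Q i => w i := fun w =>
  contMDiffWithinAt_pi_manifold.1 (contMDiffWithinAt_id (I := ModelWithCorners.pi J) (x := w)) i

end PiManifold

/-! ### Analytic families of tangent vectors -/

section TangentBundles
variable {E : Type} [NormedAddCommGroup E] [NormedSpace ℝ E]

theorem contMDiffOn_mk_tangentBundle {F' : Type} [NormedAddCommGroup F'] [NormedSpace ℝ F']
  {N : Type*} [TopologicalSpace N] [ChartedSpace F' N] {a b : N → E} {s : Set N}
    (ha : ContMDiffOn 𝓘(ℝ, F') 𝓘(ℝ, E) ω a s) (hb : ContMDiffOn 𝓘(ℝ, F') 𝓘(ℝ, E) ω b s) :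
    ContMDiffOn 𝓘(ℝ, F') 𝓘(ℝ, E).tangent ω (fun y => (⟨a y, b y⟩ : TangentBundle 𝓘(ℝ, E) E)) s := by
  intro y hy
  refine Bundle.contMDiffWithinAt_totalSpace.2 ⟨ha y hy, ?_⟩
  refine (hb y hy).congr (fun z hz => ?_) ?_
  · rw [trivializationAt_model_space_apply]
  · rw [trivializationAt_model_space_apply]

variable {X : Type u} [TopologicalSpace X] [ChartedSpace E X] [IsManifold 𝓘(ℝ, E) ω X]

omit [IsManifold 𝓘(ℝ, E) ω X] in
theorem totalSpace_mk_symm_mfderiv {φ : OpenPartialHomeomorph X E}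
    (h : φ ∈ IsManifold.maximalAtlas 𝓘(ℝ, E) ω X) {q : X} (hq : q ∈ φ.source)
    (v : TangentSpace 𝓘(ℝ, E) q) (u : E) (hu : (mfderiv 𝓘(ℝ, E) 𝓘(ℝ, E) φ q v : E) = u) :
    tangentMap 𝓘(ℝ, E) 𝓘(ℝ, E) φ.symm (⟨φ q, u⟩ : TangentBundle 𝓘(ℝ, E) E) =
      (⟨q, v⟩ : TangentBundle 𝓘(ℝ, E) X) := by
  have key : ∀ q' : X, q' = q → ∀ u : TangentSpace 𝓘(ℝ, E) q', (u : E) = (v : E) →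
      (⟨q', u⟩ : TangentBundle 𝓘(ℝ, E) X) = ⟨q, v⟩ := by
    rintro q' rfl u rfl; rfl
  refine key _ (φ.left_inv hq) _ ?_
  subst hu
  exact DFunLike.congr_fun ((mdifferentiable_of_mem h).symm_comp_deriv hq) v

theorem contMDiffOn_tangentMap_symm {φ : OpenPartialHomeomorph X E}
    (h : φ ∈ IsManifold.maximalAtlas 𝓘(ℝ, E) ω X) :
    ContMDiffOn 𝓘(ℝ, E).tangent 𝓘(ℝ, E).tangent ω (tangentMap 𝓘(ℝ, E) 𝓘(ℝ, E) φ.symm)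
      {w : TangentBundle 𝓘(ℝ, E) E | w.1 ∈ φ.target} := by
  have h1 := (contMDiffOn_symm_of_mem_maximalAtlas h).contMDiffOn_tangentMapWithin
    (m := ω) (by simp) φ.open_target.uniqueMDiffOn
  refine h1.congr fun w hw => ?_
  exact (tangentMapWithin_eq_tangentMap (φ.open_target.uniqueMDiffOn _ hw)
    ((mdifferentiable_of_mem h).mdifferentiableAt_symm hw)).symm

theorem contMDiffOn_tangentMap {φ : OpenPartialHomeomorph X E}
    (h : φ ∈ IsManifold.maximalAtlas 𝓘(ℝ, E) ω X) :
    ContMDiffOn 𝓘(ℝ, E).tangent 𝓘(ℝ, E).tangent ω (tangentMap 𝓘(ℝ, E) 𝓘(ℝ, E) φ)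
      {w : TangentBundle 𝓘(ℝ, E) X | w.1 ∈ φ.source} := by
  have h1 := (contMDiffOn_of_mem_maximalAtlas h).contMDiffOn_tangentMapWithin
    (m := ω) (by simp) φ.open_source.uniqueMDiffOn
  refine h1.congr fun w hw => ?_
  exact (tangentMapWithin_eq_tangentMap (φ.open_source.uniqueMDiffOn _ hw)
    ((mdifferentiable_of_mem h).mdifferentiableAt hw)).symm

end TangentBundles

/-! ### The zero section and the fibre product -/

section Correspondence
variable {n ℓ : ℕ} {X : Type u} [TopologicalSpace X] [ChartedSpace (EuclideanSpace ℝ (Fin n)) X]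
  {M : Fin ℓ → Set X} {T : DeformationTower X ℓ}
  {φ : OpenPartialHomeomorph X (EuclideanSpace ℝ (Fin n))} {I : Fin ℓ → Finset (Fin n)}
  {Ψ : OpenPartialHomeomorph T.space (EuclideanSpace ℝ (Fin n) × (Fin ℓ → ℝ))}

namespace FiberProduct

/-- The element of the fibre product over `q` with components the classes of the `v_j`. -/
def ofVectors (q : X) (hq : ∀ j, q ∈ M j)
    (v : ∀ j, tangentSubspace (E := EuclideanSpace ℝ (Fin n)) (iota M j) q) :
    FiberProduct (EuclideanSpace ℝ (Fin n)) M :=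
  ⟨(q, fun j => ⟨⟨q, hq j⟩, Submodule.Quotient.mk (v j)⟩), fun _ => rfl⟩

theorem exists_eq_ofVectors (z : FiberProduct (EuclideanSpace ℝ (Fin n)) M) :
    ∃ q hq v, z = ofVectors q hq v := by
  obtain ⟨⟨q, f⟩, h⟩ := z
  have hex : ∀ j, ∃ (hq : q ∈ M j)
      (v : tangentSubspace (E := EuclideanSpace ℝ (Fin n)) (iota M j) q),
      f j = ⟨⟨q, hq⟩, Submodule.Quotient.mk v⟩ := by
    intro j
    have hj : ((f j).1 : X) = q := h j
    generalize f j = a at hj ⊢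
    obtain ⟨⟨q', hq'⟩, ν⟩ := a
    obtain rfl : q' = q := hj
    obtain ⟨v, rfl⟩ := Submodule.Quotient.mk_surjective _ ν
    exact ⟨hq', v, rfl⟩
  choose hq v hv using hex
  obtain rfl : f = _ := funext hv
  exact ⟨q, hq, v, rfl⟩

theorem base_mem (z : FiberProduct (EuclideanSpace ℝ (Fin n)) M) (j : Fin ℓ) : z.base ∈ M j := by
  obtain ⟨q, hq, v, rfl⟩ := exists_eq_ofVectors z
  exact hq j

theorem ofVectors_congr {q : X} {hq : ∀ j, q ∈ M j}
    {v v' : ∀ j, tangentSubspace (E := EuclideanSpace ℝ (Fin n)) (iota M j) q}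
    (h : ∀ j, ((v j : TangentSpace 𝓘(ℝ, EuclideanSpace ℝ (Fin n)) q) - v' j) ∈
      tangentSubspace (E := EuclideanSpace ℝ (Fin n)) (M j) q) :
    ofVectors q hq v = ofVectors q hq v' := by
  have : ∀ j, (Submodule.Quotient.mk (v j) :
      _ ⧸ (tangentSubspace (E := EuclideanSpace ℝ (Fin n)) (M j) q).submoduleOf _) =
        Submodule.Quotient.mk (v' j) :=
    fun j => (Submodule.Quotient.eq _).2 (h j)
  exact Subtype.ext (Prod.ext rfl (funext fun j => Sigma.ext rfl (heq_of_eq (this j))))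

/-- The value of `dφ_i` on the `j`-th component of an element of the fibre product, computed with an
arbitrary representative. It does not depend on the representative if `i ∈ Î_j`. -/
def coord (φ : OpenPartialHomeomorph X (EuclideanSpace ℝ (Fin n)))
    (z : FiberProduct (EuclideanSpace ℝ (Fin n)) M) (j : Fin ℓ) (i : Fin n) : ℝ :=
  coordDeriv φ ((z.1.2 j).1 : X) ((Quotient.out (z.1.2 j).2 :
    tangentSubspace (E := EuclideanSpace ℝ (Fin n)) (iota M j) ((z.1.2 j).1 : X)) :
    TangentSpace 𝓘(ℝ, EuclideanSpace ℝ (Fin n)) ((z.1.2 j).1 : X)) i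

theorem coord_eq (h : IsAdaptedChart M φ I)
    (z : FiberProduct (EuclideanSpace ℝ (Fin n)) M) (hz : z.base ∈ φ.source) {j : Fin ℓ}
    (u : tangentSubspace (E := EuclideanSpace ℝ (Fin n)) (iota M j) ((z.1.2 j).1 : X))
    (hu : Submodule.Quotient.mk u = (z.1.2 j).2) {i : Fin n} (hi : i ∈ hatI I j) :
    z.coord φ j i = coordDeriv φ ((z.1.2 j).1 : X) u i := by
  have hb : ((z.1.2 j).1 : X) = z.base := z.2 j
  have hq : ((z.1.2 j).1 : X) ∈ φ.source := hb ▸ hz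
  have hqM : ∀ k, ((z.1.2 j).1 : X) ∈ M k := fun k => hb ▸ z.base_mem k
  have h2 : Submodule.Quotient.mk (Quotient.out (z.1.2 j).2) =
      (Submodule.Quotient.mk u :
        _ ⧸ (tangentSubspace (E := EuclideanSpace ℝ (Fin n)) (M j) ((z.1.2 j).1 : X)).submoduleOf _) := by
    rw [hu]; exact Quotient.out_eq _
  have h3 := (Submodule.Quotient.eq _).1 h2
  have h4 := (h.mem_tangentSubspace_iff hq (hqM j) _).1 h3 i (mem_hatI.1 hi).1
  have h5 : coordDeriv φ ((z.1.2 j).1 : X) ((Quotient.out (z.1.2 j).2 :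
    tangentSubspace (E := EuclideanSpace ℝ (Fin n)) (iota M j) ((z.1.2 j).1 : X)) :
    TangentSpace 𝓘(ℝ, EuclideanSpace ℝ (Fin n)) ((z.1.2 j).1 : X)) i -
      coordDeriv φ ((z.1.2 j).1 : X) u i = 0 := by
    rw [← PiLp.sub_apply, ← coordDeriv_sub]
    exact h4
  exact sub_eq_zero.1 h5

theorem coord_ofVectors (h : IsAdaptedChart M φ I)
    {q : X} (hq : ∀ j, q ∈ M j) (hqφ : q ∈ φ.source)
    (v : ∀ j, tangentSubspace (E := EuclideanSpace ℝ (Fin n)) (iota M j) q) {j : Fin ℓ} {i : Fin n}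
    (hi : i ∈ hatI I j) :
    (ofVectors q hq v).coord φ j i = coordDeriv φ q (v j) i :=
  coord_eq h (ofVectors q hq v) hqφ (v j) rfl hi

/-- In adapted coordinates an element of the fibre product is determined by its base point and its
fibre coordinates. -/
theorem ext_coord (h : IsAdaptedChart M φ I)
    (hM : ∀ j, IsClosedSubmanifold (EuclideanSpace ℝ (Fin n)) (M j)) (h1 : H1 M)
    {z z' : FiberProduct (EuclideanSpace ℝ (Fin n)) M} (hz : z.base ∈ φ.source)
    (hb : z.base = z'.base) (hc : ∀ j, ∀ i ∈ hatI I j, z.coord φ j i = z'.coord φ j i) : z = z' := by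
  obtain ⟨q, hq, v, rfl⟩ := exists_eq_ofVectors z
  obtain ⟨q', hq', v', rfl⟩ := exists_eq_ofVectors z'
  obtain rfl : q = q' := hb
  have hqφ : q ∈ φ.source := hz
  refine ofVectors_congr fun j => ?_
  rw [h.mem_tangentSubspace_iff_of_mem_iota hM h1 hqφ hq (Submodule.sub_mem _ (v j).2 (v' j).2)]
  intro i hi
  have := hc j i hi
  rw [coord_ofVectors h hq hqφ v hi, coord_ofVectors h hq' hqφ v' hi] at this
  rw [coordDeriv_sub, PiLp.sub_apply, this, sub_self]

/-- The coordinates `x` of the point of the zero section that corresponds to `z`: the coordinate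
`x_i` is `φ_i` of the base point if `i` is in no `I_j`, and `dφ_i` of the `j`-th component for
`i ∈ Î_j`. In the first case the sum is empty, in the second `φ_i` vanishes. -/
def modelCoord (φ : OpenPartialHomeomorph X (EuclideanSpace ℝ (Fin n))) (I : Fin ℓ → Finset (Fin n))
    (z : FiberProduct (EuclideanSpace ℝ (Fin n)) M) : EuclideanSpace ℝ (Fin n) :=
  WithLp.toLp 2 fun i => φ z.base i + ∑ j, if i ∈ hatI I j then z.coord φ j i else 0

theorem modelCoord_of_mem_hatI (h : IsAdaptedChart M φ I)
    (hM : ∀ j, IsClosedSubmanifold (EuclideanSpace ℝ (Fin n)) (M j)) (h1 : H1 M)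
    (h2 : H2 (EuclideanSpace ℝ (Fin n)) M) (z : FiberProduct (EuclideanSpace ℝ (Fin n)) M)
    (hz : z.base ∈ φ.source) {j : Fin ℓ} {i : Fin n} (hi : i ∈ hatI I j) :
    z.modelCoord φ I i = z.coord φ j i := by
  have h3 : φ z.base i = 0 := (h.mem_iff j _ hz).1 (z.base_mem j) i (mem_hatI.1 hi).1
  have h4 : (∑ k, if i ∈ hatI I k then z.coord φ k i else 0) = z.coord φ j i := by
    rw [Finset.sum_eq_single j, if_pos hi]
    · intro k _ hk
      rw [if_neg]
      exact fun hik => hk (h.eq_of_mem_hatI hM h1 h2 hz z.base_mem hik hi)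
    · simp
  change φ z.base i + _ = _
  rw [h3, h4, zero_add]

theorem modelCoord_of_forall_notMem (z : FiberProduct (EuclideanSpace ℝ (Fin n)) M) {i : Fin n}
    (hi : ∀ j, i ∉ I j) : z.modelCoord φ I i = φ z.base i := by
  have : ∀ j, i ∉ hatI I j := fun j h => hi j (mem_hatI.1 h).1
  simp [modelCoord, this]

end FiberProduct

theorem tProd_zero (I : Fin ℓ → Finset (Fin n)) (i : Fin n) [Decidable (∃ j, i ∈ I j)] :
    tProd I 0 i = if ∃ j, i ∈ I j then 0 else 1 := by
  split_ifs with h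
  · obtain ⟨j, hj⟩ := h
    exact Finset.prod_eq_zero (i := j) (by simpa using hj) rfl
  · have : (Finset.univ.filter fun j => i ∈ I j) = ∅ :=
      Finset.filter_eq_empty_iff.2 fun j _ hj => h ⟨j, hj⟩
    rw [tProd, this, Finset.prod_empty]

/-- The point `s` of the zero section has the same fibre coordinates as the element `z` of the fibre
product, in all systems of adapted coordinates. -/
def Corresponds (T : DeformationTower X ℓ) (s : T.space)
    (z : FiberProduct (EuclideanSpace ℝ (Fin n)) M) : Prop :=
  T.p s = z.base ∧ ∀ φ I Ψ, IsAdaptedChart M φ I → IsLocalModel T φ I Ψ → z.base ∈ φ.source →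
    ∀ j, ∀ i ∈ hatI I j, (Ψ s).1 i = z.coord φ j i

/-- It suffices to check the correspondence in one system of coordinates. -/
theorem IsLocalModel.corresponds (hΨ : IsLocalModel T φ I Ψ) (h : IsAdaptedChart M φ I)
    (hM : ∀ j, IsClosedSubmanifold (EuclideanSpace ℝ (Fin n)) (M j)) (h1 : H1 M)
    (h2 : H2 (EuclideanSpace ℝ (Fin n)) M) {s : T.space} (hs : s ∈ T.zeroSection)
    {z : FiberProduct (EuclideanSpace ℝ (Fin n)) M} (hp : T.p s = z.base) (hz : z.base ∈ φ.source)
    (hc : ∀ j, ∀ i ∈ hatI I j, (Ψ s).1 i = z.coord φ j i) : Corresponds T s z := by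
  refine ⟨hp, fun φ' I' Ψ' h' hΨ' hz' j => ?_⟩
  have hb : ((z.1.2 j).1 : X) = z.base := z.2 j
  exact hΨ.coordDeriv_eq hΨ' h h' hM h1 h2 hs (hp.trans hb.symm) (hb ▸ hz) (hb ▸ hz')
    (fun k => hb ▸ z.base_mem k) (Subtype.mem _) (hc j)

/-- The coordinates of a point of the zero section in terms of the corresponding element. -/
theorem Corresponds.coord_eq {s : T.space} {z : FiberProduct (EuclideanSpace ℝ (Fin n)) M}
    (hsz : Corresponds T s z) (hΨ : IsLocalModel T φ I Ψ) (h : IsAdaptedChart M φ I)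
    (hM : ∀ j, IsClosedSubmanifold (EuclideanSpace ℝ (Fin n)) (M j)) (h1 : H1 M)
    (h2 : H2 (EuclideanSpace ℝ (Fin n)) M) (hs : s ∈ T.zeroSection) (hz : z.base ∈ φ.source) :
    s ∈ Ψ.source ∧ Ψ s = (z.modelCoord φ I, 0) := by
  classical
  have hsΨ : s ∈ Ψ.source := by
    rw [hΨ.source_eq]
    exact (hsz.1 ▸ hz : T.p s ∈ φ.source)
  have h0 : (Ψ s).2 = 0 := funext fun j => by rw [hΨ.snd_eq s hsΨ, hs j]; rfl
  refine ⟨hsΨ, Prod.ext ?_ h0⟩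
  ext i
  by_cases hi : ∃ j, i ∈ I j
  · obtain ⟨k, hk⟩ := hi
    obtain ⟨j, hj⟩ := exists_mem_hatI hk
    rw [hsz.2 φ I Ψ h hΨ hz j i hj, z.modelCoord_of_mem_hatI h hM h1 h2 hz hj]
  · have h3 := hΨ.p_eq s hsΨ i
    rw [h0, tProd_zero, if_neg hi, one_mul, hsz.1] at h3
    rw [z.modelCoord_of_forall_notMem (not_exists.1 hi), h3]

/-- Every element of the fibre product corresponds to a point of the zero section. -/
theorem IsLocalModel.exists_point (hΨ : IsLocalModel T φ I Ψ) (h : IsAdaptedChart M φ I)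
    (hM : ∀ j, IsClosedSubmanifold (EuclideanSpace ℝ (Fin n)) (M j)) (h1 : H1 M)
    (h2 : H2 (EuclideanSpace ℝ (Fin n)) M) (z : FiberProduct (EuclideanSpace ℝ (Fin n)) M)
    (hz : z.base ∈ φ.source) : ∃ s ∈ T.zeroSection, Corresponds T s z := by
  classical
  have hmul : ∀ i, tProd I 0 i * z.modelCoord φ I i = φ z.base i := by
    intro i
    rw [tProd_zero]
    split_ifs with hi
    · obtain ⟨j, hj⟩ := hi
      rw [zero_mul, (h.mem_iff j _ hz).1 (z.base_mem j) i hj]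
    · rw [one_mul, z.modelCoord_of_forall_notMem (not_exists.1 hi)]
  have ht : (z.modelCoord φ I, (0 : Fin ℓ → ℝ)) ∈ Ψ.target := by
    rw [hΨ.target_eq]
    have : (WithLp.toLp 2 fun i => tProd I 0 i * z.modelCoord φ I i) = φ z.base := by
      ext i; exact hmul i
    change WithLp.toLp 2 (fun i => tProd I 0 i * z.modelCoord φ I i) ∈ φ.target
    rw [this]
    exact φ.map_source hz
  have hsΨ := Ψ.map_target ht
  have hr := Ψ.right_inv ht
  have hs : Ψ.symm (z.modelCoord φ I, 0) ∈ T.zeroSection := fun j => by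
    rw [← hΨ.snd_eq _ hsΨ, hr]; rfl
  have hp : T.p (Ψ.symm (z.modelCoord φ I, 0)) = z.base := by
    refine φ.injOn (by rw [hΨ.source_eq] at hsΨ; exact hsΨ) hz ?_
    ext i
    rw [hΨ.p_eq _ hsΨ, hr, hmul]
  refine ⟨_, hs, hΨ.corresponds h hM h1 h2 hs hp hz fun j i hi => ?_⟩
  rw [hr, z.modelCoord_of_mem_hatI h hM h1 h2 hz hi]

/-- The tangent vector at `q` with the coordinates `w_i`, `i ∈ Î_j`, and otherwise zero, is tangent to
`ι(M_j)`. -/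
theorem IsAdaptedChart.mem_tangentSubspace_iota_of_coord (h : IsAdaptedChart M φ I)
    (hM : ∀ j, IsClosedSubmanifold (EuclideanSpace ℝ (Fin n)) (M j)) (h1 : H1 M) {q : X}
    (hq : q ∈ φ.source) (hqM : ∀ j, q ∈ M j) {j : Fin ℓ}
    {v : TangentSpace 𝓘(ℝ, EuclideanSpace ℝ (Fin n)) q} {w : EuclideanSpace ℝ (Fin n)}
    (hv : coordDeriv φ q v = coordProj (hatI I j) w) : v ∈ tangentSubspace (iota M j) q := by
  rw [h.mem_tangentSubspace_iota_iff hq hqM]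
  intro k hk i hi
  rw [hv, coordProj_apply, if_neg]
  exact fun hij => (mem_hatI.1 hij).2 k ((h.ssubset_iff hM h1 hq hqM).1 hk) hi

/-- Every point of the zero section over `⋂ j, M_j` corresponds to an element of the fibre product. -/
theorem IsLocalModel.exists_element (hΨ : IsLocalModel T φ I Ψ) (h : IsAdaptedChart M φ I)
    (hM : ∀ j, IsClosedSubmanifold (EuclideanSpace ℝ (Fin n)) (M j)) (h1 : H1 M)
    (h2 : H2 (EuclideanSpace ℝ (Fin n)) M) {s : T.space} (hs : s ∈ T.zeroSection)
    (hsM : ∀ j, T.p s ∈ M j) (hsφ : T.p s ∈ φ.source) :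
    ∃ z : FiberProduct (EuclideanSpace ℝ (Fin n)) M, Corresponds T s z := by
  choose v hv using fun j => h.coordDeriv_surjective hsφ (coordProj (hatI I j) (Ψ s).1)
  refine ⟨FiberProduct.ofVectors (T.p s) hsM fun j =>
    ⟨v j, h.mem_tangentSubspace_iota_of_coord hM h1 hsφ hsM (hv j)⟩, ?_⟩
  refine hΨ.corresponds h hM h1 h2 hs rfl hsφ fun j i hi => ?_
  rw [FiberProduct.coord_ofVectors h hsM hsφ _ hi, hv, coordProj_apply, if_pos hi]

end Correspondence

/-! ### The isomorphism -/

section Isomorphism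
variable {n ℓ : ℕ} {X : Type u} [TopologicalSpace X] [ChartedSpace (EuclideanSpace ℝ (Fin n)) X]
  [IsManifold 𝓘(ℝ, EuclideanSpace ℝ (Fin n)) ω X]
  {M : Fin ℓ → Set X} {T : DeformationTower X ℓ}
  {φ : OpenPartialHomeomorph X (EuclideanSpace ℝ (Fin n))} {I : Fin ℓ → Finset (Fin n)}
  {Ψ : OpenPartialHomeomorph T.space (EuclideanSpace ℝ (Fin n) × (Fin ℓ → ℝ))}

theorem nonempty_multiNormalDeformation [Nonempty X] : ∀ (ℓ : ℕ) (M : Fin ℓ → Set X),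
    Nonempty (multiNormalDeformation (EuclideanSpace ℝ (Fin n)) X ℓ M).space
  | 0, _ => (inferInstance : Nonempty X)
  | ℓ + 1, M => by
    obtain ⟨y⟩ := nonempty_multiNormalDeformation ℓ fun j => M j.castSucc
    let T := multiNormalDeformation (EuclideanSpace ℝ (Fin n)) X ℓ fun j => M j.castSucc
    exact ⟨(NormalDeformation.off y 1 one_ne_zero :
      NormalDeformation T.space.Model (T.strictPreimage (M (Fin.last ℓ))))⟩

theorem contMDiffOn_coordDeriv (h : φ ∈ IsManifold.maximalAtlas 𝓘(ℝ, EuclideanSpace ℝ (Fin n)) ω X) :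
    ContMDiffOn 𝓘(ℝ, EuclideanSpace ℝ (Fin n)).tangent 𝓘(ℝ, EuclideanSpace ℝ (Fin n)) ω
      (fun w : TangentBundle 𝓘(ℝ, EuclideanSpace ℝ (Fin n)) X => coordDeriv φ w.1 w.2)
      {w | w.1 ∈ φ.source} :=
  (contMDiff_snd_tangentBundle_modelSpace (EuclideanSpace ℝ (Fin n))
    𝓘(ℝ, EuclideanSpace ℝ (Fin n))).comp_contMDiffOn (contMDiffOn_tangentMap h)

/-- The bijection between the zero section and the fibre product. -/
theorem exists_equiv_corresponds
    (hM : ∀ j, IsClosedSubmanifold (EuclideanSpace ℝ (Fin n)) (M j)) (h1 : H1 M)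
    (h2 : H2 (EuclideanSpace ℝ (Fin n)) M) :
    ∃ Φ : (multiNormalDeformation (EuclideanSpace ℝ (Fin n)) X ℓ M).zeroSection ≃
        FiberProduct (EuclideanSpace ℝ (Fin n)) M,
      ∀ s : (multiNormalDeformation (EuclideanSpace ℝ (Fin n)) X ℓ M).zeroSection,
        Corresponds (multiNormalDeformation (EuclideanSpace ℝ (Fin n)) X ℓ M) s (Φ s) := by
  let T := multiNormalDeformation (EuclideanSpace ℝ (Fin n)) X ℓ M
  have hex : ∀ s : T.zeroSection, ∃ z : FiberProduct (EuclideanSpace ℝ (Fin n)) M,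
      Corresponds T s z := by
    intro s
    have hsM : ∀ j, T.p s ∈ M j := fun j =>
      p_mem_of_t_eq_zero (EuclideanSpace ℝ (Fin n)) X ℓ M (fun k => (hM k).isClosed) j s (s.2 j)
    obtain ⟨φ, I, h, hsφ⟩ := exists_isAdaptedChart hM h1.2 h2 hsM
    obtain ⟨Ψ, hΨ⟩ := exists_isLocalModel φ ℓ M I h
    exact hΨ.exists_element h hM h1 h2 s.2 hsM hsφ
  choose f hf using hex
  refine ⟨Equiv.ofBijective f ⟨fun s s' hss => ?_, fun z => ?_⟩, hf⟩
  · obtain ⟨φ, I, h, hsφ⟩ := exists_isAdaptedChart hM h1.2 h2 (f s).base_mem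
    obtain ⟨Ψ, hΨ⟩ := exists_isLocalModel φ ℓ M I h
    obtain ⟨m1, e1⟩ := (hf s).coord_eq hΨ h hM h1 h2 s.2 hsφ
    obtain ⟨m2, e2⟩ := (hf s').coord_eq hΨ h hM h1 h2 s'.2 (hss ▸ hsφ)
    exact Subtype.ext (Ψ.injOn m1 m2 (by rw [e1, e2, hss]))
  · obtain ⟨φ, I, h, hzφ⟩ := exists_isAdaptedChart hM h1.2 h2 z.base_mem
    obtain ⟨Ψ, hΨ⟩ := exists_isLocalModel φ ℓ M I h
    obtain ⟨s, hs, hsz⟩ := hΨ.exists_point h hM h1 h2 z hzφ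
    have hb : (f ⟨s, hs⟩).base = z.base := (hf ⟨s, hs⟩).1.symm.trans hsz.1
    refine ⟨⟨s, hs⟩, FiberProduct.ext_coord h hM h1 (hb ▸ hzφ) hb fun j i hi => ?_⟩
    rw [← (hf ⟨s, hs⟩).2 φ I Ψ h hΨ (hb ▸ hzφ) j i hi, ← hsz.2 φ I Ψ h hΨ hzφ j i hi]

/-- The projection to `X` in a local model is analytic. -/
theorem contDiff_blowDown (I : Fin ℓ → Finset (Fin n)) :
    ContDiff ℝ ω fun z : EuclideanSpace ℝ (Fin n) × (Fin ℓ → ℝ) =>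
      (WithLp.toLp 2 fun i => tProd I z.2 i * z.1 i : EuclideanSpace ℝ (Fin n)) := by
  rw [contDiff_euclidean]
  intro i
  refine ContDiff.mul ?_ (contDiff_euclidean.1 contDiff_fst i)
  unfold tProd
  exact contDiff_prod fun j _ => contDiff_pi.1 contDiff_snd j

/-- In adapted coordinates, the classes `Φ s` have representatives that depend analytically on `s`: the
vectors with coordinates `x_i`, `i ∈ Î_j`, and otherwise zero. -/
theorem IsLocalModel.exists_representatives (hΨ : IsLocalModel T φ I Ψ) (h : IsAdaptedChart M φ I)
    (hM : ∀ j, IsClosedSubmanifold (EuclideanSpace ℝ (Fin n)) (M j)) (h1 : H1 M)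
    {Φ : T.zeroSection ≃ FiberProduct (EuclideanSpace ℝ (Fin n)) M}
    (hΦ : ∀ s : T.zeroSection, Corresponds T s (Φ s)) :
    ∃ σ : T.space → X × (Fin ℓ → TangentBundle 𝓘(ℝ, EuclideanSpace ℝ (Fin n)) X),
      ContMDiffOn 𝓘(ℝ, T.space.Model) (𝓘(ℝ, EuclideanSpace ℝ (Fin n)).prod
        (ModelWithCorners.pi fun _ : Fin ℓ => 𝓘(ℝ, EuclideanSpace ℝ (Fin n)).tangent)) ω σ
        Ψ.source ∧
      ∀ s : T.zeroSection, (s : T.space) ∈ Ψ.source → FiberProduct.Represents (σ s) (Φ s) := by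
  have hmem : ∀ y ∈ Ψ.source, T.p y ∈ φ.source := fun y hy => by
    rw [hΨ.source_eq] at hy; exact hy
  let d : EuclideanSpace ℝ (Fin n) × (Fin ℓ → ℝ) → EuclideanSpace ℝ (Fin n) := fun z =>
    WithLp.toLp 2 fun i => tProd I z.2 i * z.1 i
  have hd : ContMDiffOn 𝓘(ℝ, T.space.Model) 𝓘(ℝ, EuclideanSpace ℝ (Fin n)) ω
      (fun y => d (Ψ y)) Ψ.source :=
    (contDiff_blowDown I).contMDiff.comp_contMDiffOn hΨ.contMDiffOn
  have hdp : ∀ y ∈ Ψ.source, d (Ψ y) = φ (T.p y) := fun y hy => by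
    ext i; exact (hΨ.p_eq y hy i).symm
  refine ⟨fun y => (φ.symm (d (Ψ y)), fun j => tangentMap 𝓘(ℝ, EuclideanSpace ℝ (Fin n))
    𝓘(ℝ, EuclideanSpace ℝ (Fin n)) φ.symm
      (⟨d (Ψ y), coordProj (hatI I j) (Ψ y).1⟩ :
        TangentBundle 𝓘(ℝ, EuclideanSpace ℝ (Fin n)) (EuclideanSpace ℝ (Fin n)))), ?_, ?_⟩
  · have ht : ∀ y ∈ Ψ.source, d (Ψ y) ∈ φ.target := fun y hy => by
      rw [hdp y hy]; exact φ.map_source (hmem y hy)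
    refine ContMDiffOn.prodMk ?_ fun y hy => contMDiffWithinAt_pi_manifold.2 fun j => ?_
    · exact (contMDiffOn_symm_of_mem_maximalAtlas h.mem_maximalAtlas).comp hd ht
    · have hc : ContMDiffOn 𝓘(ℝ, T.space.Model) 𝓘(ℝ, EuclideanSpace ℝ (Fin n)) ω
          (fun y => coordProj (hatI I j) (Ψ y).1) Ψ.source :=
        ((coordProj (hatI I j)).contDiff.comp contDiff_fst).contMDiff.comp_contMDiffOn
          hΨ.contMDiffOn
      exact (contMDiffOn_tangentMap_symm h.mem_maximalAtlas).comp
        (contMDiffOn_mk_tangentBundle hd hc) ht y hy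
  · intro s hs
    have hz : (Φ s).base ∈ φ.source := (hΦ s).1 ▸ hmem _ hs
    refine ⟨?_, fun j => ?_⟩
    · change φ.symm (d (Ψ s)) = _
      rw [hdp _ hs, φ.left_inv (hmem _ hs), (hΦ s).1]
    have hb : (((Φ s).1.2 j).1 : X) = (Φ s).base := (Φ s).2 j
    have hq : (((Φ s).1.2 j).1 : X) ∈ φ.source := hb ▸ hz
    have hqM : ∀ k, (((Φ s).1.2 j).1 : X) ∈ M k := fun k => hb ▸ (Φ s).base_mem k
    obtain ⟨v, hv⟩ := h.coordDeriv_surjective hq (coordProj (hatI I j) (Ψ s).1)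
    have hvι := h.mem_tangentSubspace_iota_of_coord hM h1 hq hqM hv
    obtain ⟨u, hu⟩ := Submodule.Quotient.mk_surjective _ ((Φ s).1.2 j).2
    refine ⟨⟨v, hvι⟩, ?_, ?_⟩
    · rw [← hu, Submodule.Quotient.eq]
      change v - (u : TangentSpace 𝓘(ℝ, EuclideanSpace ℝ (Fin n)) _) ∈ tangentSubspace (M j) _
      rw [h.mem_tangentSubspace_iff_of_mem_iota hM h1 hq hqM (Submodule.sub_mem _ hvι u.2)]
      intro i hi
      rw [coordDeriv_sub, PiLp.sub_apply, hv, coordProj_apply, if_pos hi,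
        ← FiberProduct.coord_eq h _ hz u hu hi, ← (hΦ s).2 φ I Ψ h hΨ hz j i hi, sub_self]
    · have hp : d (Ψ s) = φ ((Φ s).1.2 j).1 := by rw [hdp _ hs, hb, (hΦ s).1]
      change tangentMap _ _ φ.symm (⟨d (Ψ s), _⟩ : TangentBundle 𝓘(ℝ, EuclideanSpace ℝ (Fin n))
        (EuclideanSpace ℝ (Fin n))) = _
      rw [hp]
      exact totalSpace_mk_symm_mfderiv h.mem_maximalAtlas hq v _ hv

/-- In adapted coordinates, the inverse of `Φ` is an analytic function of representatives: their fibre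
coordinates and the coordinates of the base point are the coordinates of the point of `S`. -/
theorem IsLocalModel.exists_symm_of_representatives (hΨ : IsLocalModel T φ I Ψ)
    (h : IsAdaptedChart M φ I)
    (hM : ∀ j, IsClosedSubmanifold (EuclideanSpace ℝ (Fin n)) (M j)) (h1 : H1 M)
    (h2 : H2 (EuclideanSpace ℝ (Fin n)) M)
    {Φ : T.zeroSection ≃ FiberProduct (EuclideanSpace ℝ (Fin n)) M}
    (hΦ : ∀ s : T.zeroSection, Corresponds T s (Φ s)) :
    ∃ g : X × (Fin ℓ → TangentBundle 𝓘(ℝ, EuclideanSpace ℝ (Fin n)) X) → T.space,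
      ContMDiffOn (𝓘(ℝ, EuclideanSpace ℝ (Fin n)).prod
        (ModelWithCorners.pi fun _ : Fin ℓ => 𝓘(ℝ, EuclideanSpace ℝ (Fin n)).tangent))
        𝓘(ℝ, T.space.Model) ω g {w | w.1 ∈ φ.source ∧
          ∃ z : FiberProduct (EuclideanSpace ℝ (Fin n)) M, FiberProduct.Represents w z} ∧
      ∀ w z, w.1 ∈ φ.source → FiberProduct.Represents w z → g w = (Φ.symm z : T.space) := by
  let m : X × (Fin ℓ → TangentBundle 𝓘(ℝ, EuclideanSpace ℝ (Fin n)) X) →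
      EuclideanSpace ℝ (Fin n) × (Fin ℓ → ℝ) := fun w =>
    (φ w.1 + ∑ j, coordProj (hatI I j) (coordDeriv φ (w.2 j).1 (w.2 j).2), 0)
  have hm : ∀ w z, w.1 ∈ φ.source → FiberProduct.Represents w z →
      (Φ.symm z : T.space) ∈ Ψ.source ∧ m w = Ψ (Φ.symm z) := by
    intro w z hw hwz
    have hz : z.base ∈ φ.source := hwz.1 ▸ hw
    have hc : Corresponds T (Φ.symm z) z := by
      have := hΦ (Φ.symm z)
      rwa [Φ.apply_symm_apply] at this
    obtain ⟨h3, h4⟩ := hc.coord_eq hΨ h hM h1 h2 (Φ.symm z).2 hz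
    refine ⟨h3, h4 ▸ Prod.ext ?_ rfl⟩
    ext i
    change (φ w.1 + ∑ j, coordProj (hatI I j) (coordDeriv φ (w.2 j).1 (w.2 j).2)) i =
        φ z.base i + ∑ j, if i ∈ hatI I j then z.coord φ j i else 0
    rw [PiLp.add_apply, WithLp.ofLp_sum, Finset.sum_apply, hwz.1]
    congr 1
    refine Finset.sum_congr rfl fun j _ => ?_
    rw [coordProj_apply]
    split_ifs with hi
    · obtain ⟨v, hv, hwv⟩ := hwz.2 j
      rw [FiberProduct.coord_eq h z hz v hv hi, hwv]
    · rfl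
  let S := {w : X × (Fin ℓ → TangentBundle 𝓘(ℝ, EuclideanSpace ℝ (Fin n)) X) | w.1 ∈ φ.source ∧
    ∃ z : FiberProduct (EuclideanSpace ℝ (Fin n)) M, FiberProduct.Represents w z}
  refine ⟨fun w => Ψ.symm (m w), ?_, fun w z hw hwz => ?_⟩
  · refine hΨ.contMDiffOn_symm.comp ?_ ?_
    · rintro w ⟨hw, z, hwz⟩
      have hwj : ∀ j, (w.2 j).1 ∈ φ.source := fun j => by
        obtain ⟨v, -, hwv⟩ := hwz.2 j
        rw [hwv]
        have : ((z.1.2 j).1 : X) = w.1 := (z.2 j).trans hwz.1.symm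
        exact (this ▸ hw : ((z.1.2 j).1 : X) ∈ φ.source)
      have hf : ContMDiffWithinAt (𝓘(ℝ, EuclideanSpace ℝ (Fin n)).prod
          (ModelWithCorners.pi fun _ : Fin ℓ => 𝓘(ℝ, EuclideanSpace ℝ (Fin n)).tangent))
          𝓘(ℝ, EuclideanSpace ℝ (Fin n)) ω
          (fun w : X × (Fin ℓ → TangentBundle 𝓘(ℝ, EuclideanSpace ℝ (Fin n)) X) => φ w.1) S w :=
        ((contMDiffOn_of_mem_maximalAtlas h.mem_maximalAtlas).contMDiffAt
          (φ.open_source.mem_nhds hw)).comp_contMDiffWithinAt w contMDiffWithinAt_fst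
      have hv : ∀ j, ContMDiffWithinAt (𝓘(ℝ, EuclideanSpace ℝ (Fin n)).prod
          (ModelWithCorners.pi fun _ : Fin ℓ => 𝓘(ℝ, EuclideanSpace ℝ (Fin n)).tangent))
          𝓘(ℝ, EuclideanSpace ℝ (Fin n)) ω
          (fun w : X × (Fin ℓ → TangentBundle 𝓘(ℝ, EuclideanSpace ℝ (Fin n)) X) =>
            coordProj (hatI I j) (coordDeriv φ (w.2 j).1 (w.2 j).2)) S w := by
        intro j
        have e1 : ContMDiffWithinAt (𝓘(ℝ, EuclideanSpace ℝ (Fin n)).prod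
            (ModelWithCorners.pi fun _ : Fin ℓ => 𝓘(ℝ, EuclideanSpace ℝ (Fin n)).tangent))
            𝓘(ℝ, EuclideanSpace ℝ (Fin n)).tangent ω
            (fun w : X × (Fin ℓ → TangentBundle 𝓘(ℝ, EuclideanSpace ℝ (Fin n)) X) => w.2 j) S w :=
          ((contMDiff_apply_manifold j).contMDiffAt).comp_contMDiffWithinAt w contMDiffWithinAt_snd
        have e2 : {w : TangentBundle 𝓘(ℝ, EuclideanSpace ℝ (Fin n)) X | w.1 ∈ φ.source} ∈
            𝓝 (w.2 j) :=
          (φ.open_source.preimage (FiberBundle.continuous_proj (EuclideanSpace ℝ (Fin n))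
            (TangentSpace 𝓘(ℝ, EuclideanSpace ℝ (Fin n))))).mem_nhds (hwj j)
        have e3 := ((contMDiffOn_coordDeriv h.mem_maximalAtlas).contMDiffAt
          e2).comp_contMDiffWithinAt w e1
        exact (coordProj (hatI I j)).contDiff.contMDiff.contMDiffAt.comp_contMDiffWithinAt w e3
      exact (hf.add (contMDiffWithinAt_finsetSum fun j _ => hv j)).prodMk_space
        contMDiffWithinAt_const
    · rintro w ⟨hw, z, hwz⟩
      obtain ⟨h3, h4⟩ := hm w z hw hwz
      change m w ∈ Ψ.target
      rw [h4]
      exact Ψ.map_source h3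
  · obtain ⟨h3, h4⟩ := hm w z hw hwz
    change Ψ.symm (m w) = _
    rw [h4, Ψ.left_inv h3]

end Isomorphism

end

end MultiNormal

theorem proposition1p5 {n ℓ : ℕ} {X : Type u} [TopologicalSpace X] [T2Space X] [SigmaCompactSpace X]
    [ChartedSpace (EuclideanSpace ℝ (Fin n)) X]
    [IsManifold 𝓘(ℝ, EuclideanSpace ℝ (Fin n)) ω X]
    (M : Fin ℓ → Set X)
    (hM : ∀ j, IsClosedSubmanifold (EuclideanSpace ℝ (Fin n)) (M j))
    (h1 : H1 M) (h2 : H2 (EuclideanSpace ℝ (Fin n)) M) (h3 : H3 M) :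
    ∃ Φ : (multiNormalDeformation (EuclideanSpace ℝ (Fin n)) X ℓ M).zeroSection ≃
        FiberProduct (EuclideanSpace ℝ (Fin n)) M,
      IsAnalyticIso Φ ∧
      (∀ s, (Φ s).base = (multiNormalDeformation (EuclideanSpace ℝ (Fin n)) X ℓ M).p s) ∧
      (∀ q ∈ ⋂ j, M j, ∃ (φ : OpenPartialHomeomorph X (EuclideanSpace ℝ (Fin n)))
        (I : Fin ℓ → Finset (Fin n)), IsAdaptedChart M φ I ∧ q ∈ φ.source) ∧
      ∀ (φ : OpenPartialHomeomorph X (EuclideanSpace ℝ (Fin n))) (I : Fin ℓ → Finset (Fin n)),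
        IsAdaptedChart M φ I → ∃ Ψ,
          IsLocalModel (multiNormalDeformation (EuclideanSpace ℝ (Fin n)) X ℓ M) φ I Ψ ∧
          AgreesInCoordinates _ φ I Ψ Φ := by

  obtain ⟨Φ, hΦ⟩ := exists_equiv_corresponds hM h1 h2
  refine ⟨Φ, ⟨fun s => ?_, ?_⟩, fun s => (hΦ s).1.symm,
    fun q hq => exists_isAdaptedChart hM h1.2 h2 (mem_iInter.1 hq), fun φ I h => ?_⟩
  · obtain ⟨φ, I, h, hsφ⟩ := exists_isAdaptedChart hM h1.2 h2 (Φ s).base_mem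
    obtain ⟨Ψ, hΨ⟩ := exists_isLocalModel φ ℓ M I h
    obtain ⟨σ, hσ, hσΦ⟩ := hΨ.exists_representatives h hM h1 hΦ
    have hs := ((hΦ s).coord_eq hΨ h hM h1 h2 s.2 hsφ).1
    exact ⟨Ψ.source, Ψ.open_source.mem_nhds hs, σ, hσ.mono inter_subset_left, hσΦ⟩
  · have hloc : ∀ z : FiberProduct (EuclideanSpace ℝ (Fin n)) M, ∃ V : Set X, IsOpen V ∧ z.base ∈ V ∧
        ∃ g : X × (Fin ℓ → TangentBundle 𝓘(ℝ, EuclideanSpace ℝ (Fin n)) X) →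
          (multiNormalDeformation (EuclideanSpace ℝ (Fin n)) X ℓ M).space,
        ContMDiffOn (𝓘(ℝ, EuclideanSpace ℝ (Fin n)).prod
          (ModelWithCorners.pi fun _ : Fin ℓ => 𝓘(ℝ, EuclideanSpace ℝ (Fin n)).tangent))
          𝓘(ℝ, (multiNormalDeformation (EuclideanSpace ℝ (Fin n)) X ℓ M).space.Model) ω g
          {w | w.1 ∈ V ∧
            ∃ z : FiberProduct (EuclideanSpace ℝ (Fin n)) M, FiberProduct.Represents w z} ∧
        ∀ w z, w.1 ∈ V → FiberProduct.Represents w z →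
          g w = (Φ.symm z : (multiNormalDeformation (EuclideanSpace ℝ (Fin n)) X ℓ M).space) := by
      intro z
      obtain ⟨φ, I, h, hzφ⟩ := exists_isAdaptedChart hM h1.2 h2 z.base_mem
      obtain ⟨Ψ, hΨ⟩ := exists_isLocalModel φ ℓ M I h
      exact ⟨φ.source, φ.open_source, hzφ, hΨ.exists_symm_of_representatives h hM h1 h2 hΦ⟩
    have hex : ∀ w : X × (Fin ℓ → TangentBundle 𝓘(ℝ, EuclideanSpace ℝ (Fin n)) X),
        ∃ y : (multiNormalDeformation (EuclideanSpace ℝ (Fin n)) X ℓ M).space,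
          ∀ z, FiberProduct.Represents w z → y = Φ.symm z := by
      intro w
      by_cases hw : ∃ z : FiberProduct (EuclideanSpace ℝ (Fin n)) M, FiberProduct.Represents w z
      · obtain ⟨z, hz⟩ := hw
        obtain ⟨V, -, hzV, g, -, hg⟩ := hloc z
        exact ⟨g w, fun z' hz' => hg w z' (hz.1 ▸ hzV) hz'⟩
      · have : Nonempty X := ⟨w.1⟩
        obtain ⟨y⟩ := nonempty_multiNormalDeformation (n := n) ℓ M
        exact ⟨y, fun z hz => (hw ⟨z, hz⟩).elim⟩
    -- The local inverses agree where representatives exist; the value of `g` elsewhere is irrelevant.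
    choose g hg using hex
    refine ⟨g, ?_, hg⟩
    rintro w ⟨z, hwz⟩
    obtain ⟨V, hV, hzV, g', hg'a, hg'⟩ := hloc z
    have hwV : w.1 ∈ V := hwz.1 ▸ hzV
    have hmem := (hV.preimage continuous_fst).mem_nhds (show w ∈ Prod.fst ⁻¹' V from hwV)
    refine (contMDiffWithinAt_inter' (mem_nhdsWithin_of_mem_nhds hmem)).1 ?_
    refine ContMDiffWithinAt.congr ((hg'a w ⟨hwV, z, hwz⟩).mono ?_) ?_ ?_
    · exact fun w' hw' => ⟨hw'.2, hw'.1⟩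
    · rintro w' ⟨⟨z', hz'⟩, hw'⟩
      rw [hg w' z' hz', hg' w' z' hw' hz']
    · rw [hg w z hwz, hg' w z hwV hwz]
  · obtain ⟨Ψ, hΨ⟩ := exists_isLocalModel φ ℓ M I h
    refine ⟨Ψ, hΨ, fun s hs j v hv i hi => ?_⟩
    have hz : (Φ s).base ∈ φ.source := by
      rw [← (hΦ s).1]
      rw [hΨ.source_eq] at hs
      exact hs
    have hq : (((Φ s).1.2 j).1 : X) ∈ φ.source := ((Φ s).2 j : _ = (Φ s).base) ▸ hz
    rw [h.mfderiv_coord_apply hq, ← FiberProduct.coord_eq h _ hz v hv hi]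
    exact (hΦ s).2 φ I Ψ h hΨ hz j i hi
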